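/- **Theorem 1.2.** Let $n \ge 8$ be an integer with $n \equiv 0 \pmod 4$, let $s$ be an integer with $s^2 \equiv 1 \pmod n$ and $s \not\equiv \pm 1 \pmod n$, and let $$G = \langle x, y \mid x^2 = y^{n/2},\ y^n = 1,\ yx = xy^s \rangle .$$ A sequence over $G$ is a finite unordered sequence of elements of $G$ with repetition allowed (a multiset); sequences are concatenated with $\cdot$, $g^{[k]}$ is the term $g$ repeated $k$ times, and $|S|$ is the length of $S$. A sequence is *product-one* if its terms can be ordered so that their product is $1$. A sequence is *$k$-product-one free* if it has no product-one subsequence of length $k$, *product-one free* if it has no non-empty product-one subsequence, and *short product-one free* if it has no product-one subsequence of length in $[1, \exp(G)]$, where $\exp(G)$ is the exponent of $G$. Call $(\alpha,\beta) \in G^2$ a *defining pair* if $G = \langle \alpha, \beta \mid \alpha^2 = \beta^{n/2},\ \beta^n = 1,\ \beta\alpha = \alpha\beta^s \rangle$, that is, if $\alpha,\beta$ generate $G$ and these relations define $G$. Let $S$ be a sequence over $G$. (a) If $|S| = 2n-1$, then $S$ is $n$-product-one free if and only if there exist a defining pair $(\alpha,\beta)$ and $t_1,t_2,t_3 \in \mathbb{Z}$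 with $\gcd(t_1-t_2,n)=1$ and $$S = (\beta^{t_1})^{[n-1]} \cdot (\beta^{t_2})^{[n-1]} \cdot (\alpha\beta^{t_3}).$$ (b) If $|S| = 3n-1$, then $S$ is $2n$-product-one free if and only if there exist a defining pair $(\alpha,\beta)$ and $t_1,t_2,t_3 \in \mathbb{Z}$ with $\gcd(t_1-t_2,n)=1$ and $$S = (\beta^{t_1})^{[2n-1]} \cdot (\beta^{t_2})^{[n-1]} \cdot (\alpha\beta^{t_3}).$$ (c) If $|S| = n$, then $S$ is product-one free if and only if there exist a defining pair $(\alpha,\beta)$ and $t \in \mathbb{Z}$ with $$S = \beta^{[n-1]} \cdot (\alpha\beta^{t}),$$ and the same equivalence holds with "short product-one free" in place of "product-one free". -/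

import Mathlib

/-- The relators of `⟨x, y ∣ x² = y^(n/2), yⁿ = 1, y x = x y^s⟩`, as words in the free group on
two letters; letter `0` is `x` and letter `1` is `y`. -/
def relators (n : ℕ) (s : ℤ) : Set (FreeGroup (Fin 2)) :=
  let x : FreeGroup (Fin 2) := FreeGroup.of 0
  let y : FreeGroup (Fin 2) := FreeGroup.of 1
  {x ^ 2 * (y ^ (n / 2))⁻¹, y ^ n, (y * x) * (x * y ^ s)⁻¹}

/-- `G = ⟨α, β ∣ α² = β^(n/2), βⁿ = 1, β α = α β^s⟩`: the elements `α`, `β` generate `G`, and the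
relations between them are exactly the consequences of the three displayed ones. -/
def IsPresentedBy {G : Type*} [Group G] (n : ℕ) (s : ℤ) (α β : G) : Prop :=
  Function.Surjective (FreeGroup.lift ![α, β]) ∧
    (FreeGroup.lift ![α, β]).ker = Subgroup.normalClosure (relators n s)

/-- `π(S)`: the set of products of all terms of `S`, over all orderings of the terms. A sequence
over `G` (an unordered one, with repetition allowed) is a `Multiset G`. -/
def products {G : Type*} [Group G] (S : Multiset G) : Set G :=
  {g | ∃ l : List G, (l : Multiset G) = S ∧ l.prod = g}

/-- `Π(S)`: the union of `π(T)` over the non-empty subsequences `T` of `S`. -/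
def subproducts {G : Type*} [Group G] (S : Multiset G) : Set G :=
  {g | ∃ T : Multiset G, T ≤ S ∧ 1 ≤ T.card ∧ g ∈ products T}

/-- `Π_k(S)`: the union of `π(T)` over the subsequences `T` of `S` of length `k`. -/
def subproductsOfLength {G : Type*} [Group G] (k : ℕ) (S : Multiset G) : Set G :=
  {g | ∃ T : Multiset G, T ≤ S ∧ T.card = k ∧ g ∈ products T}

/-- `S` is product-one free. -/
def ProductOneFree {G : Type*} [Group G] (S : Multiset G) : Prop :=
  (1 : G) ∉ subproducts S

/-- `S` is `k`-product-one free. -/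
def ProductOneFreeOfLength {G : Type*} [Group G] (k : ℕ) (S : Multiset G) : Prop :=
  (1 : G) ∉ subproductsOfLength k S

/-- `S` is short product-one free: no product-one subsequence of length in `[1, exp(G)]`. -/
def ShortProductOneFree {G : Type*} [Group G] (S : Multiset G) : Prop :=
  ∀ j ∈ Set.Icc 1 (Monoid.exponent G), (1 : G) ∉ subproductsOfLength j S

/-! Put m = n/2. Since s is odd, G maps onto the Klein four-group with kernel K = ⟨y²⟩, cyclic of
order m.

Part (a). Group the terms of S, of length 4m - 1, into pairs lying in the same coset of K, as far as
possible. At most four terms remain, in distinct cosets, and an odd number of them. Pair products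
lie in K, so 2m - 1 pairs would give a product-one subsequence of length 2m = n by
Erdős–Ginzburg–Ziv. Hence there are 2m - 2 pairs and three leftover terms, and the inverse
Erdős–Ginzburg–Ziv theorem (`inverseEGZ_of_orderOf`) makes the pair products take two values u, v,
each m - 1 times, with u v⁻¹ generating K.

This is rigid in two ways. Replacing one pair cannot change its product (`Pairing.mul_eq_mul`), so
paired terms commute and a leftover term in the coset of a pair equals both its terms. Moreover,
four terms with product in K, completed by pairs of products u and v, must have product u v
(`FreeConfig.prod_eq_mul`), in every order; this yields commutation relations.

If K is not central, these relations allow at most one term outside ⟨y⟩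
(`FreeConfig.commute_of_two_le`), and inverse Erdős–Ginzburg–Ziv in ⟨y⟩ describes the others. If K
is central, elements in different nontrivial cosets never commute, and the relations leave only S =
a^[n-1] b^[n-1] c with a in K and b, c in different nontrivial cosets
(`FreeConfig.exists_eq_of_central`). Then β = b a⁻¹ has order n and is completed to a defining pair
(`exists_pair_of_central`).

Part (c) is part (a) for S padded by n - 1 copies of 1. For part (b), every sequence of length 2n
has a product-one subsequence of length n; removing one from S leaves a sequence as in (a). Varying
what is removed bounds the values of S to three and fixes their multiplicities
(`multiplicities_eq`).

Inverse Erdős–Ginzburg–Ziv is proved for prime order by Cauchy–Davenport and in general by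
induction, splitting off a prime factor (`InverseEGZ.mul`). -/

/-! ### Multisets: lifting along maps, and multisets with two values. -/

open Multiset in
theorem Multiset.exists_list_of_coe_le_map {α β : Type*} (f : α → β) (l : List β) (s : Multiset α)
    (h : (l : Multiset β) ≤ s.map f) : ∃ L : List α, (L : Multiset α) ≤ s ∧ L.map f = l := by
  classical
  induction l generalizing s with
  | nil => exact ⟨[], by simp, rfl⟩
  | cons b l ih =>
    have hb : b ∈ s.map f := Multiset.mem_of_le h (by simp)
    obtain ⟨a, ha, rfl⟩ := Multiset.mem_map.1 hb
    obtain ⟨s', rfl⟩ := Multiset.exists_cons_of_mem ha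
    rw [Multiset.map_cons, ← Multiset.cons_coe, Multiset.cons_le_cons_iff] at h
    obtain ⟨L, hL, rfl⟩ := ih s' h
    exact ⟨a :: L, by rw [← Multiset.cons_coe, Multiset.cons_le_cons_iff]; exact hL, rfl⟩

theorem Multiset.exists_le_map_eq {α β : Type*} (f : α → β) (t : Multiset β) (s : Multiset α)
    (h : t ≤ s.map f) : ∃ u ≤ s, u.map f = t := by
  induction t using Quotient.inductionOn with
  | h l =>
    obtain ⟨L, hL, rfl⟩ := Multiset.exists_list_of_coe_le_map f l s h
    exact ⟨L, hL, by simp⟩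

theorem Multiset.eq_replicate_add_replicate {α : Type*} [DecidableEq α] {M : Multiset α} {a b : α}
    {N : ℕ} (hab : a ≠ b) (h : ∀ x ∈ M, x = a ∨ x = b) (ha : M.count a ≤ N) (hb : M.count b ≤ N)
    (hM : M.card = 2 * N) : M = replicate N a + replicate N b := by
  have h1 : M = replicate (M.count a) a + replicate (M.count b) b := by
    ext x
    rw [count_add, count_replicate, count_replicate]
    by_cases hx : x ∈ M
    · rcases h x hx with rfl | rfl
      · simp [hab.symm]
      · simp [hab]
    · have h0 := count_eq_zero_of_notMem hx
      split_ifs <;> simp_all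
  have h2 := congrArg card h1
  rw [card_add, card_replicate, card_replicate, hM] at h2
  have ha' : M.count a = N := by omega
  have hb' : M.count b = N := by omega
  rw [ha', hb'] at h1
  exact h1

theorem Multiset.count_eq_of_mem_replicate_add_replicate {α : Type*} [DecidableEq α]
    {M : Multiset α} {u v x : α} {N : ℕ} (huv : u ≠ v) (h : M = replicate N u + replicate N v)
    (hx : x ∈ M) : M.count x = N := by
  subst h
  rw [mem_add, mem_replicate, mem_replicate] at hx
  rw [count_add, count_replicate, count_replicate]
  rcases hx with ⟨_, rfl⟩ | ⟨_, rfl⟩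
  · simp [huv.symm]
  · simp [huv]

/-- A multiset consisting of two distinct elements with equal multiplicity at least two cannot be
changed into another such multiset by replacing a single element. -/
theorem Multiset.eq_of_cons_eq_replicate_add_replicate {α : Type*} {M : Multiset α}
    {e f u v u' v' : α} {N : ℕ} (hN : 2 ≤ N) (huv : u ≠ v) (huv' : u' ≠ v')
    (h : e ::ₘ M = replicate N u + replicate N v)
    (h' : f ::ₘ M = replicate N u' + replicate N v') : e = f := by
  classical
  by_contra hef
  -- If e ≠ f, then e has multiplicity N - 1 ≥ 1 in `f ::ₘ M`, where every occurring element has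
  -- multiplicity N.
  have h1 := count_eq_of_mem_replicate_add_replicate huv h (mem_cons_self e M)
  rw [count_cons_self] at h1
  have hM : e ∈ M := count_pos.1 (by omega)
  have h2 := count_eq_of_mem_replicate_add_replicate huv' h' (mem_cons_of_mem hM)
  rw [count_cons_of_ne hef] at h2
  omega

theorem Multiset.card_sum_of_forall_card {α : Type*} {Bs : Multiset (Multiset α)} {q : ℕ}
    (h : ∀ B ∈ Bs, B.card = q) : Bs.sum.card = Bs.card * q := by
  induction Bs using Multiset.induction_on with
  | empty => simp
  | cons B Bs ih =>
    rw [sum_cons, card_add, card_cons, ih fun C hC => h C (mem_cons_of_mem hC),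
      h B (mem_cons_self _ _)]
    ring

theorem Multiset.sum_le_sum_of_le {α : Type*} {Cs Bs : Multiset (Multiset α)} (h : Cs ≤ Bs) :
    Cs.sum ≤ Bs.sum := by
  obtain ⟨D, rfl⟩ := Multiset.le_iff_exists_add.1 h
  rw [sum_add]
  exact Multiset.le_add_right _ _

theorem Multiset.prod_sum_eq {α : Type*} [CommMonoid α] (Bs : Multiset (Multiset α)) :
    Bs.sum.prod = (Bs.map prod).prod := by
  induction Bs using Multiset.induction_on with
  | empty => simp
  | cons B Bs ih => simp [ih]

/-! ### Erdős–Ginzburg–Ziv in cyclic groups, and its inverse for prime order. -/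

section ErdosGinzburgZiv

open Multiset

variable {A : Type*} [CommGroup A]

theorem exists_multiset_int_of_mem_zpowers (g : A) (M : Multiset A)
    (hM : ∀ x ∈ M, x ∈ Subgroup.zpowers g) : ∃ N : Multiset ℤ, N.map (g ^ ·) = M := by
  induction M using Multiset.induction_on with
  | empty => exact ⟨0, rfl⟩
  | cons a M ih =>
    obtain ⟨N, rfl⟩ := ih fun x hx => hM x (mem_cons_of_mem hx)
    obtain ⟨i, hi⟩ := Subgroup.mem_zpowers_iff.1 (hM a (mem_cons_self _ _))
    exact ⟨i ::ₘ N, by simp [hi]⟩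

theorem prod_map_zpow_eq (g : A) (N : Multiset ℤ) : (N.map (g ^ ·)).prod = g ^ N.sum := by
  induction N using Multiset.induction_on with
  | empty => simp
  | cons a N ih => simp [ih, zpow_add]

/-- The Erdős–Ginzburg–Ziv theorem in a finite cyclic group. -/
theorem exists_prod_eq_one_of_mem_zpowers (g : A) {n : ℕ} (hg : orderOf g = n) (M : Multiset A)
    (hM : ∀ x ∈ M, x ∈ Subgroup.zpowers g) (hc : 2 * n - 1 ≤ M.card) :
    ∃ T ≤ M, T.card = n ∧ T.prod = 1 := by
  obtain ⟨N, rfl⟩ := exists_multiset_int_of_mem_zpowers g M hM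
  rw [card_map] at hc
  obtain ⟨t, ht, htc, hd⟩ := Int.erdos_ginzburg_ziv_multiset N hc
  refine ⟨t.map (g ^ ·), map_le_map ht, by simpa using htc, ?_⟩
  rw [prod_map_zpow_eq]
  exact orderOf_dvd_iff_zpow_eq_one.1 (hg ▸ hd)

open scoped Pointwise in
/-- Sums of `k` terms of a sequence over a cyclic group of prime order, all of whose
multiplicities are at most `k`. -/
theorem ZMod.le_card_sums_of_count_le {p : ℕ} (hp : p.Prime) (k : ℕ) (R : Multiset (ZMod p))
    (hk : k ≤ R.card) (hc : ∀ a, R.count a ≤ k) :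
    min p (R.card - k + 1) ≤ ((R.powersetCard k).map sum).toFinset.card := by
  induction k generalizing R with
  | zero =>
    have : R = 0 := by
      rw [Multiset.eq_zero_iff_forall_notMem]
      exact fun a ha => by have := count_pos.2 ha; have := hc a; omega
    subst this
    simp
  | succ k ih =>
    -- F is a set of distinct terms containing every value of maximal multiplicity k + 1, so that R
    -- - F satisfies the induction hypothesis. If such values exist, F consists of them, and k + |F|
    -- ≤ (k + 1)|F| ≤ |R|; otherwise any single term does.
    obtain ⟨F, hFne, hFR, hFc, hFk⟩ : ∃ F : Finset (ZMod p), F.Nonempty ∧ F.val ≤ R ∧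
        (∀ a, R.count a = k + 1 → a ∈ F) ∧ k + F.card ≤ R.card := by
      by_cases h : ∃ a, R.count a = k + 1
      · obtain ⟨a, ha⟩ := h
        have hle : (k + 1) • (R.toFinset.filter (R.count · = k + 1)).val ≤ R := by
          rw [Multiset.le_iff_count]
          intro b
          rw [count_nsmul]
          by_cases hb : R.count b = k + 1
          · have := Multiset.nodup_iff_count_le_one.1
              (R.toFinset.filter (R.count · = k + 1)).nodup b
            nlinarith
          · rw [count_eq_zero_of_notMem]
            · simp
            · simp [hb]
        have hcard := card_le_card hle
        rw [card_nsmul] at hcard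
        have hne : (R.toFinset.filter (R.count · = k + 1)).Nonempty :=
          ⟨a, by simp [ha, ← count_pos (s := R) (a := a)]⟩
        have hpos := hne.card_pos
        refine ⟨R.toFinset.filter (R.count · = k + 1), hne, ?_, ?_, ?_⟩
        · exact (le_iff_subset (Finset.nodup _)).2 fun b hb => by simp at hb; exact hb.1
        · intro b hb
          simp [hb, ← count_pos (s := R) (a := b)]
        · change (k + 1) * Finset.card _ ≤ _ at hcard
          nlinarith
      · obtain ⟨a, ha⟩ : ∃ a, a ∈ R := card_pos_iff_exists_mem.1 (by omega)
        exact ⟨{a}, by simp, by simpa using ha, fun b hb => absurd ⟨b, hb⟩ h, by simpa using hk⟩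
    have hcard : (R - F.val).card = R.card - F.card := card_sub hFR
    have ih' := ih (R - F.val) (by omega) fun a => by
      rw [count_sub]
      by_cases ha : R.count a = k + 1
      · have : 1 ≤ F.val.count a := one_le_count_iff_mem.2 (hFc a ha)
        omega
      · have := hc a
        omega
    rw [hcard] at ih'
    have hne : ((R - F.val).powersetCard k |>.map sum).toFinset.Nonempty := by
      rw [← Finset.card_pos]
      have := hp.pos
      omega
    -- One term from F plus k terms from R - F: the bound is |F| + (|R| - |F| - k + 1) - 1 = |R| -
    -- (k + 1) + 1.
    have hcd := ZMod.cauchy_davenport hp hFne hne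
    have hsub : F + ((R - F.val).powersetCard k |>.map sum).toFinset ⊆
        ((R.powersetCard (k + 1)).map sum).toFinset := by
      intro z hz
      obtain ⟨a, ha, b, hb, rfl⟩ := Finset.mem_add.1 hz
      simp only [mem_toFinset, mem_map, mem_powersetCard] at hb ⊢
      obtain ⟨T, ⟨hT, hTk⟩, rfl⟩ := hb
      refine ⟨a ::ₘ T, ⟨?_, by simp [hTk]⟩, by simp⟩
      have : {a} + T ≤ F.val + (R - F.val) :=
        add_le_add (singleton_le.2 ha) hT
      rwa [add_tsub_cancel_of_le hFR] at this
    have := Finset.card_le_card hsub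
    have hpos := hFne.card_pos
    omega

/-- If S does not have two values of multiplicity p - 1, then after removing one suitable term c all
multiplicities are at most p - 2. The sums of p - 2 of the remaining 2p - 3 terms then fill `ZMod
p`. One of them equals the sum of S, and its complement in S consists of p terms with sum zero. -/
theorem ZMod.eq_replicate_of_forall_sum_ne_zero {p : ℕ} (hp : p.Prime) (S : Multiset (ZMod p))
    (hc : S.card = 2 * p - 2) (hS : ∀ T ≤ S, T.card = p → T.sum ≠ 0) :
    ∃ a b, S = replicate (p - 1) a + replicate (p - 1) b := by
  have hp2 := hp.two_le
  have hcount : ∀ a, S.count a ≤ p - 1 := by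
    intro a
    by_contra! h
    refine hS (replicate p a) (le_count_iff_replicate_le.1 (by omega)) (by simp) (by simp)
  by_contra! hno
  obtain ⟨c, hcS, hcc⟩ : ∃ c ∈ S, ∀ a, S.count a = p - 1 → a = c := by
    by_cases h : ∃ a, S.count a = p - 1
    · obtain ⟨a, ha⟩ := h
      refine ⟨a, count_pos.1 (by omega), fun b hb => ?_⟩
      by_contra hab
      refine hno a b (Multiset.eq_of_le_of_card_le ?_ (by simp; omega)).symm
      rw [Multiset.le_iff_count]
      intro x
      rw [count_add, count_replicate, count_replicate]
      split_ifs with h1 h2 h2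
      · exact absurd (h2.trans h1.symm) hab
      · subst h1; omega
      · subst h2; omega
      · omega
    · obtain ⟨a, ha⟩ : ∃ a, a ∈ S := card_pos_iff_exists_mem.1 (by omega)
      exact ⟨a, ha, fun b hb => absurd ⟨b, hb⟩ h⟩
  have hRc : (S.erase c).card = 2 * p - 3 := by rw [card_erase_of_mem hcS, hc, Nat.pred_eq_sub_one]; omega
  have key := ZMod.le_card_sums_of_count_le hp (p - 2) (S.erase c) (by omega) fun a => by
    by_cases hac : a = c
    · subst hac
      rw [count_erase_self]
      have := hcount a
      omega
    · rw [count_erase_of_ne hac]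
      have h1 := hcount a
      have h2 : S.count a ≠ p - 1 := fun h => hac (hcc a h)
      omega
  rw [hRc] at key
  have : NeZero p := ⟨hp.ne_zero⟩
  have huniv : (((S.erase c).powersetCard (p - 2)).map sum).toFinset = Finset.univ := by
    rw [← Finset.card_eq_iff_eq_univ, ZMod.card]
    refine le_antisymm ?_ (by omega)
    exact (Finset.card_le_univ _).trans_eq (ZMod.card p)
  have hmem : S.sum ∈ (((S.erase c).powersetCard (p - 2)).map sum).toFinset := by
    rw [huniv]; exact Finset.mem_univ _
  simp only [mem_toFinset, mem_map, mem_powersetCard] at hmem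
  obtain ⟨T, ⟨hT, hTk⟩, hTs⟩ := hmem
  have hTS : T ≤ S := hT.trans (erase_le _ _)
  refine hS (S - T) tsub_le_self (by rw [card_sub hTS, hTk, hc]; omega) ?_
  have := congrArg sum (tsub_add_cancel_of_le hTS)
  rw [sum_add, hTs] at this
  simpa using this

theorem eq_replicate_of_prime_of_forall_prod_ne_one (g : A) {p : ℕ} (hp : p.Prime)
    (hg : orderOf g = p) (M : Multiset A) (hM : ∀ x ∈ M, x ∈ Subgroup.zpowers g)
    (hc : M.card = 2 * p - 2) (hfree : ∀ T ≤ M, T.card = p → T.prod ≠ 1) :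
    ∃ a b, M = replicate (p - 1) a + replicate (p - 1) b := by
  have : NeZero p := ⟨hp.ne_zero⟩
  obtain ⟨N, rfl⟩ := exists_multiset_int_of_mem_zpowers g M hM
  have hF : ∀ i : ℤ, g ^ ((i : ZMod p).val) = g ^ i := by
    intro i
    rw [← zpow_natCast, ZMod.val_intCast, ← hg, zpow_mod_orderOf]
  have hmap : (N.map (Int.cast : ℤ → ZMod p)).map (fun a => g ^ a.val) = N.map (g ^ ·) := by
    rw [map_map]
    exact map_congr rfl fun i _ => hF i
  have hprod : ∀ T : Multiset (ZMod p), (T.map fun a => g ^ a.val).prod = g ^ T.sum.val := by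
    intro T
    induction T using Multiset.induction_on with
    | empty => simp
    | cons a T ih =>
      have h := pow_mod_orderOf g (a.val + T.sum.val)
      rw [hg] at h
      rw [map_cons, prod_cons, sum_cons, ih, ZMod.val_add, ← pow_add, h]
  obtain ⟨a, b, hab⟩ := ZMod.eq_replicate_of_forall_sum_ne_zero hp
    (N.map (Int.cast : ℤ → ZMod p)) (by simpa using hc) (by
      intro T hT hTc hs
      refine hfree (T.map fun a => g ^ a.val) ?_ (by simpa using hTc) ?_
      · rw [← hmap]; exact map_le_map hT
      · rw [hprod, hs]; simp)
  refine ⟨g ^ a.val, g ^ b.val, ?_⟩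
  rw [← hmap, hab]
  simp

end ErdosGinzburgZiv

/-! ### The inverse Erdős–Ginzburg–Ziv theorem for all finite cyclic groups. -/

section InverseErdosGinzburgZiv

open Multiset

variable {A : Type*} [CommGroup A]

/-- `M` consists of two values, each repeated `n - 1` times, whenever it is a sequence of length
`2 n - 2` over `⟨g⟩` without product-one subsequence of length `n`. -/
def InverseEGZ (g : A) (n : ℕ) : Prop :=
  ∀ M : Multiset A, (∀ x ∈ M, x ∈ Subgroup.zpowers g) → M.card = 2 * n - 2 →
    (∀ T ≤ M, T.card = n → T.prod ≠ 1) →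
      ∃ a b, M = replicate (n - 1) a + replicate (n - 1) b

theorem ne_of_replicate_add_replicate (g : A) {n : ℕ} (hn : 2 ≤ n) (hg : orderOf g = n)
    {M : Multiset A} (hM : ∀ x ∈ M, x ∈ Subgroup.zpowers g)
    (hfree : ∀ T ≤ M, T.card = n → T.prod ≠ 1) {a b : A}
    (h : M = replicate (n - 1) a + replicate (n - 1) b) : a ≠ b := by
  rintro rfl
  refine hfree (replicate n a) ?_ (by simp) ?_
  · rw [h, ← replicate_add, replicate_le_replicate]
    omega
  · have ha : a ∈ M := by
      rw [h, mem_add, mem_replicate]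
      exact Or.inl ⟨by omega, rfl⟩
    obtain ⟨i, rfl⟩ := Subgroup.mem_zpowers_iff.1 (hM a ha)
    rw [prod_replicate, ← zpow_natCast, ← zpow_mul, mul_comm, zpow_mul, zpow_natCast, ← hg,
      pow_orderOf_eq_one, one_zpow]

/-- If `X` has `p` terms of order dividing `p`, product one, and all terms but possibly one equal
to `b`, then all of them are equal to `b`. -/
theorem eq_replicate_of_le_count [DecidableEq A] {p : ℕ} (hp : 1 ≤ p) {X : Multiset A} {b : A}
    (hX : X.card = p) (hb : b ^ p = 1) (hc : p - 1 ≤ X.count b) (h1 : X.prod = 1) :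
    X = replicate p b := by
  obtain ⟨Y, hY⟩ := Multiset.le_iff_exists_add.1 (le_count_iff_replicate_le.1 hc)
  have hYc : Y.card = 1 := by
    have := congrArg card hY
    rw [card_add, card_replicate] at this
    omega
  obtain ⟨e, rfl⟩ := card_eq_one.1 hYc
  have he : e = b := by
    rw [hY, prod_add, prod_replicate, prod_singleton] at h1
    have h2 : b ^ (p - 1) * b = 1 := by rw [← pow_succ, Nat.sub_add_cancel hp, hb]
    exact mul_left_cancel (h1.trans h2.symm)
  rw [hY, he, ← replicate_one, ← replicate_add, Nat.sub_add_cancel hp]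

/-- Grouping a sequence over a commutative group into blocks of length `q` preserves the absence
of product-one subsequences. -/
theorem prod_ne_one_of_le_map_prod {M : Multiset A} {Bs : Multiset (Multiset A)} {q m : ℕ}
    (hBs : Bs.sum ≤ M) (hq : ∀ B ∈ Bs, B.card = q)
    (hfree : ∀ T ≤ M, T.card = q * m → T.prod ≠ 1) :
    ∀ T ≤ Bs.map prod, T.card = m → T.prod ≠ 1 := by
  intro T hT hTc
  obtain ⟨Cs, hCs, rfl⟩ := exists_le_map_eq _ T Bs hT
  rw [← prod_sum_eq]
  refine hfree _ ((sum_le_sum_of_le hCs).trans hBs) ?_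
  rw [card_map] at hTc
  rw [card_sum_of_forall_card fun B hB => hq B (mem_of_le hCs hB), hTc, mul_comm]

theorem mem_zpowers_pow_of_pow_eq_one {g x : A} {p m : ℕ} (hm : 0 < m) (hg : orderOf g = p * m)
    (hx : x ∈ Subgroup.zpowers g) (h : x ^ m = 1) : x ∈ Subgroup.zpowers (g ^ p) := by
  obtain ⟨i, rfl⟩ := Subgroup.mem_zpowers_iff.1 hx
  rw [← zpow_natCast, ← zpow_mul, ← orderOf_dvd_iff_zpow_eq_one, hg] at h
  push_cast at h
  obtain ⟨j, rfl⟩ := (mul_dvd_mul_iff_right (by exact_mod_cast hm.ne')).1 h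
  exact Subgroup.mem_zpowers_iff.2 ⟨j, by rw [← zpow_natCast, ← zpow_mul]⟩

theorem pow_mem_zpowers_pow {g x : A} (m : ℕ) (hx : x ∈ Subgroup.zpowers g) :
    x ^ m ∈ Subgroup.zpowers (g ^ m) := by
  obtain ⟨i, rfl⟩ := Subgroup.mem_zpowers_iff.1 hx
  exact Subgroup.mem_zpowers_iff.2
    ⟨i, by rw [← zpow_natCast, ← zpow_natCast, ← zpow_mul, ← zpow_mul, mul_comm]⟩

/-- The inductive step of the inverse Erdős–Ginzburg–Ziv theorem: the terms of `M` are grouped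
into blocks of length `p` whose product has order dividing `m`. -/
theorem InverseEGZ.mul (g : A) {p m : ℕ} (hp : p.Prime) (hm : 2 ≤ m) (hg : orderOf g = p * m)
    (hEp : InverseEGZ (g ^ m) p) (hEm : InverseEGZ (g ^ p) m) : InverseEGZ g (p * m) := by
  classical
  intro M hM hc hfree
  have hp2 := hp.two_le
  have hpm : p * 2 ≤ p * m := Nat.mul_le_mul_left p hm
  have hgm : orderOf (g ^ m) = p := by
    rw [orderOf_pow_of_dvd (by omega) (by rw [hg]; exact dvd_mul_left _ _), hg,
      Nat.mul_div_cancel _ (by omega)]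
  have hgp : orderOf (g ^ p) = m := by
    rw [orderOf_pow_of_dvd (by omega) (by rw [hg]; exact dvd_mul_right _ _), hg,
      Nat.mul_div_cancel_left _ (by omega)]
  have hcl : ∀ x ∈ M, x ^ m ∈ Subgroup.zpowers (g ^ m) := fun x hx =>
    pow_mem_zpowers_pow m (hM x hx)
  have hclp : ∀ x ∈ M, (x ^ m) ^ p = 1 := by
    intro x hx
    obtain ⟨i, hi⟩ := Subgroup.mem_zpowers_iff.1 (hcl x hx)
    rw [← hi, ← zpow_natCast, ← zpow_mul, mul_comm, zpow_mul, zpow_natCast, ← hgm,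
      pow_orderOf_eq_one, one_zpow]
  have hprodmap : ∀ B : Multiset A, (B.map (· ^ m)).prod = B.prod ^ m := fun B =>
    prod_map_pow.trans (by rw [map_id'])
  have extract : ∀ L ≤ M, 2 * p - 1 ≤ L.card → ∃ B ≤ L, B.card = p ∧ B.prod ^ m = 1 := by
    intro L hL hLc
    obtain ⟨T, hT, hTc, hT1⟩ := exists_prod_eq_one_of_mem_zpowers (g ^ m) hgm (L.map (· ^ m))
      (by
        intro x hx
        obtain ⟨y, hy, rfl⟩ := mem_map.1 hx
        exact hcl y (mem_of_le hL hy))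
      (by simpa using hLc)
    obtain ⟨B, hB, rfl⟩ := exists_le_map_eq _ T L hT
    exact ⟨B, hB, by simpa using hTc, by rw [← hprodmap, hT1]⟩
  -- Families of disjoint blocks of p terms whose products lie in ⟨g ^ p⟩, the kernel of the m-th
  -- power map on ⟨g⟩. The class of a term means its m-th power.
  let Good : Multiset (Multiset A) → Prop := fun Bs =>
    Bs.sum ≤ M ∧ ∀ B ∈ Bs, B.card = p ∧ B.prod ^ m = 1
  have good_cons : ∀ {Bs : Multiset (Multiset A)} {B : Multiset A}, Good Bs → B ≤ M - Bs.sum →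
      B.card = p → B.prod ^ m = 1 → Good (B ::ₘ Bs) := by
    intro Bs B hBs hB hBc hB1
    refine ⟨?_, fun C hC => ?_⟩
    · rw [sum_cons]
      calc B + Bs.sum ≤ (M - Bs.sum) + Bs.sum := add_le_add_left hB _
        _ = M := tsub_add_cancel_of_le hBs.1
    · rcases mem_cons.1 hC with rfl | hC
      · exact ⟨hBc, hB1⟩
      · exact hBs.2 C hC
  have card_left : ∀ {Bs : Multiset (Multiset A)}, Good Bs →
      (M - Bs.sum).card = 2 * (p * m) - 2 - Bs.card * p := by
    intro Bs hBs
    rw [card_sub hBs.1, hc, card_sum_of_forall_card fun B hB => (hBs.2 B hB).1]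
  have mapprod : ∀ {Bs : Multiset (Multiset A)}, Good Bs → ∀ x ∈ Bs.map prod,
      x ∈ Subgroup.zpowers (g ^ p) := by
    intro Bs hBs x hx
    obtain ⟨B, hB, rfl⟩ := mem_map.1 hx
    refine mem_zpowers_pow_of_pow_eq_one (by omega) hg ?_ (hBs.2 B hB).2
    exact Subgroup.multiset_prod_mem _ _ fun y hy =>
      hM y (mem_of_le ((le_sum_of_mem hB).trans hBs.1) hy)
  have mapfree : ∀ {Bs : Multiset (Multiset A)}, Good Bs → ∀ T ≤ Bs.map prod, T.card = m →
      T.prod ≠ 1 := fun {Bs} hBs =>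
    prod_ne_one_of_le_map_prod hBs.1 (fun B hB => (hBs.2 B hB).1) hfree
  -- Among 2m - 1 blocks, Erdős–Ginzburg–Ziv in ⟨g ^ p⟩ would find m with total product one, that
  -- is, p m terms of M.
  have card_good : ∀ {Bs : Multiset (Multiset A)}, Good Bs → Bs.card ≤ 2 * m - 2 := by
    intro Bs hBs
    by_contra! h
    obtain ⟨T, hT, hTc, hT1⟩ := exists_prod_eq_one_of_mem_zpowers (g ^ p) hgp (Bs.map prod)
      (mapprod hBs) (by rw [card_map]; omega)
    exact mapfree hBs T hT hTc hT1
  have exists_full : ∀ k, k ≤ 2 * m - 2 → ∃ Bs, Good Bs ∧ Bs.card = k := by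
    intro k
    induction k with
    | zero => exact fun _ => ⟨0, ⟨by simp, by simp⟩, rfl⟩
    | succ k ih =>
      intro hk
      obtain ⟨Bs, hBs, rfl⟩ := ih (by omega)
      -- With at most 2m - 3 blocks taken, at least 3p - 2 ≥ 2p - 1 terms are left.
      obtain ⟨B, hB, hBc, hB1⟩ := extract (M - Bs.sum) tsub_le_self (by
        rw [card_left hBs]
        have : (Bs.card + 3) * p ≤ 2 * m * p := Nat.mul_le_mul_right p (by omega)
        have h1 : 2 * m * p = 2 * (p * m) := by ring
        have h2 : (Bs.card + 3) * p = Bs.card * p + 3 * p := by ring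
        omega)
      exact ⟨B ::ₘ Bs, good_cons hBs hB hBc hB1, by simp⟩
  have rigid : ∀ {Rs : Multiset (Multiset A)} {B C : Multiset A}, Good (B ::ₘ Rs) →
      Good (C ::ₘ Rs) → Rs.card + 1 = 2 * m - 2 → B.prod = C.prod := by
    intro Rs B C hB hC hR
    obtain ⟨u, v, huv⟩ := hEm _ (mapprod hB) (by simp [hR]) (mapfree hB)
    obtain ⟨u', v', huv'⟩ := hEm _ (mapprod hC) (by simp [hR]) (mapfree hC)
    have hne := ne_of_replicate_add_replicate _ hm hgp (mapprod hB) (mapfree hB) huv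
    have hne' := ne_of_replicate_add_replicate _ hm hgp (mapprod hC) (mapfree hC) huv'
    rw [map_cons] at huv huv'
    -- The multiplicity argument needs m - 1 ≥ 2. For m = 2 there is one other block D, and B.prod *
    -- D.prod, C.prod * D.prod are both the nontrivial element of a group of order two.
    rcases Nat.lt_or_ge m 3 with hm3 | hm3
    · obtain rfl : m = 2 := by omega
      have hRs : Rs.card = 1 := by omega
      obtain ⟨D, rfl⟩ := card_eq_one.1 hRs
      have key : ∀ x ∈ Subgroup.zpowers (g ^ p), ∀ y ∈ Subgroup.zpowers (g ^ p),
          x ≠ 1 → y ≠ 1 → x = y := by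
        have hsq : (g ^ p) ^ 2 = 1 := by rw [← hgp, pow_orderOf_eq_one]
        have : ∀ x ∈ Subgroup.zpowers (g ^ p), x ≠ 1 → x = g ^ p := by
          intro x hx hx1
          obtain ⟨i, rfl⟩ := Subgroup.mem_zpowers_iff.1 hx
          rcases Int.even_or_odd' i with ⟨j, rfl | rfl⟩
          · exact absurd (by rw [zpow_mul]; norm_cast; simp [hsq]) hx1
          · rw [zpow_add, zpow_mul]; norm_cast; simp [hsq]
        exact fun x hx y hy hx1 hy1 => (this x hx hx1).trans (this y hy hy1).symm
      have hpair : ∀ {E : Multiset A}, Good (E ::ₘ {D}) → E.prod * D.prod ≠ 1 := by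
        intro E hE
        simpa using mapfree hE {E.prod, D.prod} (by simp) (by simp)
      have hsq : ∀ x ∈ Subgroup.zpowers (g ^ p), x * x = 1 := by
        intro x hx
        obtain ⟨i, rfl⟩ := Subgroup.mem_zpowers_iff.1 hx
        rw [← zpow_add, ← two_mul, zpow_mul]
        norm_cast
        rw [← hgp, pow_orderOf_eq_one, one_zpow]
      have hDm : D.prod ∈ Subgroup.zpowers (g ^ p) := mapprod hB _ (by simp)
      have hBm : B.prod ∈ Subgroup.zpowers (g ^ p) := mapprod hB _ (by simp)
      have hCm : C.prod ∈ Subgroup.zpowers (g ^ p) := mapprod hC _ (by simp)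
      have := key _ (Subgroup.mul_mem _ hBm hDm) _ (Subgroup.mul_mem _ hCm hDm)
        (hpair hB) (hpair hC)
      exact mul_right_cancel this
    · exact eq_of_cons_eq_replicate_add_replicate (by omega) hne hne' huv huv'
  -- the remaining terms of a full family of blocks lie in two classes modulo the subgroup
  have leftover : ∀ {Bs : Multiset (Multiset A)}, Good Bs → Bs.card = 2 * m - 2 →
      ∃ a b, a ≠ b ∧ (M - Bs.sum).map (· ^ m) = replicate (p - 1) a + replicate (p - 1) b := by
    intro Bs hBs hBc
    have hmem : ∀ x ∈ (M - Bs.sum).map (· ^ m), x ∈ Subgroup.zpowers (g ^ m) := by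
      intro x hx
      obtain ⟨y, hy, rfl⟩ := mem_map.1 hx
      exact hcl y (mem_of_le tsub_le_self hy)
    have hfr : ∀ T ≤ (M - Bs.sum).map (· ^ m), T.card = p → T.prod ≠ 1 := by
      intro T hT hTc h1
      obtain ⟨B, hB, rfl⟩ := exists_le_map_eq _ T _ hT
      rw [hprodmap] at h1
      have := card_good (good_cons hBs hB (by simpa using hTc) h1)
      rw [card_cons] at this
      omega
    obtain ⟨a, b, hab⟩ := hEp _ hmem (by
      rw [card_map, card_left hBs, hBc, Nat.sub_mul]
      have : 2 * m * p = 2 * (p * m) := by ring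
      omega) hfr
    exact ⟨a, b, ne_of_replicate_add_replicate _ hp2 hgm hmem hfr hab, hab⟩
  obtain ⟨Bs, hBs, hBc⟩ := exists_full _ le_rfl
  obtain ⟨a, b, hab, hL⟩ := leftover hBs hBc
  set L := M - Bs.sum with hLdef
  have hLM : L ≤ M := tsub_le_self
  have hMsum : L + Bs.sum = M := tsub_add_cancel_of_le hBs.1
  have hcountL : ∀ x, (L.map (· ^ m)).count x =
      (if a = x then p - 1 else 0) + (if b = x then p - 1 else 0) := by
    intro x
    rw [hL, count_add, count_replicate, count_replicate]
  have hBM : ∀ {B}, B ∈ Bs → B ≤ M := fun hB => (le_sum_of_mem hB).trans hBs.1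
  -- replacing a block
  have replace : ∀ {B : Multiset A}, B ∈ Bs → ∀ C ≤ L + B, C.card = p → C.prod ^ m = 1 →
      ∃ Cs, Good Cs ∧ Cs.card = 2 * m - 2 ∧ M - Cs.sum = L + B - C ∧ C.prod = B.prod := by
    intro B hB C hC hCc hC1
    obtain ⟨Rs, hRs⟩ := exists_cons_of_mem hB
    have hBs' : Good (B ::ₘ Rs) := hRs ▸ hBs
    have hR : Good Rs := ⟨by
      have := hBs'.1
      rw [sum_cons] at this
      exact (Multiset.le_add_left _ _).trans this,
      fun D hD => hBs'.2 D (mem_cons_of_mem hD)⟩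
    have hMR : M - Rs.sum = L + B := by
      rw [← hMsum, hRs, sum_cons, ← add_assoc, add_tsub_cancel_right]
    have hgood : Good (C ::ₘ Rs) := good_cons hR (by rw [hMR]; exact hC) hCc hC1
    have hRc : Rs.card + 1 = 2 * m - 2 := by rw [← hBc, hRs, card_cons]
    refine ⟨C ::ₘ Rs, hgood, by rw [card_cons]; exact hRc, ?_, rigid hgood hBs' hRc⟩
    rw [sum_cons, add_comm C, ← tsub_tsub, hMR]
  -- Suppose c in B has a third class. The 3p - 3 ≥ 2p - 1 other terms of L + B contain a new block
  -- C, and c stays among the new leftover terms, where its class has multiplicity p - 1. So B has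
  -- at least p - 1 terms of this class, hence p since its product has trivial class, and exactly
  -- one of them is in C.
  have classes_block : ∀ B ∈ Bs, ∀ c ∈ B, c ^ m = a ∨ c ^ m = b := by
    intro B hB c hcB
    by_contra! hno
    have hBp := hBs.2 B hB
    have hBcl : (B.map (· ^ m)).prod = 1 := by rw [hprodmap, hBp.2]
    have hLc : L.card = 2 * p - 2 := by
      have := congrArg card hL
      rw [card_map, card_add, card_replicate, card_replicate] at this
      omega
    have hcLB : c ∈ L + B := mem_add.2 (Or.inr hcB)
    have hLBM : L + B ≤ M := by
      rw [← hMsum]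
      exact add_le_add_right (le_sum_of_mem hB) _
    obtain ⟨C, hC, hCc, hC1⟩ := extract ((L + B).erase c) ((erase_le _ _).trans hLBM) (by
      rw [card_erase_of_mem hcLB, card_add, hLc, hBp.1, Nat.pred_eq_sub_one]
      omega)
    have hCLB : C ≤ L + B := hC.trans (erase_le _ _)
    obtain ⟨Cs, hCs, hCsc, hMC, -⟩ := replace hB C hCLB hCc hC1
    obtain ⟨a', b', hab', hL'⟩ := leftover hCs hCsc
    rw [hMC] at hL'
    have hcL' : c ∈ L + B - C := by
      have h1 : {c} + C ≤ L + B := by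
        rw [← cons_erase hcLB, ← singleton_add]
        exact add_le_add_right hC _
      have : {c} ≤ L + B - C := by
        rw [add_comm] at h1
        exact le_tsub_of_add_le_left h1
      exact singleton_le.1 this
    have hcount : ∀ x, (L.map (· ^ m)).count x + (B.map (· ^ m)).count x =
        ((L + B - C).map (· ^ m)).count x + (C.map (· ^ m)).count x := by
      intro x
      rw [← count_add, ← count_add, ← map_add, ← map_add, tsub_add_cancel_of_le hCLB]
    have hcc' := count_eq_of_mem_replicate_add_replicate hab' hL' (mem_map_of_mem (· ^ m) hcL')
    have h1 := hcount (c ^ m)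
    rw [hcc', hcountL, if_neg (Ne.symm hno.1), if_neg (Ne.symm hno.2)] at h1
    have hBrep := eq_replicate_of_le_count (b := c ^ m) (by omega)
      ((card_map (· ^ m) B).trans hBp.1) (hclp c (mem_of_le (hBM hB) hcB)) (by omega) hBcl
    rw [hBrep, count_replicate_self] at h1
    have hCcl : (C.map (· ^ m)).prod = 1 := by rw [hprodmap, hC1]
    -- If a class d among a, b is missing from the new leftover terms, its p - 1 terms in L all went
    -- into C; then C lies entirely in class d, although it contains a term of the class of c.
    have haux : ∀ d, d ≠ c ^ m → (d = a ∨ d = b) → d ∉ (L + B - C).map (· ^ m) → False := by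
      intro d hdc hd hdL
      have h2 := hcount d
      have hd1 : d ^ p = 1 := by
        have : d ∈ L.map (· ^ m) := by
          rw [hL, mem_add, mem_replicate, mem_replicate]
          rcases hd with rfl | rfl
          · exact Or.inl ⟨by omega, rfl⟩
          · exact Or.inr ⟨by omega, rfl⟩
        obtain ⟨z, hz, rfl⟩ := mem_map.1 this
        exact hclp z (mem_of_le hLM hz)
      rw [count_eq_zero_of_notMem hdL, hBrep, count_replicate, if_neg (Ne.symm hdc), hcountL] at h2
      have hge : p - 1 ≤ (C.map (· ^ m)).count d := by
        rcases hd with rfl | rfl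
        · rw [if_pos rfl] at h2; omega
        · rw [if_pos rfl] at h2; omega
      have hCrep := eq_replicate_of_le_count (b := d) (by omega)
        ((card_map (· ^ m) C).trans hCc) hd1 hge hCcl
      rw [hCrep, count_replicate, if_neg hdc] at h1
      omega
    -- The new leftover terms have only two classes and one is that of c, so a or b is missing.
    have hthree : a ∉ (L + B - C).map (· ^ m) ∨ b ∉ (L + B - C).map (· ^ m) := by
      by_contra! h
      have hcm := mem_map_of_mem (· ^ m) hcL'
      rw [hL'] at h hcm
      simp only [mem_add, mem_replicate] at h hcm
      obtain ⟨h3, h4⟩ := h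
      have e1 := h3.imp And.right And.right
      have e2 := h4.imp And.right And.right
      have e3 := hcm.imp And.right And.right
      grind
    rcases hthree with h | h
    · exact haux a (Ne.symm hno.1) (Or.inl rfl) h
    · exact haux b (Ne.symm hno.2) (Or.inr rfl) h
  have classes : ∀ c ∈ M, c ^ m = a ∨ c ^ m = b := by
    intro c hcM
    rw [← hMsum, mem_add] at hcM
    rcases hcM with hcL | hcB
    · have := mem_map_of_mem (· ^ m) hcL
      rw [hL, mem_add, mem_replicate, mem_replicate] at this
      exact this.imp And.right And.right
    · obtain ⟨B, hB, hcB⟩ := mem_join.1 hcB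
      exact classes_block B hB c hcB
  -- Exchanging f for e keeps the class of the product of the block, so by `rigid` it keeps the
  -- product itself.
  have swap : ∀ B ∈ Bs, ∀ f ∈ B, ∀ e ∈ L, e ^ m = f ^ m → e = f := by
    intro B hB f hf e he hef
    obtain ⟨D, rfl⟩ := exists_cons_of_mem hf
    have hBp := hBs.2 _ hB
    obtain ⟨-, -, -, -, h⟩ := replace hB (e ::ₘ D) (by
        rw [← singleton_add, ← singleton_add]
        exact add_le_add (singleton_le.2 he) (Multiset.le_add_left _ _)) (by simpa using hBp.1) (by
        rw [prod_cons, mul_pow, hef, ← mul_pow, ← prod_cons, hBp.2])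
    rw [prod_cons, prod_cons] at h
    exact mul_right_cancel h
  have pow_pm : ∀ x ∈ M, x ^ (p * m) = 1 := by
    intro x hx
    obtain ⟨i, rfl⟩ := Subgroup.mem_zpowers_iff.1 (hM x hx)
    rw [← zpow_natCast, ← zpow_mul, mul_comm, zpow_mul, zpow_natCast, ← hg, pow_orderOf_eq_one,
      one_zpow]
  have hcount_le : ∀ x, M.count x ≤ p * m - 1 := by
    intro x
    by_contra! h
    have hx : x ∈ M := count_pos.1 (by omega)
    refine hfree (replicate (p * m) x) (le_count_iff_replicate_le.1 (by omega)) (by simp) ?_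
    rw [prod_replicate, pow_pm x hx]
  have exL : ∀ d, (d = a ∨ d = b) → ∃ e ∈ L, e ^ m = d := by
    intro d hd
    have : d ∈ L.map (· ^ m) := by
      rw [hL, mem_add, mem_replicate, mem_replicate]
      rcases hd with rfl | rfl
      · exact Or.inl ⟨by omega, rfl⟩
      · exact Or.inr ⟨by omega, rfl⟩
    exact mem_map.1 this
  -- each class occurs in some block, hence is constant
  have hblock : ∀ d, (d = a ∨ d = b) → ∃ B ∈ Bs, ∃ f ∈ B, f ^ m = d := by
    intro d hd
    by_contra! hno
    obtain ⟨d', hd', hdd', hother⟩ : ∃ d', (d' = a ∨ d' = b) ∧ d' ≠ d ∧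
        ∀ x, (x = a ∨ x = b) → x ≠ d → x = d' := by
      rcases hd with rfl | rfl
      · exact ⟨b, Or.inr rfl, hab.symm, by grind⟩
      · exact ⟨a, Or.inl rfl, hab, by grind⟩
    obtain ⟨e, heL, hed⟩ := exL d' hd'
    have hBsum : ∀ f ∈ Bs.sum, f = e := by
      intro f hf
      obtain ⟨B, hB, hfB⟩ := mem_join.1 hf
      have hfd := hother _ (classes_block B hB f hfB) (hno B hB f hfB)
      exact (swap B hB f hfB e heL (hed.trans hfd.symm)).symm
    -- Otherwise all (2m - 2)p ≥ p m terms in blocks equal e, more than the allowed multiplicity p m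
    -- - 1.
    have hrep := eq_replicate_card.2 hBsum
    rw [card_sum_of_forall_card fun B hB => (hBs.2 B hB).1, hBc] at hrep
    have h1 : (Bs.sum).count e ≤ M.count e := count_le_of_le _ hBs.1
    have h2 := hcount_le e
    rw [hrep, count_replicate_self, Nat.sub_mul] at h1
    have h3 : 2 * m * p = 2 * (p * m) := by ring
    have h4 : e ::ₘ replicate ((2 * m - 2) * p) e ≤ M := by
      rw [← hMsum, ← singleton_add]
      exact add_le_add (singleton_le.2 heL) hrep.ge
    have h5 := count_le_of_le e h4
    rw [count_cons_self, count_replicate_self, Nat.sub_mul] at h5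
    omega
  have hconst : ∀ d, (d = a ∨ d = b) → ∃ e ∈ M, e ^ m = d ∧ ∀ x ∈ M, x ^ m = d → x = e := by
    intro d hd
    obtain ⟨B, hB, f, hf, hfd⟩ := hblock d hd
    obtain ⟨e, heL, hed⟩ := exL d hd
    refine ⟨e, mem_of_le hLM heL, hed, fun x hx hxd => ?_⟩
    rw [← hMsum, mem_add] at hx
    rcases hx with hxL | hxB
    · rw [swap B hB f hf x hxL (hxd.trans hfd.symm), swap B hB f hf e heL (hed.trans hfd.symm)]
    · obtain ⟨C, hC, hxC⟩ := mem_join.1 hxB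
      exact (swap C hC x hxC e heL (hed.trans hxd.symm)).symm
  obtain ⟨e, heM, hea, he⟩ := hconst a (Or.inl rfl)
  obtain ⟨f, hfM, hfb, hf⟩ := hconst b (Or.inr rfl)
  refine ⟨e, f, eq_replicate_add_replicate ?_ ?_ (hcount_le e) (hcount_le f) (by omega)⟩
  · rintro rfl
    exact hab (hea.symm.trans hfb)
  · exact fun x hx => (classes x hx).imp (he x hx) (hf x hx)

/-- The inverse Erdős–Ginzburg–Ziv theorem for finite cyclic groups. -/
theorem inverseEGZ_of_orderOf (n : ℕ) (hn : 0 < n) (g : A) (hg : orderOf g = n) :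
    InverseEGZ g n := by
  induction n using Nat.strong_induction_on generalizing g with
  | _ n ih =>
    rcases Nat.lt_or_ge n 2 with h1 | h2
    · obtain rfl : n = 1 := by omega
      intro M _ hc _
      exact ⟨1, 1, by simpa using hc⟩
    by_cases hprime : n.Prime
    · exact fun M hM hc hfree =>
        eq_replicate_of_prime_of_forall_prod_ne_one g hprime hg M hM hc hfree
    · obtain ⟨p, m, hp, hm, rfl⟩ : ∃ p m, p.Prime ∧ 2 ≤ m ∧ n = p * m := by
        obtain ⟨m, hm⟩ := n.minFac_dvd
        refine ⟨n.minFac, m, Nat.minFac_prime (by omega), ?_, hm⟩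
        by_contra! h
        interval_cases m
        · omega
        · rw [mul_one] at hm
          exact hprime (hm ▸ Nat.minFac_prime (by omega))
      have hp2 := hp.two_le
      have hpm : p * 2 ≤ p * m := Nat.mul_le_mul_left p hm
      have hpm' : 2 * m ≤ p * m := Nat.mul_le_mul_right m hp2
      refine InverseEGZ.mul g hp hm hg (ih p (by omega) (by omega) _ ?_)
        (ih m (by omega) (by omega) _ ?_)
      · rw [orderOf_pow_of_dvd (by omega) (by rw [hg]; exact dvd_mul_left _ _), hg,
          Nat.mul_div_cancel _ (by omega)]
      · rw [orderOf_pow_of_dvd (by omega) (by rw [hg]; exact dvd_mul_right _ _), hg,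
          Nat.mul_div_cancel_left _ (by omega)]

end InverseErdosGinzburgZiv

/-! ### The group given by the presentation, and its defining pairs. -/

section Presentation

variable {G : Type*} [Group G] {n : ℕ} {s : ℤ} {x y : G}

theorem IsPresentedBy.relations (h : IsPresentedBy n s x y) :
    x ^ 2 = y ^ (n / 2) ∧ y ^ n = 1 ∧ y * x = x * y ^ s := by
  have hk : relators n s ⊆ (FreeGroup.lift ![x, y]).ker := by
    rw [h.2]; exact Subgroup.subset_normalClosure
  have h1 := hk (show FreeGroup.of 0 ^ 2 * (FreeGroup.of 1 ^ (n / 2))⁻¹ ∈ relators n s by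
    simp [relators])
  have h2 := hk (show FreeGroup.of 1 ^ n ∈ relators n s by simp [relators])
  have h3 := hk (show (FreeGroup.of 1 * FreeGroup.of 0) *
    (FreeGroup.of 0 * FreeGroup.of 1 ^ s)⁻¹ ∈ relators n s by simp [relators])
  simp only [SetLike.mem_coe, MonoidHom.mem_ker, map_mul, map_pow, map_inv, map_zpow,
    FreeGroup.lift_apply_of, Matrix.cons_val_zero, Matrix.cons_val_one, mul_inv_eq_one] at h1 h2 h3
  exact ⟨h1, h2, h3⟩

/-- The universal property of the presentation. -/
theorem IsPresentedBy.exists_hom (h : IsPresentedBy n s x y) {M : Type*} [Group M] {a b : M}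
    (h1 : a ^ 2 = b ^ (n / 2)) (h2 : b ^ n = 1) (h3 : b * a = a * b ^ s) :
    ∃ φ : G →* M, φ x = a ∧ φ y = b := by
  have hker : (FreeGroup.lift ![x, y]).ker ≤ (FreeGroup.lift ![a, b]).ker := by
    rw [h.2]
    refine Subgroup.normalClosure_le_normal ?_
    intro w hw
    simp only [relators, Set.mem_insert_iff, Set.mem_singleton_iff] at hw
    rw [SetLike.mem_coe, MonoidHom.mem_ker]
    rcases hw with rfl | rfl | rfl <;> simp [h1, h2, h3]
  let φ := (FreeGroup.lift ![x, y]).liftOfSurjective h.1 ⟨FreeGroup.lift ![a, b], hker⟩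
  have hφ : ∀ w, φ (FreeGroup.lift ![x, y] w) = FreeGroup.lift ![a, b] w := fun w =>
    (FreeGroup.lift ![x, y]).liftOfRightInverse_comp_apply _ _ ⟨FreeGroup.lift ![a, b], hker⟩ w
  exact ⟨φ, by simpa using hφ (FreeGroup.of 0), by simpa using hφ (FreeGroup.of 1)⟩

theorem IsPresentedBy.closure_eq_top (h : IsPresentedBy n s x y) :
    Subgroup.closure {x, y} = ⊤ := by
  have := FreeGroup.range_lift_eq_closure (f := ![x, y])
  rw [MonoidHom.range_eq_top.2 h.1] at this
  rw [this]
  congr 1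
  ext z
  simp [eq_comm, or_comm]

/-- The permutation of `ZMod n × Bool` given by left multiplication by `y`, where `(i, ε)` stands
for `x ^ ε * y ^ i`. -/
def modelY (n : ℕ) (s : ℤ) : Equiv.Perm (ZMod n × Bool) where
  toFun p := (p.1 + (if p.2 then (s : ZMod n) else 1), p.2)
  invFun p := (p.1 - (if p.2 then (s : ZMod n) else 1), p.2)
  left_inv p := by simp
  right_inv p := by simp

/-- The permutation of `ZMod n × Bool` given by left multiplication by `x`, where `(i, ε)` stands
for `x ^ ε * y ^ i`. -/
def modelX (n : ℕ) : Equiv.Perm (ZMod n × Bool) where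
  toFun p := (p.1 + (if p.2 then ((n / 2 : ℕ) : ZMod n) else 0), !p.2)
  invFun p := (p.1 - (if p.2 then 0 else ((n / 2 : ℕ) : ZMod n)), !p.2)
  left_inv p := by rcases p with ⟨i, _ | _⟩ <;> simp
  right_inv p := by rcases p with ⟨i, _ | _⟩ <;> simp

theorem modelY_apply (n : ℕ) (s : ℤ) (p : ZMod n × Bool) :
    modelY n s p = (p.1 + (if p.2 then (s : ZMod n) else 1), p.2) := rfl

theorem modelX_apply (n : ℕ) (p : ZMod n × Bool) :
    modelX n p = (p.1 + (if p.2 then ((n / 2 : ℕ) : ZMod n) else 0), !p.2) := rfl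

theorem modelY_pow_apply (n : ℕ) (s : ℤ) (k : ℕ) (p : ZMod n × Bool) :
    (modelY n s ^ k) p = (p.1 + k * (if p.2 then (s : ZMod n) else 1), p.2) := by
  induction k with
  | zero => simp
  | succ k ih =>
    rw [pow_succ', Equiv.Perm.mul_apply, ih]
    simp only [modelY, Equiv.coe_fn_mk, Prod.mk.injEq, and_true]
    push_cast
    ring

theorem modelY_zpow_apply (n : ℕ) (s : ℤ) (k : ℤ) (p : ZMod n × Bool) :
    (modelY n s ^ k) p = (p.1 + k * (if p.2 then (s : ZMod n) else 1), p.2) := by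
  rcases k with k | k
  · simpa using modelY_pow_apply n s k p
  · rw [zpow_negSucc, Equiv.Perm.inv_eq_iff_eq, modelY_pow_apply]
    ext
    · push_cast; ring
    · rfl

/-- This is the consistency of x² = y^(n/2) with conjugation by x: (n/2)(s - 1) is a multiple of n
because s - 1 is even. -/
theorem natCast_half_mul_of_odd {n : ℕ} (h2 : 2 ∣ n) {s : ℤ} (hs : Odd s) :
    ((n / 2 : ℕ) : ZMod n) * s = (n / 2 : ℕ) := by
  obtain ⟨k, rfl⟩ := h2
  obtain ⟨j, rfl⟩ := hs
  rw [Nat.mul_div_cancel_left k (by norm_num)]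
  have : ((2 * k : ℕ) : ZMod (2 * k)) = 0 := ZMod.natCast_self _
  push_cast at this ⊢
  linear_combination (j : ZMod (2 * k)) * this

theorem odd_of_sq_modEq_one (hn : 2 ∣ n) (hs : s ^ 2 ≡ 1 [ZMOD n]) : Odd s := by
  have h2 : s ^ 2 ≡ 1 [ZMOD 2] := hs.of_dvd (by exact_mod_cast hn)
  by_contra hev
  rw [Int.not_odd_iff_even] at hev
  obtain ⟨k, rfl⟩ := hev
  rw [Int.ModEq] at h2
  ring_nf at h2
  omega

/-- The relations only bound the order of y from above. The permutation model on the normal forms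
x^ε y^i satisfies them, and evaluating at the identity position (0, false) shows that nothing
collapses further. -/
theorem IsPresentedBy.orderOf_eq (hn : 2 ∣ n) (hs : s ^ 2 ≡ 1 [ZMOD n])
    (h : IsPresentedBy n s x y) : orderOf y = n ∧ x ∉ Subgroup.zpowers y := by
  have hodd := odd_of_sq_modEq_one hn hs
  have hss : (s : ZMod n) * s = 1 := by
    have := (ZMod.intCast_eq_intCast_iff _ _ _).2 hs
    push_cast at this
    rw [← this, sq]
  have hhalf := natCast_half_mul_of_odd hn hodd
  obtain ⟨φ, hx, hy⟩ := h.exists_hom (a := modelX n) (b := modelY n s)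
    (by
      ext ⟨i, _ | _⟩ : 1 <;> rw [modelY_pow_apply] <;> simp [modelX, sq, hhalf])
    (by ext ⟨i, _ | _⟩ : 1 <;> rw [modelY_pow_apply] <;> simp)
    (by
      ext ⟨i, _ | _⟩ : 1
      · simp [modelX_apply, modelY_zpow_apply, modelY_apply]
      · simp only [modelX_apply, modelY_apply, Equiv.Perm.mul_apply, modelY_zpow_apply]
        simp [hss]
        ring)
  constructor
  · apply Nat.dvd_antisymm (orderOf_dvd_of_pow_eq_one h.relations.2.1)
    have h1 := congrArg (fun g => (φ g) (0, false)) (pow_orderOf_eq_one y)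
    simp only [map_pow, hy, modelY_pow_apply, map_one] at h1
    have h2 := congrArg Prod.fst h1
    simp only [Equiv.Perm.coe_one, id_eq] at h2
    exact (ZMod.natCast_eq_zero_iff _ _).1 (by simpa using h2)
  · intro hxy
    obtain ⟨i, hi⟩ := Subgroup.mem_zpowers_iff.1 hxy
    have h1 := congrArg (fun g => ((φ g) (0, false)).2) hi
    simp only [map_zpow, hx, hy, modelY_zpow_apply] at h1
    simp [modelX] at h1

theorem zpow_mul_eq_mul_zpow (h : y * x = x * y ^ s) (i : ℤ) : y ^ i * x = x * y ^ (s * i) := by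
  have h1 : SemiconjBy x (y ^ s) y := h.symm
  rw [zpow_mul]
  exact (h1.zpow_right i).symm

theorem exists_eq_zpow_or_mul_zpow (htop : Subgroup.closure {x, y} = ⊤)
    (h1 : ∃ k : ℤ, x ^ 2 = y ^ k) (h3 : y * x = x * y ^ s) (hss : y ^ (s * s) = y) (g : G) :
    (∃ i : ℤ, g = y ^ i) ∨ ∃ i : ℤ, g = x * y ^ i := by
  obtain ⟨k, h1⟩ := h1
  have hg : g ∈ Subgroup.closure {x, y} := htop ▸ Subgroup.mem_top g
  have hx : x⁻¹ = x * y ^ (-k) := by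
    rw [zpow_neg, ← h1, sq, mul_inv_rev, mul_inv_cancel_left]
  have hmul : ∀ i : ℤ, y ^ i * x = x * y ^ (s * i) := zpow_mul_eq_mul_zpow h3
  have stepx : ∀ i : ℤ, x * (x * y ^ i) = y ^ (k + i) := by
    intro i
    rw [← mul_assoc, ← sq, h1, zpow_add]
  induction hg using Subgroup.closure_induction_left with
  | one => exact Or.inl ⟨0, by simp⟩
  | mul_left z hz w _ ih =>
    rcases hz with rfl | rfl
    · rcases ih with ⟨i, rfl⟩ | ⟨i, rfl⟩
      · exact Or.inr ⟨i, rfl⟩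
      · exact Or.inl ⟨k + i, stepx i⟩
    · rcases ih with ⟨i, rfl⟩ | ⟨i, rfl⟩
      · exact Or.inl ⟨1 + i, by rw [zpow_add, zpow_one]⟩
      · exact Or.inr ⟨s + i, by rw [← mul_assoc, h3, zpow_add, mul_assoc]⟩
  | inv_mul_cancel z hz w _ ih =>
    rcases hz with rfl | rfl
    · rcases ih with ⟨i, rfl⟩ | ⟨i, rfl⟩
      · exact Or.inr ⟨-k + i, by rw [hx, zpow_add, mul_assoc]⟩
      · exact Or.inl ⟨i, by rw [inv_mul_cancel_left]⟩
    · rcases ih with ⟨i, rfl⟩ | ⟨i, rfl⟩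
      · exact Or.inl ⟨-1 + i, by rw [zpow_add, zpow_neg_one]⟩
      · refine Or.inr ⟨s * -1 + i, ?_⟩
        rw [← mul_assoc, ← zpow_neg_one, hmul, zpow_add, mul_assoc]

theorem zpow_sq_eq_self (hy : y ^ n = 1) (hs : s ^ 2 ≡ 1 [ZMOD n]) : y ^ (s * s) = y := by
  have h1 : y ^ (s * s - 1) = 1 := by
    obtain ⟨k, hk⟩ := hs.symm.dvd
    rw [← sq, hk, zpow_mul, zpow_natCast, hy, one_zpow]
  rw [← sub_add_cancel (s * s) 1, zpow_add, h1, one_mul, zpow_one]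

theorem IsPresentedBy.exists_eq (hs : s ^ 2 ≡ 1 [ZMOD n]) (h : IsPresentedBy n s x y) (g : G) :
    (∃ i : ℤ, g = y ^ i) ∨ ∃ i : ℤ, g = x * y ^ i := by
  obtain ⟨h1, h2, h3⟩ := h.relations
  exact exists_eq_zpow_or_mul_zpow h.closure_eq_top ⟨(n / 2 : ℕ), by rw [zpow_natCast, h1]⟩ h3
    (zpow_sq_eq_self h2 hs) g

theorem IsPresentedBy.card_eq (hn : 2 ∣ n) (hs : s ^ 2 ≡ 1 [ZMOD n])
    (h : IsPresentedBy n s x y) : Nat.card G = 2 * n := by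
  obtain ⟨ho, hx⟩ := h.orderOf_eq hn hs
  have hx' : x⁻¹ ∉ Subgroup.zpowers y := fun h => hx (by simpa using h)
  have hidx : (Subgroup.zpowers y).index = 2 := by
    rw [Subgroup.index_eq_two_iff]
    obtain ⟨h1, h2, h3⟩ := h.relations
    refine ⟨x, fun b => ?_⟩
    rcases h.exists_eq hs b with ⟨i, rfl⟩ | ⟨i, rfl⟩
    · refine Or.inr ⟨Subgroup.zpow_mem_zpowers _ _, fun hc => hx ?_⟩
      exact (Subgroup.mul_mem_cancel_left _ (Subgroup.zpow_mem_zpowers y i)).1 hc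
    · refine Or.inl ⟨?_, fun hc => hx ?_⟩
      · rw [mul_assoc, zpow_mul_eq_mul_zpow h3, ← mul_assoc, ← sq, h1]
        exact Subgroup.mul_mem _ (Subgroup.npow_mem_zpowers _ _) (Subgroup.zpow_mem_zpowers _ _)
      · exact (Subgroup.mul_mem_cancel_right _ (Subgroup.zpow_mem_zpowers y i)).1 hc
  rw [← Subgroup.card_mul_index (Subgroup.zpowers y), hidx, Nat.card_zpowers, ho, mul_comm]

/-- A generating pair that satisfies the defining relations is a defining pair. -/
theorem IsPresentedBy.of_relations (hn : 2 ∣ n) (hn0 : 0 < n) (hs : s ^ 2 ≡ 1 [ZMOD n])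
    (h : IsPresentedBy n s x y) {α β : G} (h1 : α ^ 2 = β ^ (n / 2)) (h2 : orderOf β = n)
    (h3 : β * α = α * β ^ s) (hα : α ∉ Subgroup.zpowers β) : IsPresentedBy n s α β := by
  have hcard := h.card_eq hn hs
  have hfin : Finite G := Nat.finite_of_card_ne_zero (by omega)
  have hβ : β ^ n = 1 := by rw [← h2, pow_orderOf_eq_one]
  obtain ⟨φ, hφx, hφy⟩ := h.exists_hom h1 hβ h3
  have hcomp : (FreeGroup.lift ![α, β]) = φ.comp (FreeGroup.lift ![x, y]) := by
    ext i
    fin_cases i <;> simp [hφx, hφy]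
  -- The image of φ contains ⟨β⟩, of order n, properly since it contains α, and its order divides
  -- 2n.
  have hsurj : Function.Surjective φ := by
    rw [← MonoidHom.range_eq_top]
    apply Subgroup.eq_top_of_card_eq
    have hle : Subgroup.zpowers β ≤ φ.range := by
      rw [Subgroup.zpowers_le]; exact ⟨y, hφy⟩
    have hne : Subgroup.zpowers β ≠ φ.range := fun he => hα (he ▸ ⟨x, hφx⟩)
    have hlt : Nat.card (Subgroup.zpowers β) ≠ Nat.card φ.range := fun he =>
      hne (Subgroup.eq_of_le_of_card_ge hle he.ge)
    rw [Nat.card_zpowers, h2] at hlt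
    have hd1 : n ∣ Nat.card φ.range := by
      have := Subgroup.card_dvd_of_le hle
      rwa [Nat.card_zpowers, h2] at this
    have hd2 : Nat.card φ.range ∣ 2 * n := hcard ▸ Subgroup.card_subgroup_dvd_card _
    rw [hcard]
    obtain ⟨k, hk⟩ := hd1
    rw [hk, mul_comm 2 n] at hd2
    have hk2 : k ∣ 2 := Nat.dvd_of_mul_dvd_mul_left hn0 hd2
    rcases (Nat.dvd_prime Nat.prime_two).1 hk2 with rfl | rfl
    · omega
    · omega
  have hinj : Function.Injective φ := Finite.injective_iff_surjective.2 hsurj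
  refine ⟨?_, ?_⟩
  · rw [hcomp]
    exact hsurj.comp h.1
  · rw [hcomp, ← h.2, ← MonoidHom.comap_ker, (MonoidHom.ker_eq_bot_iff φ).2 hinj]
    rfl

end Presentation

/-! ### Product-one freeness by lists; sequences inside a cyclic subgroup. -/

section FreeIffLists

open Multiset

variable {G : Type*} [Group G]

theorem productOneFreeOfLength_iff {k : ℕ} {S : Multiset G} : ProductOneFreeOfLength k S ↔
    ∀ l : List G, (l : Multiset G) ≤ S → l.length = k → l.prod ≠ 1 := by
  constructor
  · intro h l hl hk h1
    exact h ⟨l, hl, by simpa using hk, l, rfl, h1⟩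
  · rintro h ⟨T, hT, hTk, l, rfl, h1⟩
    exact h l hT (by simpa using hTk) h1

theorem ProductOneFreeOfLength.mono {k : ℕ} {S T : Multiset G} (hTS : T ≤ S)
    (h : ProductOneFreeOfLength k S) : ProductOneFreeOfLength k T := by
  rw [productOneFreeOfLength_iff] at h ⊢
  exact fun l hl => h l (hl.trans hTS)

theorem exists_list_of_mem_zpowers (κ : G) {m : ℕ} (hκ : orderOf κ = m) (M : Multiset G)
    (hM : ∀ x ∈ M, x ∈ Subgroup.zpowers κ) (hc : 2 * m - 1 ≤ M.card) :
    ∃ l : List G, (l : Multiset G) ≤ M ∧ l.length = m ∧ l.prod = 1 := by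
  lift M to Multiset (Subgroup.zpowers κ) using hM
  let _ : CommGroup (Subgroup.zpowers κ) := IsCyclic.commGroup
  obtain ⟨T, hT, hTc, hT1⟩ := exists_prod_eq_one_of_mem_zpowers
    (⟨κ, Subgroup.mem_zpowers κ⟩ : Subgroup.zpowers κ) (hκ ▸ Subgroup.orderOf_mk _ _) M
    (by
      rintro ⟨x, hx⟩ -
      obtain ⟨i, rfl⟩ := Subgroup.mem_zpowers_iff.1 hx
      exact Subgroup.mem_zpowers_iff.2 ⟨i, by ext; simp⟩)
    (by simpa using hc)
  induction T using Quotient.inductionOn with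
  | h l =>
    refine ⟨l.map (Subgroup.zpowers κ).subtype, ?_, by simpa using hTc, ?_⟩
    · rw [← map_coe]
      exact map_le_map hT
    · rw [List.prod_hom]
      have : l.prod = 1 := by simpa using hT1
      rw [this, map_one]

theorem exists_eq_replicate_of_mem_zpowers (κ : G) {m : ℕ} (hm : 2 ≤ m) (hκ : orderOf κ = m)
    (M : Multiset G) (hM : ∀ x ∈ M, x ∈ Subgroup.zpowers κ) (hc : M.card = 2 * m - 2)
    (hfree : ∀ l : List G, (l : Multiset G) ≤ M → l.length = m → l.prod ≠ 1) :
    ∃ u ∈ Subgroup.zpowers κ, ∃ v ∈ Subgroup.zpowers κ,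
      M = replicate (m - 1) u + replicate (m - 1) v ∧ orderOf (u * v⁻¹) = m := by
  have hM' := hM
  lift M to Multiset (Subgroup.zpowers κ) using hM
  let _ : CommGroup (Subgroup.zpowers κ) := IsCyclic.commGroup
  obtain ⟨u, v, huv⟩ := inverseEGZ_of_orderOf m (by omega)
    (⟨κ, Subgroup.mem_zpowers κ⟩ : Subgroup.zpowers κ) (hκ ▸ Subgroup.orderOf_mk _ _) M
    (by
      rintro ⟨x, hx⟩ -
      obtain ⟨i, rfl⟩ := Subgroup.mem_zpowers_iff.1 hx
      exact Subgroup.mem_zpowers_iff.2 ⟨i, by ext; simp⟩)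
    (by simpa using hc)
    (by
      intro T hT hTc hT1
      induction T using Quotient.inductionOn with
      | h l =>
        refine hfree (l.map (Subgroup.zpowers κ).subtype) ?_ (by simpa using hTc) ?_
        · rw [← map_coe]
          exact map_le_map hT
        · rw [List.prod_hom]
          have : l.prod = 1 := by simpa using hT1
          rw [this, map_one])
  refine ⟨u, u.2, v, v.2, by rw [huv]; simp, ?_⟩
  rw [huv] at hfree
  have hpow : ∀ w : Subgroup.zpowers κ, w ^ m = 1 := by
    rintro ⟨w, hw⟩
    obtain ⟨i, rfl⟩ := Subgroup.mem_zpowers_iff.1 hw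
    ext
    simp only [SubmonoidClass.mk_pow, OneMemClass.coe_one]
    rw [← zpow_natCast, ← zpow_mul, mul_comm, zpow_mul, zpow_natCast, ← hκ, pow_orderOf_eq_one,
      one_zpow]
  rw [← Subgroup.coe_inv, ← Subgroup.coe_mul, Subgroup.orderOf_coe]
  refine Nat.le_antisymm (orderOf_le_of_pow_eq_one (by omega) (hpow _)) ?_
  by_contra! hlt
  set d := orderOf (u * v⁻¹) with hd
  have hd0 : 0 < d := (isOfFinOrder_iff_pow_eq_one.2 ⟨m, by omega, hpow _⟩).orderOf_pos
  -- If u v⁻¹ had order d < m, then u^d v^(m-d) = v^m = 1 would be a product-one subsequence, since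
  -- d and m - d are both at most m - 1.
  refine hfree (List.replicate d (u : G) ++ List.replicate (m - d) (v : G)) ?_ (by simp; omega) ?_
  · simp only [Multiset.map_add, map_replicate, ← coe_add, coe_replicate]
    exact add_le_add ((replicate_le_replicate _).2 (by omega))
      ((replicate_le_replicate _).2 (by omega))
  · have h1 : u ^ d * v ^ (m - d) = 1 := by
      have h2 := pow_orderOf_eq_one (u * v⁻¹)
      rw [← hd, mul_pow, inv_pow, mul_inv_eq_one] at h2
      rw [h2, ← pow_add, Nat.add_sub_cancel' hlt.le, hpow]
    rw [List.prod_append, List.prod_replicate, List.prod_replicate]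
    exact_mod_cast congrArg Subtype.val h1

end FreeIffLists

/-- The elementary abelian group of order four, written multiplicatively. -/
abbrev Klein : Type := Multiplicative (ZMod 2 × ZMod 2)

theorem Klein.mul_mul_mul_eq_one : ∀ a b c d : Klein, [a, b, c, d].Nodup →
    a * b * c * d = 1 := by
  decide

theorem Klein.mul_self : ∀ a : Klein, a * a = 1 := by
  decide

/-! ### Pairing the terms within cosets of the kernel. -/

section Pairing

open Multiset

variable {G : Type*} [Group G] {φ : G →* Klein} {κ : G} {m : ℕ} {S : Multiset G}

/-- All terms occurring in a collection of pairs. -/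
def terms {G : Type*} (Bs : Multiset (G × G)) : Multiset G := Bs.map Prod.fst + Bs.map Prod.snd

/-- The products of the pairs of a collection. -/
def pairProducts (Bs : Multiset (G × G)) : Multiset G := Bs.map fun p => p.1 * p.2

theorem terms_cons {G : Type*} (p : G × G) (Bs : Multiset (G × G)) :
    terms (p ::ₘ Bs) = p.1 ::ₘ p.2 ::ₘ terms Bs := by
  simp [terms, cons_swap]

theorem terms_add {G : Type*} (Bs Cs : Multiset (G × G)) : terms (Bs + Cs) = terms Bs + terms Cs := by
  simp only [terms, Multiset.map_add]
  abel

theorem pairProducts_cons (p : G × G) (Bs : Multiset (G × G)) :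
    pairProducts (p ::ₘ Bs) = (p.1 * p.2) ::ₘ pairProducts Bs := by
  simp [pairProducts]

theorem card_terms {G : Type*} (Bs : Multiset (G × G)) : (terms Bs).card = 2 * Bs.card := by
  simp [terms]; ring

theorem exists_list_of_pairProducts (l : List G) (Bs : Multiset (G × G))
    (h : (l : Multiset G) ≤ pairProducts Bs) :
    ∃ l' : List G, (l' : Multiset G) ≤ terms Bs ∧ l'.length = 2 * l.length ∧ l'.prod = l.prod := by
  obtain ⟨C, hC, rfl⟩ := exists_list_of_coe_le_map _ l Bs h
  refine ⟨C.flatMap fun p => [p.1, p.2], ?_, ?_, ?_⟩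
  · obtain ⟨D, rfl⟩ := Multiset.le_iff_exists_add.1 hC
    rw [terms_add]
    refine le_trans (le_of_eq ?_) (Multiset.le_add_right _ _)
    clear hC h
    induction C with
    | nil => simp [terms]
    | cons p C ih =>
      rw [← cons_coe, terms_cons, ← ih]
      rfl
  · clear hC h
    induction C with
    | nil => rfl
    | cons p C ih =>
      rw [List.flatMap_cons, List.length_append, ih]
      simp; ring
  · clear hC h
    induction C with
    | nil => rfl
    | cons p C ih =>
      rw [List.flatMap_cons, List.prod_append, ih]
      simp [mul_assoc]

/-- `S` is grouped into pairs of terms with the same image under `φ`, and remaining terms with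
distinct images. -/
structure Pairing (φ : G →* Klein) (S : Multiset G) (Bs : Multiset (G × G))
    (L : Multiset G) : Prop where
  eq : S = terms Bs + L
  map_eq : ∀ p ∈ Bs, φ p.1 = φ p.2
  nodup : (L.map φ).Nodup

theorem exists_pairing (φ : G →* Klein) (S : Multiset G) : ∃ Bs L, Pairing φ S Bs L := by
  induction h : S.card using Nat.strong_induction_on generalizing S with
  | _ k ih =>
    by_cases hnd : (S.map φ).Nodup
    · exact ⟨0, S, by simp [terms], by simp, hnd⟩
    · rw [nodup_iff_le] at hnd
      push Not at hnd
      obtain ⟨c, hc⟩ := hnd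
      obtain ⟨U, hU, hUc⟩ := exists_le_map_eq φ _ S hc
      obtain ⟨a, b, rfl⟩ := card_eq_two.1 (show U.card = 2 by
        rw [← card_map φ, hUc]; rfl)
      obtain ⟨R, rfl⟩ := Multiset.le_iff_exists_add.1 hU
      have hab : φ a = c ∧ φ b = c := by
        have h1 : φ a ∈ c ::ₘ c ::ₘ 0 := by rw [← hUc]; simp
        have h2 : φ b ∈ c ::ₘ c ::ₘ 0 := by rw [← hUc]; simp
        exact ⟨by simpa using h1, by simpa using h2⟩
      obtain ⟨Bs, L, hP⟩ := ih R.card (by rw [← h, card_add]; simp) R rfl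
      refine ⟨(a, b) ::ₘ Bs, L, ?_, ?_, hP.nodup⟩
      · rw [terms_cons, hP.eq]
        simp [insert_eq_cons]
      · intro p hp
        rcases mem_cons.1 hp with rfl | hp
        · exact hab.1.trans hab.2.symm
        · exact hP.map_eq p hp

theorem exists_pairing_of_mem {a b : G} (hab : φ a = φ b) (h : a ::ₘ b ::ₘ 0 ≤ S) :
    ∃ Bs L, (a, b) ∈ Bs ∧ Pairing φ S Bs L := by
  obtain ⟨R, rfl⟩ := Multiset.le_iff_exists_add.1 h
  obtain ⟨Bs, L, hP⟩ := exists_pairing φ R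
  refine ⟨(a, b) ::ₘ Bs, L, mem_cons_self _ _, ?_, ?_, hP.nodup⟩
  · rw [terms_cons, hP.eq]
    simp
  · intro p hp
    rcases mem_cons.1 hp with rfl | hp
    · exact hab
    · exact hP.map_eq p hp

/-- A sequence of length `4 m - 1` without product-one subsequence of length `2 m`, over a group
which is an extension of the Klein four-group by the cyclic group `⟨κ⟩` of order `m`. -/
structure FreeConfig (φ : G →* Klein) (κ : G) (m : ℕ) (S : Multiset G) : Prop where
  ker_eq : φ.ker = Subgroup.zpowers κ
  orderOf_eq : orderOf κ = m
  four_le : 4 ≤ m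
  card_eq : S.card = 4 * m - 1
  free : ProductOneFreeOfLength (2 * m) S

theorem zpowers_commute {u v : G} (hu : u ∈ Subgroup.zpowers κ) (hv : v ∈ Subgroup.zpowers κ) :
    Commute u v := by
  obtain ⟨i, rfl⟩ := Subgroup.mem_zpowers_iff.1 hu
  obtain ⟨j, rfl⟩ := Subgroup.mem_zpowers_iff.1 hv
  exact Commute.zpow_zpow_self κ i j

theorem pow_eq_one_of_mem_zpowers (hκ : orderOf κ = m) {u : G} (hu : u ∈ Subgroup.zpowers κ) :
    u ^ m = 1 := by
  obtain ⟨i, rfl⟩ := Subgroup.mem_zpowers_iff.1 hu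
  rw [← zpow_natCast, ← zpow_mul, mul_comm, zpow_mul, zpow_natCast, ← hκ, pow_orderOf_eq_one,
    one_zpow]

theorem zpowers_eq_of_orderOf_eq (hκ : orderOf κ = m) (hm : 0 < m) {w : G}
    (hw : w ∈ Subgroup.zpowers κ) (ho : orderOf w = m) :
    Subgroup.zpowers w = Subgroup.zpowers κ := by
  have : Finite (Subgroup.zpowers κ) := by
    apply Nat.finite_of_card_ne_zero
    rw [Nat.card_zpowers]
    omega
  refine Subgroup.eq_of_le_of_card_ge (Subgroup.zpowers_le.2 hw) ?_
  rw [Nat.card_zpowers, Nat.card_zpowers, ho, hκ]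

/-- Given `u, v ∈ ⟨κ⟩` such that `u * v⁻¹` generates, the products `u ^ i * v ^ (t - i)` for
`i < m` cover `⟨κ⟩`. -/
theorem exists_mul_zpow_eq_one (hκ : orderOf κ = m) (hm : 0 < m) {u v : G}
    (hu : u ∈ Subgroup.zpowers κ) (hv : v ∈ Subgroup.zpowers κ) (ho : orderOf (u * v⁻¹) = m)
    (t : ℤ) {k : G} (hk : k ∈ Subgroup.zpowers κ) :
    ∃ i < m, k * (u ^ i * v ^ (t - i)) = 1 := by
  have hw := Subgroup.mul_mem _ hu (Subgroup.inv_mem _ hv)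
  have hgen := zpowers_eq_of_orderOf_eq hκ hm hw ho
  have hk' : (k * v ^ t)⁻¹ ∈ Subgroup.zpowers (u * v⁻¹) := by
    rw [hgen]
    exact Subgroup.inv_mem _ (Subgroup.mul_mem _ hk (Subgroup.zpow_mem _ hv _))
  obtain ⟨j, hj⟩ := Subgroup.mem_zpowers_iff.1 hk'
  obtain ⟨i, hi, hiw⟩ : ∃ i < m, (u * v⁻¹) ^ i = (k * v ^ t)⁻¹ := by
    have h0 := Int.emod_nonneg j (show (m : ℤ) ≠ 0 by omega)
    have h1 := Int.emod_lt_of_pos j (show (0 : ℤ) < m by omega)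
    refine ⟨(j % m).toNat, by omega, ?_⟩
    rw [← zpow_natCast, Int.toNat_of_nonneg h0, ← hj, ← zpow_mod_orderOf (u * v⁻¹) j, ho]
  refine ⟨i, hi, ?_⟩
  have huv := zpowers_commute hu (Subgroup.inv_mem _ hv)
  rw [huv.mul_pow] at hiw
  have h2 : u ^ i * v ^ (t - i) = (k * v ^ t)⁻¹ * v ^ t := by
    rw [← hiw, zpow_sub, inv_pow, zpow_natCast, mul_assoc]
    congr 1
    exact ((Commute.refl v).pow_left i).inv_left.zpow_right t |>.eq.symm
  rw [h2, ((zpowers_commute hk hv).zpow_right t).eq, mul_inv_rev, mul_assoc,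
    inv_mul_cancel, mul_one, mul_inv_cancel]

end Pairing

/-! ### Rigidity of pairings of a free sequence. -/

section FreeConfig

open Multiset

variable {G : Type*} [Group G] {φ : G →* Klein} {κ : G} {m : ℕ} {S : Multiset G}
  {Bs Rs : Multiset (G × G)} {L : Multiset G}

theorem Pairing.pairProducts_mem (hC : FreeConfig φ κ m S) (hP : Pairing φ S Bs L) :
    ∀ x ∈ pairProducts Bs, x ∈ Subgroup.zpowers κ := by
  intro x hx
  obtain ⟨p, hp, rfl⟩ := mem_map.1 hx
  rw [← hC.ker_eq, MonoidHom.mem_ker, map_mul, hP.map_eq p hp, Klein.mul_self]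

theorem Pairing.pairProducts_free (hC : FreeConfig φ κ m S) (hP : Pairing φ S Bs L) (l : List G)
    (hl : (l : Multiset G) ≤ pairProducts Bs) (hm : l.length = m) : l.prod ≠ 1 := by
  obtain ⟨l', hl', hlen, hprod⟩ := exists_list_of_pairProducts l Bs hl
  rw [← hprod]
  refine productOneFreeOfLength_iff.1 hC.free l' (hl'.trans ?_) (by rw [hlen, hm])
  rw [hP.eq]
  exact Multiset.le_add_right _ _

/-- Leftover terms lie in distinct classes, so there are at most four, and by parity one or three. A
single leftover term would mean 2m - 1 pairs, contradicting Erdős–Ginzburg–Ziv in ⟨κ⟩. -/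
theorem Pairing.card_eq (hC : FreeConfig φ κ m S) (hP : Pairing φ S Bs L) :
    L.card = 3 ∧ Bs.card = 2 * m - 2 := by
  have hm := hC.four_le
  have h4 : L.card ≤ 4 := by
    rw [← card_map φ]
    calc (L.map φ).card = (⟨L.map φ, hP.nodup⟩ : Finset Klein).card := rfl
      _ ≤ Fintype.card Klein := Finset.card_le_univ _
      _ = 4 := by decide
  have h := congrArg card hP.eq
  rw [hC.card_eq, card_add, card_terms] at h
  have hBs : Bs.card < 2 * m - 1 := by
    by_contra! hge
    obtain ⟨l, hl, hlm, h1⟩ := exists_list_of_mem_zpowers κ hC.orderOf_eq (pairProducts Bs)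
      (hP.pairProducts_mem hC) (by simpa [pairProducts] using hge)
    exact hP.pairProducts_free hC l hl hlm h1
  omega

theorem Pairing.exists_eq_replicate (hC : FreeConfig φ κ m S) (hP : Pairing φ S Bs L) :
    ∃ u ∈ Subgroup.zpowers κ, ∃ v ∈ Subgroup.zpowers κ,
      pairProducts Bs = replicate (m - 1) u + replicate (m - 1) v ∧ orderOf (u * v⁻¹) = m :=
  exists_eq_replicate_of_mem_zpowers κ (by have := hC.four_le; omega) hC.orderOf_eq _
    (hP.pairProducts_mem hC) (by simpa [pairProducts] using (hP.card_eq hC).2)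
    (hP.pairProducts_free hC)

theorem ne_of_orderOf_mul_inv {u v : G} (hm : 4 ≤ m) (h : orderOf (u * v⁻¹) = m) : u ≠ v := by
  rintro rfl
  rw [mul_inv_cancel, orderOf_one] at h
  omega

/-- Replacing a single pair in a pairing does not change its product. -/
theorem Pairing.mul_eq_mul (hC : FreeConfig φ κ m S) {p q : G × G} {L' : Multiset G}
    (hP : Pairing φ S (p ::ₘ Rs) L) (hQ : Pairing φ S (q ::ₘ Rs) L') :
    p.1 * p.2 = q.1 * q.2 := by
  have hm := hC.four_le
  obtain ⟨u, -, v, -, huv, ho⟩ := hP.exists_eq_replicate hC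
  obtain ⟨u', -, v', -, huv', ho'⟩ := hQ.exists_eq_replicate hC
  rw [pairProducts_cons] at huv huv'
  exact eq_of_cons_eq_replicate_add_replicate (by omega) (ne_of_orderOf_mul_inv hm ho)
    (ne_of_orderOf_mul_inv hm ho') huv huv'

theorem Pairing.swap {p : G × G} (hP : Pairing φ S (p ::ₘ Rs) L) :
    Pairing φ S (p.swap ::ₘ Rs) L := by
  refine ⟨?_, ?_, hP.nodup⟩
  · rw [hP.eq, terms_cons, terms_cons, cons_swap]
    rfl
  · intro q hq
    rcases mem_cons.1 hq with rfl | hq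
    · exact (hP.map_eq p (mem_cons_self _ _)).symm
    · exact hP.map_eq q (mem_cons_of_mem hq)

/-- Interchanging a and b is a replacement of one pair, so it preserves the product. -/
theorem Pairing.commute (hC : FreeConfig φ κ m S) (hP : Pairing φ S Bs L) {a b : G}
    (h : (a, b) ∈ Bs) : a * b = b * a := by
  obtain ⟨Rs, rfl⟩ := exists_cons_of_mem h
  exact hP.mul_eq_mul hC hP.swap

/-- A remaining term in the class of a pair equals the first term of that pair. -/
theorem Pairing.eq_fst (hC : FreeConfig φ κ m S) (hP : Pairing φ S Bs L) {a b e : G}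
    (h : (a, b) ∈ Bs) (he : e ∈ L) (hea : φ e = φ a) : e = a := by
  obtain ⟨Rs, rfl⟩ := exists_cons_of_mem h
  obtain ⟨L', rfl⟩ := exists_cons_of_mem he
  have hQ : Pairing φ S ((e, b) ::ₘ Rs) (a ::ₘ L') := by
    refine ⟨?_, ?_, ?_⟩
    · rw [hP.eq, terms_cons, terms_cons]
      simp only [cons_add, add_cons]
      exact cons_swap _ _ _
    · intro q hq
      rcases mem_cons.1 hq with rfl | hq
      · exact hea.trans (hP.map_eq _ (mem_cons_self _ _))
      · exact hP.map_eq q (mem_cons_of_mem hq)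
    · have := hP.nodup
      rw [map_cons] at this ⊢
      rwa [← hea]
  have h1 := hP.mul_eq_mul hC hQ
  exact (mul_right_cancel h1).symm

theorem Pairing.eq_snd (hC : FreeConfig φ κ m S) (hP : Pairing φ S Bs L) {a b e : G}
    (h : (a, b) ∈ Bs) (he : e ∈ L) (hea : φ e = φ a) : e = b := by
  obtain ⟨Rs, rfl⟩ := exists_cons_of_mem h
  exact hP.swap.eq_fst hC (mem_cons_self _ _) he (hea.trans (hP.map_eq _ h))

/-- Four terms with product in `⟨κ⟩`, completed by pairs of products `u` and `v`. -/
theorem FreeConfig.exists_pow (hC : FreeConfig φ κ m S) {u v : G}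
    (hu : u ∈ Subgroup.zpowers κ) (hv : v ∈ Subgroup.zpowers κ) (ho : orderOf (u * v⁻¹) = m)
    {E : List G} (hE : (E : Multiset G) + terms Rs ≤ S) (hlen : E.length = 4)
    (hEK : E.prod ∈ Subgroup.zpowers κ) {j : ℕ}
    (hj : j ≤ m - 2) (hR : replicate j u + replicate (m - 2) v ≤ pairProducts Rs) :
    ∃ i, j < i ∧ i < m ∧ E.prod * (u ^ i * v ^ ((m - 2 : ℤ) - i)) = 1 := by
  have hm := hC.four_le
  obtain ⟨i, him, hi⟩ := exists_mul_zpow_eq_one hC.orderOf_eq (by omega) hu hv ho (m - 2) hEK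
  refine ⟨i, ?_, him, hi⟩
  -- If i ≤ j, then i pairs of product u and m - 2 - i pairs of product v are available; with E they
  -- form 4 + 2(m - 2) = 2m terms of product one.
  by_contra! hji
  obtain ⟨l, hl, hlen', hprod⟩ := exists_list_of_pairProducts
    (List.replicate i u ++ List.replicate (m - 2 - i) v) Rs (by
      refine le_trans ?_ hR
      rw [← coe_add, coe_replicate, coe_replicate]
      exact add_le_add ((replicate_le_replicate _).2 hji)
        ((replicate_le_replicate _).2 (by omega)))
  refine productOneFreeOfLength_iff.1 hC.free (E ++ l) ?_ ?_ ?_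
  · rw [← coe_add]
    exact (add_le_add_right hl _).trans hE
  · rw [List.length_append, hlen, hlen', List.length_append, List.length_replicate,
      List.length_replicate]
    omega
  · rw [List.prod_append, hprod, List.prod_append, List.prod_replicate, List.prod_replicate,
      ← hi, ← zpow_natCast v]
    congr 3
    omega

/-- Every exponent i ≤ m - 2 would give a product-one subsequence, so i = m - 1 and E.prod is
inverse to u^(m-1) v⁻¹ = u⁻¹ v⁻¹. The value does not depend on the order of E. -/
theorem FreeConfig.prod_eq_mul (hC : FreeConfig φ κ m S) {u v : G}
    (hu : u ∈ Subgroup.zpowers κ) (hv : v ∈ Subgroup.zpowers κ) (ho : orderOf (u * v⁻¹) = m)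
    {E : List G} (hE : (E : Multiset G) + terms Rs ≤ S) (hlen : E.length = 4)
    (hEK : E.prod ∈ Subgroup.zpowers κ)
    (hR : replicate (m - 2) u + replicate (m - 2) v ≤ pairProducts Rs) : E.prod = u * v := by
  have hm := hC.four_le
  obtain ⟨i, hi, him, h1⟩ := hC.exists_pow hu hv ho hE hlen hEK le_rfl hR
  obtain rfl : i = m - 1 := by omega
  have h2 : u ^ (m - 1) = u⁻¹ := by
    rw [eq_inv_iff_mul_eq_one, ← pow_succ, Nat.sub_add_cancel (by omega),
      pow_eq_one_of_mem_zpowers hC.orderOf_eq hu]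
  have h3 : (m - 2 : ℤ) - ((m - 1 : ℕ) : ℤ) = -1 := by omega
  rw [h2, h3, zpow_neg_one, ← mul_inv_rev, mul_inv_eq_one] at h1
  rw [h1, (zpowers_commute hu hv).eq]

/-- The variant for E made of two pairs that both have product u: only m - 3 pairs of product u
remain, so i = m - 2 is possible as well. -/
theorem FreeConfig.prod_eq_mul_or_sq (hC : FreeConfig φ κ m S) {u v : G}
    (hu : u ∈ Subgroup.zpowers κ) (hv : v ∈ Subgroup.zpowers κ) (ho : orderOf (u * v⁻¹) = m)
    {E : List G} (hE : (E : Multiset G) + terms Rs ≤ S) (hlen : E.length = 4)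
    (hEK : E.prod ∈ Subgroup.zpowers κ)
    (hR : replicate (m - 3) u + replicate (m - 2) v ≤ pairProducts Rs) :
    E.prod = u * v ∨ E.prod = u * u := by
  have hm := hC.four_le
  obtain ⟨i, hi, him, h1⟩ := hC.exists_pow hu hv ho hE hlen hEK (by omega) hR
  have h2 : u ^ (m - 1) = u⁻¹ := by
    rw [eq_inv_iff_mul_eq_one, ← pow_succ, Nat.sub_add_cancel (by omega),
      pow_eq_one_of_mem_zpowers hC.orderOf_eq hu]
  obtain rfl | rfl : i = m - 1 ∨ i = m - 2 := by omega
  · left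
    have h3 : (m - 2 : ℤ) - ((m - 1 : ℕ) : ℤ) = -1 := by omega
    rw [h2, h3, zpow_neg_one, ← mul_inv_rev, mul_inv_eq_one] at h1
    rw [h1, (zpowers_commute hu hv).eq]
  · right
    have h3 : (m - 2 : ℤ) - ((m - 2 : ℕ) : ℤ) = 0 := by omega
    have h4 : u ^ (m - 2) = (u * u)⁻¹ := by
      rw [eq_inv_iff_mul_eq_one, ← sq, ← pow_add, Nat.sub_add_cancel (by omega),
        pow_eq_one_of_mem_zpowers hC.orderOf_eq hu]
    rw [h3, h4, zpow_zero, mul_one, mul_inv_eq_one] at h1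
    exact h1

/-- If the fourth class contains a pair, then all arrangements of the three remaining terms and a
term of this pair have the same product. -/
theorem Pairing.prod_eq_prod (hC : FreeConfig φ κ m S) (hP : Pairing φ S Bs L) {q r : G}
    (hq : (q, r) ∈ Bs) (hqL : φ q ∉ L.map φ) {E E' : List G}
    (hE : (E : Multiset G) = q ::ₘ L) (hE' : (E' : Multiset G) = q ::ₘ L) :
    E.prod = E'.prod := by
  classical
  have hm := hC.four_le
  obtain ⟨Rs, rfl⟩ := exists_cons_of_mem hq
  obtain ⟨u, hu, v, hv, huv, ho⟩ := hP.exists_eq_replicate hC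
  -- Only one pair is broken up, so at least m - 2 pairs of either product remain.
  have hR : replicate (m - 2) u + replicate (m - 2) v ≤ pairProducts Rs := by
    rw [pairProducts_cons] at huv
    have h1 : pairProducts Rs = (replicate (m - 1) u + replicate (m - 1) v).erase (q * r) := by
      rw [← huv, erase_cons_head]
    have hne := ne_of_orderOf_mul_inv hm ho
    rw [h1, Multiset.le_iff_count]
    intro x
    by_cases hx : x = q * r
    · subst hx
      rw [count_erase_self]
      simp only [count_add, count_replicate]
      split_ifs with h1 h2
      · exact absurd (h1.trans h2.symm) hne
      all_goals omega
    · rw [count_erase_of_ne hx]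
      simp only [count_add, count_replicate]
      split_ifs <;> omega
  have key : ∀ {F : List G}, (F : Multiset G) = q ::ₘ L → F.prod = u * v := by
    intro F hF
    have hlen : F.length = 4 := by
      rw [← coe_card, hF, card_cons, (hP.card_eq hC).1]
    refine hC.prod_eq_mul hu hv ho ?_ hlen ?_ hR
    · rw [hF, hP.eq, terms_cons, cons_add, cons_add, add_comm L, cons_le_cons_iff]
      exact add_le_add_left (le_cons_self _ _) _
    · rw [← hC.ker_eq, MonoidHom.mem_ker, map_list_prod]
      have hnd : (F.map φ).Nodup := by
        rw [← coe_nodup, ← map_coe, hF, map_cons, nodup_cons]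
        exact ⟨hqL, hP.nodup⟩
      obtain ⟨a, b, c, d, rfl⟩ : ∃ a b c d, F = [a, b, c, d] := by
        match F, hlen with
        | [a, b, c, d], _ => exact ⟨a, b, c, d, rfl⟩
      have := Klein.mul_mul_mul_eq_one _ _ _ _ hnd
      simpa [mul_assoc] using this
  rw [key hE, key hE']

end FreeConfig

/-! ### Two terms outside the abelian subgroup force centrality. -/

section FreeConfig

open Multiset

variable {G : Type*} [Group G] {φ : G →* Klein} {κ : G} {m : ℕ} {S : Multiset G}
  {Bs Rs : Multiset (G × G)} {L : Multiset G}

theorem orderOf_mul_inv_comm (u v : G) : orderOf (v * u⁻¹) = orderOf (u * v⁻¹) := by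
  rw [← orderOf_inv (u * v⁻¹), mul_inv_rev, inv_inv]

theorem Pairing.exists_eq_replicate_of_mem (hC : FreeConfig φ κ m S) (hP : Pairing φ S Bs L)
    {a b : G} (h : (a, b) ∈ Bs) :
    ∃ v ∈ Subgroup.zpowers κ, pairProducts Bs = replicate (m - 1) (a * b) + replicate (m - 1) v ∧
      orderOf (a * b * v⁻¹) = m := by
  obtain ⟨u, hu, v, hv, huv, ho⟩ := hP.exists_eq_replicate hC
  have hmem : a * b ∈ pairProducts Bs := mem_map_of_mem (fun p : G × G => p.1 * p.2) h
  have : a * b = u ∨ a * b = v := by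
    rw [huv, mem_add, mem_replicate, mem_replicate] at hmem
    exact hmem.imp And.right And.right
  rcases this with h | h
  · exact ⟨v, hv, by rw [h, huv], by rw [h, ho]⟩
  · exact ⟨u, hu, by rw [h, huv, add_comm], by rw [h, orderOf_mul_inv_comm, ho]⟩

theorem Pairing.exists_mem_of_replicate (hC : FreeConfig φ κ m S) {u v : G}
    (h : pairProducts Bs = replicate (m - 1) u + replicate (m - 1) v) :
    (∃ p ∈ Bs, p.1 * p.2 = u) ∧ ∃ p ∈ Bs, p.1 * p.2 = v := by
  have hm := hC.four_le
  constructor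
  · refine mem_map.1 (show u ∈ pairProducts Bs from ?_)
    rw [h, mem_add, mem_replicate]
    exact Or.inl ⟨by omega, rfl⟩
  · refine mem_map.1 (show v ∈ pairProducts Bs from ?_)
    rw [h, mem_add, mem_replicate, mem_replicate]
    exact Or.inr ⟨by omega, rfl⟩

theorem Pairing.le_of_mem (hP : Pairing φ S Bs L) {a b : G} (h : (a, b) ∈ Bs) :
    a ::ₘ b ::ₘ 0 ≤ S := by
  obtain ⟨Rs, rfl⟩ := exists_cons_of_mem h
  rw [hP.eq, terms_cons, cons_add, cons_add, cons_le_cons_iff, cons_le_cons_iff]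
  exact Multiset.zero_le _

theorem mem_terms {G : Type*} {Bs : Multiset (G × G)} {x : G} : x ∈ terms Bs ↔ ∃ p ∈ Bs, x = p.1 ∨ x = p.2 := by
  simp only [terms, mem_add, mem_map]
  constructor
  · rintro (⟨p, hp, rfl⟩ | ⟨p, hp, rfl⟩)
    · exact ⟨p, hp, Or.inl rfl⟩
    · exact ⟨p, hp, Or.inr rfl⟩
  · rintro ⟨p, hp, rfl | rfl⟩
    · exact Or.inl ⟨p, hp, rfl⟩
    · exact Or.inr ⟨p, hp, rfl⟩

theorem commute_zpowers_of_commute (hκ : orderOf κ = m) (hm : 0 < m) {u v c : G}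
    (hu : u ∈ Subgroup.zpowers κ) (hv : v ∈ Subgroup.zpowers κ) (ho : orderOf (u * v⁻¹) = m)
    (huc : Commute u c) (hvc : Commute v c) : ∀ w ∈ Subgroup.zpowers κ, Commute w c := by
  intro w hw
  rw [← zpowers_eq_of_orderOf_eq hκ hm (Subgroup.mul_mem _ hu (Subgroup.inv_mem _ hv)) ho] at hw
  obtain ⟨i, rfl⟩ := Subgroup.mem_zpowers_iff.1 hw
  exact (huc.mul_left hvc.inv_left).zpow_left i

/-- Two pairs of terms of different products: swapping in the interior of the first pair does not
change the product. -/
theorem Pairing.prod_eq_of_coe_eq (hC : FreeConfig φ κ m S) (hP : Pairing φ S Bs L)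
    {a b c d v : G} (h1 : (c, d) ∈ Bs) (h2 : (a, b) ∈ Bs) (hv : a * b = v)
    (hBs : pairProducts Bs = replicate (m - 1) (c * d) + replicate (m - 1) v)
    (ho : orderOf (c * d * v⁻¹) = m) (hvκ : v ∈ Subgroup.zpowers κ) {E : List G}
    (hE : (E : Multiset G) = c ::ₘ d ::ₘ a ::ₘ b ::ₘ 0) : E.prod = c * d * v := by
  classical
  have hm := hC.four_le
  have hcd : c * d ∈ Subgroup.zpowers κ :=
    hP.pairProducts_mem hC _ (mem_map_of_mem (fun p : G × G => p.1 * p.2) h1)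
  have hne := ne_of_orderOf_mul_inv hm ho
  obtain ⟨Rs, rfl⟩ := exists_cons_of_mem h1
  have h2' : (a, b) ∈ Rs := by
    rcases mem_cons.1 h2 with h | h
    · rw [Prod.mk.injEq] at h
      exact absurd (by rw [← hv, h.1, h.2]) hne
    · exact h
  obtain ⟨Rs, rfl⟩ := exists_cons_of_mem h2'
  refine hC.prod_eq_mul (Rs := Rs) hcd hvκ ho ?_ ?_ ?_ (le_of_eq ?_)
  · rw [hE, hP.eq, terms_cons, terms_cons]
    simp only [cons_add, zero_add, cons_le_cons_iff]
    exact Multiset.le_add_right _ _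
  · rw [← coe_card, hE]
    rfl
  · rw [← hC.ker_eq, MonoidHom.mem_ker, map_list_prod]
    have : ((E : Multiset G).map φ).prod = 1 := by
      rw [hE]
      have e1 := hP.map_eq (c, d) (mem_cons_self _ _)
      have e2 := hP.map_eq (a, b) h2
      simp only at e1 e2
      simp only [map_cons, prod_cons, Multiset.map_zero, prod_zero, mul_one, e1, e2]
      rw [Klein.mul_self, mul_one, Klein.mul_self]
    simpa using this
  · rw [pairProducts_cons, pairProducts_cons, show m - 1 = m - 2 + 1 by omega, replicate_succ,
      replicate_succ] at hBs
    simp only [hv, cons_add, add_cons] at hBs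
    rw [cons_swap, cons_inj_right, cons_inj_right] at hBs
    exact hBs.symm

/-- If at least two terms lie outside the abelian subgroup of index two, then `κ` is central. -/
theorem FreeConfig.commute_of_two_le (hC : FreeConfig φ κ m S)
    (hH : ∀ a b : G, (φ a).toAdd.1 = 0 → (φ b).toAdd.1 = 0 → Commute a b)
    (hK : ∀ v ∈ Subgroup.zpowers κ, ∀ g h : G, (φ g).toAdd.1 = 1 → (φ h).toAdd.1 = 1 →
      Commute v g → Commute v h)
    {c d : G} (hcd : c ::ₘ d ::ₘ 0 ≤ S) (hc : (φ c).toAdd.1 = 1) (hd : (φ d).toAdd.1 = 1) :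
    ∀ v ∈ Subgroup.zpowers κ, ∀ g, Commute v g := by
  have hm := hC.four_le
  have h01 : ∀ g : G, (φ g).toAdd.1 = 0 ∨ (φ g).toAdd.1 = 1 := fun g => by
    generalize (φ g).toAdd.1 = z
    revert z
    decide
  have hκ0 : ∀ v ∈ Subgroup.zpowers κ, (φ v).toAdd.1 = 0 := by
    intro v hv
    rw [← hC.ker_eq, MonoidHom.mem_ker] at hv
    rw [hv]
    rfl
  -- One element outside the subgroup that centralizes ⟨κ⟩ is enough: `hH` covers the elements
  -- inside and `hK` transfers to the others outside.
  suffices h : ∃ c : G, (φ c).toAdd.1 = 1 ∧ ∀ v ∈ Subgroup.zpowers κ, Commute v c by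
    obtain ⟨c, hc, h⟩ := h
    intro v hv g
    rcases h01 g with hg | hg
    · exact hH v g (hκ0 v hv) hg
    · exact hK v hv c g hc hg (h v hv)
  by_cases hpair : ∃ c d : G, c ::ₘ d ::ₘ 0 ≤ S ∧ (φ c).toAdd.1 = 1 ∧ φ c = φ d
  · obtain ⟨c, d, hcd, hc, hφ⟩ := hpair
    obtain ⟨Bs, L, hmem, hP⟩ := exists_pairing_of_mem hφ hcd
    obtain ⟨v, hv, huv, ho⟩ := hP.exists_eq_replicate_of_mem hC hmem
    have hcdK : c * d ∈ Subgroup.zpowers κ :=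
      hP.pairProducts_mem hC _ (mem_map_of_mem (fun p : G × G => p.1 * p.2) hmem)
    have hcomm : Commute c d := hP.commute hC hmem
    obtain ⟨⟨a, b⟩, hab, hv'⟩ := (Pairing.exists_mem_of_replicate hC huv).2
    simp only at hv'
    refine ⟨c, hc, commute_zpowers_of_commute hC.orderOf_eq (by omega) hcdK hv ho
      ((Commute.refl c).mul_left hcomm.symm) ?_⟩
    -- It remains to see that v = a b commutes with an outside element. If a is inside, the orders
    -- c, a, b, d and c, d, a, b have equal products, so v commutes with d. If a is outside, then a
    -- commutes with b, hence with v.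
    rcases h01 a with ha | ha
    · have h1 : [c, a, b, d].prod = c * d * v :=
        hP.prod_eq_of_coe_eq hC hmem hab hv' huv ho hv (by
          change c ::ₘ a ::ₘ b ::ₘ d ::ₘ 0 = _
          rw [cons_swap b d, cons_swap a d])
      have h2 : Commute v d := by
        simp only [List.prod_cons, List.prod_nil, mul_one] at h1
        rw [← mul_assoc a, hv', mul_assoc] at h1
        exact mul_left_cancel h1
      exact hK v hv d c (by rw [← hφ, hc]) hc h2
    · have hcab : Commute a b := hP.commute hC hab
      have : Commute v a := by
        rw [← hv']
        exact (Commute.refl a).mul_left hcab.symm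
      exact hK v hv a c ha hc this
  -- Now no two outside terms share a class, so all pairs lie inside, and c, d are leftover terms
  -- together with an inside term e.
  · push Not at hpair
    obtain ⟨Bs, L, hP⟩ := exists_pairing φ S
    have hBs0 : ∀ p ∈ Bs, (φ p.1).toAdd.1 = 0 := by
      intro p hp
      rcases h01 p.1 with h | h
      · exact h
      · exact absurd (hP.map_eq p hp) (hpair _ _ (hP.le_of_mem hp) h)
    have hmemL : ∀ x ∈ S, (φ x).toAdd.1 = 1 → x ∈ L := by
      intro x hx h
      rw [hP.eq, mem_add, mem_terms] at hx
      rcases hx with ⟨p, hp, rfl | rfl⟩ | hx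
      · rw [hBs0 p hp] at h; exact absurd h (by decide)
      · rw [← hP.map_eq p hp, hBs0 p hp] at h; exact absurd h (by decide)
      · exact hx
    have hcL := hmemL c (mem_of_le hcd (by simp)) hc
    have hdL := hmemL d (mem_of_le hcd (by simp)) hd
    have hne : d ≠ c := by
      rintro rfl
      exact hpair d d hcd hc rfl
    obtain ⟨L', rfl⟩ := exists_cons_of_mem hcL
    obtain ⟨L', rfl⟩ := exists_cons_of_mem ((mem_cons.1 hdL).resolve_left hne)
    obtain ⟨e, rfl⟩ := card_eq_one.1 (show L'.card = 1 by
      have := (hP.card_eq hC).1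
      rw [card_cons, card_cons] at this
      omega)
    have he : (φ e).toAdd.1 = 0 := by
      have hnd := hP.nodup
      have key : ∀ x y z : Klein, [x, y, z].Nodup → x.toAdd.1 = 1 → y.toAdd.1 = 1 →
          z.toAdd.1 = 0 := by decide
      exact key (φ c) (φ d) (φ e) (by simpa using hnd) hc hd
    obtain ⟨u, hu, v, hv, huv, ho⟩ := hP.exists_eq_replicate hC
    obtain ⟨⟨p, hp, hpu⟩, ⟨q, hq, hqv⟩⟩ := Pairing.exists_mem_of_replicate hC huv
    -- If all pairs were in the class of e, their terms would all equal e and there would be only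
    -- one pair product.
    have hex : ∃ r ∈ Bs, φ r.1 ≠ φ e := by
      by_contra! hall
      have hee : ∀ r ∈ Bs, r.1 * r.2 = e * e := by
        rintro ⟨r, r'⟩ hr
        rw [← hP.eq_fst hC hr (by simp) (hall _ hr).symm,
          ← hP.eq_snd hC hr (by simp) (hall _ hr).symm]
      exact ne_of_orderOf_mul_inv hm ho (by rw [← hpu, ← hqv, hee p hp, hee q hq])
    -- A pair in the other inside class fills the fourth class, so r, c, d, e may be reordered
    -- freely without changing their product.
    have hfour : ∀ {Bs : Multiset (G × G)}, Pairing φ S Bs (c ::ₘ d ::ₘ {e}) → ∀ r ∈ Bs,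
        (φ r.1).toAdd.1 = 0 → φ r.1 ≠ φ e → Commute d e ∧ Commute d r.1 := by
      rintro Bs hP ⟨r, r'⟩ hr hr0 hre
      have hrL : φ r ∉ (c ::ₘ d ::ₘ {e}).map φ := by
        intro h
        simp only [map_cons, map_singleton, mem_cons, mem_singleton] at h
        rcases h with h | h | h
        · rw [← h, hr0] at hc; exact absurd hc (by decide)
        · rw [← h, hr0] at hd; exact absurd hd (by decide)
        · exact hre h
      have hp : ∀ {E E' : List G}, (E : Multiset G) = r ::ₘ c ::ₘ d ::ₘ {e} →
          (E' : Multiset G) = r ::ₘ c ::ₘ d ::ₘ {e} → E.prod = E'.prod :=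
        fun h h' => hP.prod_eq_prod hC hr hrL h h'
      constructor
      · have := hp (E := [r, c, d, e]) (E' := [r, c, e, d]) rfl (by
          change r ::ₘ c ::ₘ e ::ₘ {d} = _
          congr 2
          exact pair_comm e d)
        simpa [Commute, SemiconjBy] using this
      · have := hp (E := [c, d, r, e]) (E' := [c, r, d, e])
          (by
            change c ::ₘ d ::ₘ r ::ₘ {e} = _
            rw [cons_swap d r, cons_swap c r])
          (by
            change c ::ₘ r ::ₘ d ::ₘ {e} = _
            rw [cons_swap c r])
        simp only [List.prod_cons, List.prod_nil, mul_one] at this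
        have h2 := mul_left_cancel this
        rw [← mul_assoc, ← mul_assoc] at h2
        exact mul_right_cancel h2
    have hde : Commute d e := by
      obtain ⟨r, hr, hre⟩ := hex
      exact (hfour hP r hr (hBs0 r hr) hre).1
    have hall : ∀ r ∈ Bs, Commute (r.1 * r.2) d := by
      rintro ⟨r, r'⟩ hr
      by_cases hre : φ r = φ e
      · rw [← hP.eq_fst hC hr (e := e) (by simp) hre.symm,
          ← hP.eq_snd hC hr (e := e) (by simp) hre.symm]
        exact (hde.mul_right hde).symm
      · obtain ⟨Rs, rfl⟩ := exists_cons_of_mem hr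
        have h0 := hBs0 _ hr
        have h1 := hP.map_eq _ hr
        simp only at h0 h1
        refine Commute.mul_left (hfour hP _ hr h0 hre).2.symm ?_
        refine (hfour hP.swap _ (mem_cons_self _ _) ?_ ?_).2.symm
        · simpa [← h1] using h0
        · simpa [← h1] using hre
    exact ⟨d, hd, commute_zpowers_of_commute hC.orderOf_eq (by omega) hu hv ho
      (hpu ▸ hall p hp) (hqv ▸ hall q hq)⟩

end FreeConfig

/-! ### The structure of free sequences when the kernel is central. -/

section CentralCase

open Multiset

variable {G : Type*} [Group G] {φ : G →* Klein} {κ : G} {m : ℕ} {S : Multiset G}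
  {Bs : Multiset (G × G)} {L : Multiset G}

theorem sq_mem_of_ker_eq (hker : φ.ker = Subgroup.zpowers κ) (g : G) :
    g * g ∈ Subgroup.zpowers κ := by
  rw [← hker, MonoidHom.mem_ker, map_mul, Klein.mul_self]

/-- In a central extension of the Klein four-group, commutators are involutions. -/
theorem exists_mul_eq_mul_mul (hker : φ.ker = Subgroup.zpowers κ)
    (hcent : ∀ v ∈ Subgroup.zpowers κ, ∀ g, Commute v g) (g h : G) :
    ∃ z ∈ Subgroup.zpowers κ, g * h = h * g * z ∧ z * z = 1 := by
  refine ⟨(h * g)⁻¹ * (g * h), ?_, by group, ?_⟩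
  · rw [← hker, MonoidHom.mem_ker, map_mul, map_inv, map_mul, map_mul, mul_comm (φ h),
      inv_mul_cancel]
  · set z := (h * g)⁻¹ * (g * h) with hz
    have hzK : z ∈ Subgroup.zpowers κ := by
      rw [← hker, MonoidHom.mem_ker, map_mul, map_inv, map_mul, map_mul, mul_comm (φ h),
        inv_mul_cancel]
    have h1 : g * h = h * g * z := by rw [hz]; group
    have hzc : ∀ w, z * w = w * z := fun w => (hcent z hzK w).eq
    -- As g² is central, moving h past both copies of g produces the factor z², which must be
    -- trivial.
    have h2 : g * g * h = h * (g * g) := (hcent _ (sq_mem_of_ker_eq hker g) h).eq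
    have h3 : g * g * h = h * (g * g) * (z * z) := by
      calc g * g * h = g * (g * h) := mul_assoc _ _ _
        _ = g * (h * g * z) := by rw [h1]
        _ = (g * h) * (g * z) := by group
        _ = (h * g * z) * (g * z) := by rw [h1]
        _ = h * g * (z * g) * z := by group
        _ = h * g * (g * z) * z := by rw [hzc]
        _ = h * (g * g) * (z * z) := by group
    rw [h2] at h3
    exact (mul_eq_left.1 h3.symm)

/-- Not both of two distinct nontrivial classes contain a pair of equal terms. -/
theorem Pairing.false_of_mem_of_mem (hC : FreeConfig φ κ m S) (hP : Pairing φ S Bs L)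
    (hcent : ∀ v ∈ Subgroup.zpowers κ, ∀ g, Commute v g) {g h : G} (hg : (g, g) ∈ Bs)
    (hh : (h, h) ∈ Bs) (hgh : ¬ Commute g h) : False := by
  classical
  have hm := hC.four_le
  obtain ⟨z, hzK, hz, hzz⟩ := exists_mul_eq_mul_mul hC.ker_eq hcent h g
  have hz1 : z ≠ 1 := by
    rintro rfl
    exact hgh (by simpa [Commute, SemiconjBy] using hz.symm)
  have hprod : [g, h, g, h].prod = g * g * (h * h) * z := by
    have hzc : ∀ w, z * w = w * z := fun w => (hcent z hzK w).eq
    calc [g, h, g, h].prod = g * (h * g) * h := by simp [mul_assoc]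
      _ = g * (g * h) * (z * h) := by rw [hz]; simp only [mul_assoc]
      _ = g * g * (h * h) * z := by rw [hzc]; simp only [mul_assoc]
  have hne : g ≠ h := by
    rintro rfl
    exact hgh (Commute.refl _)
  have hgK := sq_mem_of_ker_eq hC.ker_eq g
  have hhK := sq_mem_of_ker_eq hC.ker_eq h
  obtain ⟨v, hv, hBs, ho⟩ := hP.exists_eq_replicate_of_mem hC hg
  obtain ⟨Rs, rfl⟩ := exists_cons_of_mem hg
  have hh' : (h, h) ∈ Rs := by
    rcases mem_cons.1 hh with h1 | h1
    · rw [Prod.mk.injEq] at h1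
      exact absurd h1.1.symm hne
    · exact h1
  obtain ⟨Rs, rfl⟩ := exists_cons_of_mem hh'
  have hE : (([g, h, g, h] : List G) : Multiset G) + terms Rs ≤ S := by
    rw [hP.eq, terms_cons, terms_cons]
    change g ::ₘ h ::ₘ g ::ₘ h ::ₘ 0 + _ ≤ _
    simp only [cons_add, zero_add]
    rw [cons_swap h g, cons_le_cons_iff, cons_le_cons_iff, cons_le_cons_iff, cons_le_cons_iff]
    exact Multiset.le_add_right _ _
  have hEK : [g, h, g, h].prod ∈ Subgroup.zpowers κ := by
    rw [hprod]
    exact Subgroup.mul_mem _ (Subgroup.mul_mem _ hgK hhK) hzK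
  have huv := ne_of_orderOf_mul_inv hm ho
  rw [pairProducts_cons, pairProducts_cons] at hBs
  simp only at hBs
  have hhmem : h * h = g * g ∨ h * h = v := by
    have : h * h ∈ replicate (m - 1) (g * g) + replicate (m - 1) v := by
      rw [← hBs]; simp
    rw [mem_add, mem_replicate, mem_replicate] at this
    exact this.imp And.right And.right
  -- The product of g, h, g, h is g² h² z with z ≠ 1. If h² = v, it must equal g² v, so z = 1. If h²
  -- = g², it must be g² v or g⁴: the former makes g² v⁻¹ have order at most 2 < m, the latter gives
  -- z = 1.
  rcases hhmem with hhg | hhv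
  · have hR : replicate (m - 3) (g * g) + replicate (m - 2) v ≤ pairProducts Rs := by
      rw [hhg, show m - 1 = m - 3 + 1 + 1 by omega, replicate_succ, replicate_succ, cons_add,
        cons_add, cons_inj_right, cons_inj_right] at hBs
      rw [hBs]
      exact add_le_add_right ((replicate_le_replicate _).2 (by omega)) _
    rcases hC.prod_eq_mul_or_sq hgK hv ho hE rfl hEK hR with h1 | h1
    · rw [hprod, hhg, mul_assoc] at h1
      have h2 : g * g * z = v := mul_left_cancel h1
      have h3 : (g * g * v⁻¹) ^ 2 = 1 := by
        have : g * g * v⁻¹ = z⁻¹ := by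
          rw [← h2, mul_inv_rev, ← mul_assoc, (hcent _ hgK _).eq, mul_assoc, mul_inv_cancel,
            mul_one]
        rw [this, inv_pow, sq, hzz, inv_one]
      have := orderOf_le_of_pow_eq_one (by norm_num) h3
      omega
    · rw [hprod, hhg] at h1
      exact hz1 (mul_eq_left.1 h1)
  · have hR : replicate (m - 2) (g * g) + replicate (m - 2) v ≤ pairProducts Rs := by
      rw [hhv, show m - 1 = m - 2 + 1 by omega, replicate_succ, replicate_succ, cons_add,
        cons_inj_right, add_cons, cons_inj_right] at hBs
      exact hBs.ge
    have h1 := hC.prod_eq_mul hgK hv ho hE rfl hEK hR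
    rw [hprod, hhv] at h1
    exact hz1 (mul_eq_left.1 h1)

theorem terms_replicate {G : Type*} (k : ℕ) (a : G) :
    terms (replicate k (a, a)) = replicate (2 * k) a := by
  simp [terms, two_mul, replicate_add]

/-- The order of w is even, since otherwise w would be a power of w² and lie in the kernel; half of
it is then a multiple of m. -/
theorem orderOf_eq_two_mul_of_sq (hker : φ.ker = Subgroup.zpowers κ) {w : G}
    (hw : φ w ≠ 1) (h : orderOf (w * w) = m) : orderOf w = 2 * m := by
  have hdvd : orderOf w ∣ 2 * m := by
    rw [orderOf_dvd_iff_pow_eq_one, pow_mul, sq, ← h, pow_orderOf_eq_one]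
  have heven : Even (orderOf w) := by
    by_contra hodd
    rw [Nat.not_even_iff_odd] at hodd
    obtain ⟨k, hk⟩ := hodd
    apply hw
    rw [← MonoidHom.mem_ker, hker]
    have : w = (w * w) ^ (k + 1) := by
      rw [← sq, ← pow_mul, show 2 * (k + 1) = orderOf w + 1 by omega, pow_succ,
        pow_orderOf_eq_one, one_mul]
    rw [this]
    exact Subgroup.pow_mem _ (sq_mem_of_ker_eq hker w) _
  obtain ⟨k, hk⟩ := heven
  have hmk : m ∣ k := by
    rw [← h, orderOf_dvd_iff_pow_eq_one, ← sq, ← pow_mul, two_mul, ← hk, pow_orderOf_eq_one]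
  apply Nat.dvd_antisymm hdvd
  rw [hk, ← two_mul]
  exact Nat.mul_dvd_mul_left 2 hmk

/-- The structure of a free sequence when `κ` is central. -/
theorem FreeConfig.exists_eq_of_central (hC : FreeConfig φ κ m S)
    (hcent : ∀ v ∈ Subgroup.zpowers κ, ∀ g, Commute v g)
    (hnc : ∀ g h : G, φ g ≠ 1 → φ h ≠ 1 → φ g ≠ φ h → ¬ Commute g h) :
    ∃ a b c, S = replicate (2 * m - 1) a + replicate (2 * m - 1) b + {c} ∧ φ a = 1 ∧ φ b ≠ 1 ∧
      φ c ≠ 1 ∧ φ c ≠ φ b ∧ orderOf (b * a⁻¹) = 2 * m := by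
  classical
  have hm := hC.four_le
  obtain ⟨Bs, L, hP⟩ := exists_pairing φ S
  -- the fourth class is empty
  have hfour : ∀ p ∈ Bs, φ p.1 ∈ L.map φ := by
    rintro ⟨q, r⟩ hq
    by_contra hqL
    obtain ⟨x, y, z, rfl⟩ := card_eq_three.1 (hP.card_eq hC).1
    have hp : ∀ {E E' : List G}, (E : Multiset G) = q ::ₘ {x, y, z} →
        (E' : Multiset G) = q ::ₘ {x, y, z} → E.prod = E'.prod :=
      fun h h' => hP.prod_eq_prod hC hq hqL h h'
    -- A pair in the fourth class would make the three leftover terms commute pairwise, but two of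
    -- them lie in distinct nontrivial classes.
    have e1 : Commute x y := by
      have := hp (E := [q, x, y, z]) (E' := [q, y, x, z]) rfl
        (congrArg (q ::ₘ ·) (cons_swap y x {z}))
      simp only [List.prod_cons, List.prod_nil, mul_one] at this
      have h2 := mul_left_cancel this
      rw [← mul_assoc, ← mul_assoc] at h2
      exact mul_right_cancel h2
    have e2 : Commute y z := by
      have := hp (E := [q, x, y, z]) (E' := [q, x, z, y]) rfl
        (congrArg (fun T => q ::ₘ x ::ₘ T) (pair_comm z y))
      simp only [List.prod_cons, List.prod_nil, mul_one] at this
      exact mul_left_cancel (mul_left_cancel this)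
    have e3 : Commute x z := by
      have := hp (E := [q, y, x, z]) (E' := [q, y, z, x])
        (congrArg (q ::ₘ ·) (cons_swap y x {z}))
        (congrArg (q ::ₘ ·)
          ((congrArg (y ::ₘ ·) (pair_comm z x)).trans (cons_swap y x {z})))
      simp only [List.prod_cons, List.prod_nil, mul_one] at this
      exact mul_left_cancel (mul_left_cancel this)
    have hnd := hP.nodup
    simp only [insert_eq_cons, map_cons, map_singleton, nodup_cons, mem_cons, mem_singleton,
      nodup_singleton, and_true, not_or] at hnd
    by_cases h1 : φ x = 1
    · exact hnc y z (fun h => hnd.1.1 (h1.trans h.symm)) (fun h => hnd.1.2 (h1.trans h.symm))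
        hnd.2 e2
    by_cases h2 : φ y = 1
    · exact hnc x z h1 (fun h => hnd.2 (h2.trans h.symm)) hnd.1.2 e3
    · exact hnc x y h1 h2 hnd.1.1 e1
  have hpair : ∀ p ∈ Bs, p.1 ∈ L ∧ p = (p.1, p.1) := by
    rintro ⟨q, r⟩ hq
    obtain ⟨e, he, heq⟩ := mem_map.1 (hfour _ hq)
    obtain rfl := hP.eq_fst hC hq he heq
    obtain rfl := hP.eq_snd hC hq he heq
    exact ⟨he, rfl⟩
  have hinj : ∀ a ∈ L, ∀ b ∈ L, a ≠ b → φ a ≠ φ b := fun a ha b hb hab h =>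
    hab (inj_on_of_nodup_map hP.nodup a ha b hb h)
  suffices main : ∀ a b : G, (a, a) ∈ Bs → (b, b) ∈ Bs → φ a = 1 →
      pairProducts Bs = replicate (m - 1) (a * a) + replicate (m - 1) (b * b) →
      orderOf (b * b * (a * a)⁻¹) = m →
      ∃ a b c, S = replicate (2 * m - 1) a + replicate (2 * m - 1) b + {c} ∧ φ a = 1 ∧ φ b ≠ 1 ∧
        φ c ≠ 1 ∧ φ c ≠ φ b ∧ orderOf (b * a⁻¹) = 2 * m by
    obtain ⟨u, hu, v, hv, huv, ho⟩ := hP.exists_eq_replicate hC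
    obtain ⟨⟨p, hp, rfl⟩, ⟨q, hq, rfl⟩⟩ := Pairing.exists_mem_of_replicate hC huv
    obtain ⟨hpL, hpp⟩ := hpair p hp
    obtain ⟨hqL, hqq⟩ := hpair q hq
    have hp2 : p.2 = p.1 := congrArg Prod.snd hpp
    have hq2 : q.2 = q.1 := congrArg Prod.snd hqq
    rw [hp2, hq2] at huv ho
    rw [hpp] at hp
    rw [hqq] at hq
    have hne : p.1 ≠ q.1 := fun h => ne_of_orderOf_mul_inv hm ho (by rw [h])
    by_cases h1 : φ p.1 = 1
    · exact main p.1 q.1 hp hq h1 huv (by rw [orderOf_mul_inv_comm, ho])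
    by_cases h2 : φ q.1 = 1
    · exact main q.1 p.1 hq hp h2 (by rw [huv, add_comm]) ho
    · exact (hP.false_of_mem_of_mem hC hcent hp hq
        (hnc _ _ h1 h2 (hinj _ hpL _ hqL hne))).elim
  intro a b ha hb ha1 hprod ho
  have haL := (hpair _ ha).1
  have hbL := (hpair _ hb).1
  simp only at haL hbL
  have hsq : b * b ≠ a * a := ne_of_orderOf_mul_inv hm ho
  have hab : b ≠ a := fun h => hsq (by rw [h])
  have hb1 : φ b ≠ 1 := by
    rw [← ha1]
    exact hinj b hbL a haL hab
  obtain ⟨L', rfl⟩ := exists_cons_of_mem haL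
  obtain ⟨L', rfl⟩ := exists_cons_of_mem ((mem_cons.1 hbL).resolve_left hab)
  obtain ⟨c, rfl⟩ := card_eq_one.1 (show L'.card = 1 by
    have := (hP.card_eq hC).1
    rw [card_cons, card_cons] at this
    omega)
  have hnd := hP.nodup
  simp only [map_cons, map_singleton, nodup_cons, mem_cons, mem_singleton,
    nodup_singleton, and_true, not_or] at hnd
  have hc1 : φ c ≠ 1 := fun h => hnd.1.2 (ha1.trans h.symm)
  have hcb : φ c ≠ φ b := fun h => hnd.2 h.symm
  have hBs : ∀ p ∈ Bs, p = (a, a) ∨ p = (b, b) := by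
    intro p hp
    obtain ⟨hpL, hpp⟩ := hpair p hp
    rw [hpp] at hp ⊢
    simp only [mem_cons, mem_singleton] at hpL
    rcases hpL with h | h | h
    · exact Or.inl (by rw [h])
    · exact Or.inr (by rw [h])
    · rw [h] at hp
      exact (hP.false_of_mem_of_mem hC hcent hb hp (hnc _ _ hb1 hc1 hcb.symm)).elim
  -- The squares of a and b differ, so a pair is recovered from its product and the multiplicities m
  -- - 1 carry over to the pairs.
  have hBs' : Bs = replicate (m - 1) (a, a) + replicate (m - 1) (b, b) := by
    let f : G → G × G := fun x => if x = a * a then (a, a) else (b, b)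
    have h1 : (pairProducts Bs).map f = Bs := by
      rw [pairProducts, map_map]
      conv_rhs => rw [← map_id Bs]
      refine map_congr rfl fun p hp => ?_
      rcases hBs p hp with rfl | rfl
      · simp [f]
      · simp [f, hsq]
    rw [← h1, hprod]
    simp [f, hsq]
  refine ⟨a, b, c, ?_, ha1, hb1, hc1, hcb, ?_⟩
  · rw [hP.eq, hBs', terms_add, terms_replicate, terms_replicate,
      show 2 * m - 1 = 2 * (m - 1) + 1 by omega, replicate_succ, replicate_succ,
      ← singleton_add a, ← singleton_add b, ← singleton_add a, ← singleton_add b]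
    abel
  · refine orderOf_eq_two_mul_of_sq hC.ker_eq ?_ ?_
    · rwa [map_mul, map_inv, ha1, inv_one, mul_one]
    · have haK : a ∈ Subgroup.zpowers κ := by rw [← hC.ker_eq, MonoidHom.mem_ker, ha1]
      have hc : Commute a⁻¹ b := hcent _ (Subgroup.inv_mem _ haK) b
      rw [show b * a⁻¹ * (b * a⁻¹) = b * (a⁻¹ * b) * a⁻¹ by group, hc.eq]
      rw [show b * (b * a⁻¹) * a⁻¹ = b * b * (a * a)⁻¹ by group, ho]

end CentralCase

/-! ### Part (a): the Klein quotient, defining pairs and the classification. -/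

section Main

open Multiset

variable {G : Type*} [Group G] {n : ℕ} {s : ℤ} {x y : G} {S : Multiset G}

/-- The projection of the group onto the Klein four-group. -/
theorem IsPresentedBy.exists_klein_hom (h4 : 4 ∣ n) (hs : s ^ 2 ≡ 1 [ZMOD n])
    (h : IsPresentedBy n s x y) : ∃ φ : G →* Klein,
      φ x = Multiplicative.ofAdd (1, 0) ∧ φ y = Multiplicative.ofAdd (0, 1) ∧
      φ.ker = Subgroup.zpowers (y ^ 2) ∧
      ∀ g, (φ g).toAdd.1 = 0 ↔ g ∈ Subgroup.zpowers y := by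
  have hodd := odd_of_sq_modEq_one (dvd_trans (by norm_num) h4) hs
  have hsq : (Multiplicative.ofAdd (0, 1) : Klein) ^ 2 = 1 := rfl
  obtain ⟨φ, hx, hy⟩ := h.exists_hom (a := (Multiplicative.ofAdd (1, 0) : Klein))
    (b := (Multiplicative.ofAdd (0, 1) : Klein))
    (by
      obtain ⟨k, rfl⟩ := h4
      rw [show 4 * k / 2 = 2 * k by omega, pow_mul, hsq, one_pow]
      rfl)
    (by
      obtain ⟨k, rfl⟩ := h4
      rw [show 4 * k = 2 * (2 * k) by ring, pow_mul, hsq, one_pow])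
    (by
      obtain ⟨j, rfl⟩ := hodd
      rw [zpow_add, zpow_mul, zpow_ofNat, hsq, one_zpow, one_mul, zpow_one, mul_comm])
  have hyi : ∀ i : ℤ, φ (y ^ i) = Multiplicative.ofAdd (0, (i : ZMod 2)) := by
    intro i
    rw [map_zpow, hy, ← ofAdd_zsmul]
    simp
  have hxyi : ∀ i : ℤ, φ (x * y ^ i) = Multiplicative.ofAdd (1, (i : ZMod 2)) := by
    intro i
    rw [map_mul, hyi, hx, ← ofAdd_add]
    simp
  have hfst : ∀ g, (φ g).toAdd.1 = 0 ↔ g ∈ Subgroup.zpowers y := by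
    intro g
    constructor
    · intro hg
      rcases h.exists_eq hs g with ⟨i, rfl⟩ | ⟨i, rfl⟩
      · exact Subgroup.zpow_mem_zpowers _ _
      · rw [hxyi] at hg
        exact absurd hg (by simp)
    · intro hg
      obtain ⟨i, rfl⟩ := Subgroup.mem_zpowers_iff.1 hg
      rw [hyi]
      rfl
  refine ⟨φ, hx, hy, ?_, hfst⟩
  ext g
  rw [MonoidHom.mem_ker]
  constructor
  · intro hg
    obtain ⟨i, rfl⟩ := Subgroup.mem_zpowers_iff.1 ((hfst g).1 (by rw [hg]; rfl))
    rw [hyi] at hg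
    have h1 : ((i : ℤ) : ZMod 2) = 0 := congrArg (fun z : Klein => z.toAdd.2) hg
    rw [ZMod.intCast_zmod_eq_zero_iff_dvd] at h1
    obtain ⟨j, rfl⟩ := h1
    exact Subgroup.mem_zpowers_iff.2 ⟨j, by rw [← zpow_natCast, ← zpow_mul]⟩
  · intro hg
    obtain ⟨i, rfl⟩ := Subgroup.mem_zpowers_iff.1 hg
    rw [map_zpow, map_pow, hy, hsq, one_zpow]

theorem dvd_of_zpow_eq_one {β : G} (hβ : orderOf β = n) {i : ℤ} (h : β ^ i = 1) : (n : ℤ) ∣ i := by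
  rw [← hβ]
  exact orderOf_dvd_iff_zpow_eq_one.2 h

/-- The unique involution of a cyclic group of order `2 m`. -/
theorem zpow_eq_pow_half {β : G} {m : ℕ} (hβ : orderOf β = 2 * m) {i : ℤ}
    (h2 : β ^ i * β ^ i = 1) (h1 : β ^ i ≠ 1) : β ^ i = β ^ m := by
  rw [← zpow_add] at h2
  obtain ⟨k, hk⟩ := dvd_of_zpow_eq_one hβ h2
  push_cast at hk
  have hi : i = m * k := by linarith
  have hpow : (β ^ (2 * m : ℤ)) = 1 := by
    have := pow_orderOf_eq_one β
    rw [hβ] at this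
    exact_mod_cast this
  rcases Int.even_or_odd' k with ⟨j, rfl | rfl⟩
  · refine absurd ?_ h1
    rw [hi, show (m : ℤ) * (2 * j) = 2 * m * j by ring, zpow_mul, hpow, one_zpow]
  · rw [hi, show (m : ℤ) * (2 * j + 1) = 2 * m * j + m by ring, zpow_add, zpow_mul, hpow, one_zpow,
      one_mul, zpow_natCast]

theorem gcd_eq_one_of_orderOf {β : G} (hn : 0 < n) (hβ : orderOf β = n) {t₁ t₂ : ℤ}
    (h : orderOf (β ^ t₁ * (β ^ t₂)⁻¹) = n) : Int.gcd (t₁ - t₂) n = 1 := by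
  rw [← zpow_neg, ← zpow_add, ← sub_eq_add_neg] at h
  have hmem := zpowers_eq_of_orderOf_eq hβ hn (Subgroup.zpow_mem_zpowers β (t₁ - t₂)) h
  have hβm : β ∈ Subgroup.zpowers (β ^ (t₁ - t₂)) := hmem ▸ Subgroup.mem_zpowers β
  obtain ⟨j, hj⟩ := Subgroup.mem_zpowers_iff.1 hβm
  rw [← zpow_mul] at hj
  have h1 : β ^ ((t₁ - t₂) * j - 1) = 1 := by rw [zpow_sub, hj, zpow_one, mul_inv_cancel]
  obtain ⟨k, hk⟩ := dvd_of_zpow_eq_one hβ h1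
  rw [← Int.isCoprime_iff_gcd_eq_one]
  exact ⟨j, -k, by linarith⟩

theorem Klein.eq_or_eq_of_ne : ∀ a b w : Klein, a ≠ 1 → b ≠ 1 → a ≠ b →
    w = 1 ∨ w = a ∨ w = b ∨ w = a * b := by
  decide

/-- In a noncommutative central extension of the Klein four-group, elements in different
nontrivial classes do not commute. -/
theorem not_commute_of_ne {φ : G →* Klein} {κ : G} (hker : φ.ker = Subgroup.zpowers κ)
    (hcent : ∀ v ∈ Subgroup.zpowers κ, ∀ g, Commute v g) (hxy : ¬ Commute x y) {g h : G}
    (hg : φ g ≠ 1) (hh : φ h ≠ 1) (hgh : φ g ≠ φ h) : ¬ Commute g h := by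
  intro hc
  have key : ∀ w, ∃ v ∈ Subgroup.zpowers κ, ∃ a, w = a * v ∧ (a = 1 ∨ a = g ∨ a = h ∨ a = g * h) := by
    intro w
    have hw : ∀ a, φ w = φ a → ∃ v ∈ Subgroup.zpowers κ, w = a * v := by
      intro a ha
      refine ⟨a⁻¹ * w, ?_, by group⟩
      rw [← hker, MonoidHom.mem_ker, map_mul, map_inv, ha, inv_mul_cancel]
    rcases Klein.eq_or_eq_of_ne _ _ (φ w) hg hh hgh with h1 | h1 | h1 | h1
    · obtain ⟨v, hv, h2⟩ := hw 1 (by rw [h1, map_one])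
      exact ⟨v, hv, 1, h2, Or.inl rfl⟩
    · obtain ⟨v, hv, h2⟩ := hw g h1
      exact ⟨v, hv, g, h2, by simp⟩
    · obtain ⟨v, hv, h2⟩ := hw h h1
      exact ⟨v, hv, h, h2, by simp⟩
    · obtain ⟨v, hv, h2⟩ := hw (g * h) (by rw [h1, map_mul])
      exact ⟨v, hv, g * h, h2, by simp⟩
  obtain ⟨v, hv, a, rfl, ha⟩ := key x
  obtain ⟨w, hw, b, rfl, hb⟩ := key y
  -- G is generated by g, h and the central subgroup ⟨κ⟩, so commuting g and h would make G
  -- commutative.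
  refine hxy ?_
  have hab : Commute a b := by
    have hgg := Commute.refl g
    have hhh := Commute.refl h
    rcases ha with rfl | rfl | rfl | rfl <;> rcases hb with rfl | rfl | rfl | rfl <;>
      first
      | exact Commute.one_left _
      | exact Commute.one_right _
      | exact Commute.refl _
      | exact hc
      | exact hc.symm
      | exact (Commute.refl _).mul_right hc
      | exact hc.symm.mul_right (Commute.refl _)
      | exact ((Commute.refl _).mul_right hc).symm
      | exact (hc.symm.mul_right (Commute.refl _)).symm
  exact Commute.mul_left (hab.mul_right (hcent w hw a).symm)
    ((hcent v hv b).mul_right (hcent v hv w))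

/-- A defining pair and the free sequence of length `2 n - 1` over it, when `y ^ 2` is central. -/
theorem exists_pair_of_central (hn : 8 ≤ n) (h4 : 4 ∣ n) (hs : s ^ 2 ≡ 1 [ZMOD n])
    (hs1 : ¬ s ≡ 1 [ZMOD n]) (h : IsPresentedBy n s x y) {φ : G →* Klein}
    (hφx : φ x = Multiplicative.ofAdd (1, 0)) (hφy : φ y = Multiplicative.ofAdd (0, 1))
    (hker : φ.ker = Subgroup.zpowers (y ^ 2))
    (hcent : ∀ v ∈ Subgroup.zpowers (y ^ 2), ∀ g, Commute v g) {β c : G}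
    (hβ : orderOf β = n) (hβ1 : φ β ≠ 1) (hc1 : φ c ≠ 1) (hcβ : φ c ≠ φ β) :
    ∃ α, IsPresentedBy n s α β ∧ ∃ t : ℤ, c = α * β ^ t := by
  obtain ⟨q, rfl⟩ := h4
  have h2 : 2 ∣ 4 * q := ⟨2 * q, by ring⟩
  obtain ⟨hy, hxy⟩ := h.orderOf_eq h2 hs
  obtain ⟨hx2, hyn, hyx⟩ := h.relations
  have hhalf : 4 * q / 2 = 2 * q := by omega
  rw [hhalf] at hx2
  have hβ' : orderOf β = 2 * (2 * q) := by rw [hβ]; ring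
  have hy' : orderOf y = 2 * (2 * q) := by rw [hy]; ring
  have hy2 : orderOf (y ^ 2) = 2 * q := by
    rw [orderOf_pow_of_dvd (by norm_num) (by rw [hy]; exact h2), hy, hhalf]
  have hβ2 : orderOf (β ^ 2) = 2 * q := by
    rw [orderOf_pow_of_dvd (by norm_num) (by rw [hβ]; exact h2), hβ, hhalf]
  have hβK : Subgroup.zpowers (β ^ 2) = Subgroup.zpowers (y ^ 2) :=
    zpowers_eq_of_orderOf_eq hy2 (by omega) (by rw [sq β]; exact sq_mem_of_ker_eq hker β) hβ2
  have hinv : ∀ z ∈ Subgroup.zpowers (y ^ 2), z * z = 1 → z ≠ 1 → z = β ^ (2 * q) := by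
    intro z hz hzz hz1
    rw [← hβK] at hz
    obtain ⟨j, rfl⟩ := Subgroup.mem_zpowers_iff.1 hz
    rw [← zpow_natCast, ← zpow_mul] at hzz hz1 ⊢
    exact zpow_eq_pow_half hβ' hzz hz1
  have hnxy : ¬ Commute x y := by
    intro hc
    rw [← hc.eq] at hyx
    have h1 := mul_left_cancel hyx
    have h3 : y ^ (1 - s) = 1 := by rw [zpow_sub, ← h1, zpow_one, mul_inv_cancel]
    exact hs1 (Int.modEq_iff_dvd.2 (dvd_of_zpow_eq_one hy h3))
  have hβ4 : β ^ (4 * q) = 1 := by rw [← hβ, pow_orderOf_eq_one]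
  -- Centrality of y² gives y^(2s) = y², so n divides 2(s - 1) but not s - 1, and β^(s-1) is the
  -- involution of ⟨β⟩.
  have hβs : β ^ (s - 1) = β ^ (2 * q) := by
    refine zpow_eq_pow_half hβ' ?_ ?_
    · have h1 := (hcent (y ^ 2) (Subgroup.mem_zpowers _) x).eq
      have h3 := zpow_mul_eq_mul_zpow hyx 2
      have h3' : y ^ 2 * x = x * y ^ (s * 2) := by exact_mod_cast h3
      rw [h1] at h3'
      have h5 := mul_left_cancel h3'
      have h6 : y ^ (s * 2 - 2) = 1 := by
        rw [zpow_sub, ← h5]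
        norm_cast
        rw [mul_inv_cancel]
      have h7 := dvd_of_zpow_eq_one hy h6
      rw [← zpow_add, ← orderOf_dvd_iff_zpow_eq_one, hβ]
      convert h7 using 1
      ring
    · intro h1
      exact hs1 (Int.modEq_iff_dvd.2 (dvd_sub_comm.1 (dvd_of_zpow_eq_one hβ h1)))
  -- Any α outside the classes 1 and φ β fails to commute with β; their commutator is the involution
  -- β^(n/2) = β^(s-1) of the kernel.
  have hrel : ∀ α, φ α ≠ 1 → φ α ≠ φ β → β * α = α * β ^ s := by
    intro α hα1 hαβ
    obtain ⟨z, hzK, hz, hzz⟩ := exists_mul_eq_mul_mul hker hcent β α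
    have hz1 : z ≠ 1 := by
      rintro rfl
      rw [mul_one] at hz
      exact not_commute_of_ne hker hcent hnxy hα1 hβ1 hαβ hz.symm
    rw [hz, hinv z hzK hzz hz1, ← hβs, mul_assoc]
    congr 1
    rw [← zpow_one_add, add_sub_cancel]
  have hym : y ^ (2 * q) = β ^ (2 * q) := by
    refine hinv _ (by rw [pow_mul]; exact Subgroup.npow_mem_zpowers _ _) ?_ ?_
    · rw [← pow_add, show 2 * q + 2 * q = 4 * q by ring, hyn]
    · exact pow_ne_one_of_lt_orderOf (by omega) (by omega)
  have hφβ : ∀ z ∈ Subgroup.zpowers β, φ z = 1 ∨ φ z = φ β := by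
    intro z hz
    obtain ⟨i, rfl⟩ := Subgroup.mem_zpowers_iff.1 hz
    have hsq : φ β ^ (2 : ℤ) = 1 := by
      rw [zpow_ofNat, sq, Klein.mul_self]
    rcases Int.even_or_odd' i with ⟨j, rfl | rfl⟩
    · left; rw [map_zpow, zpow_mul, hsq, one_zpow]
    · right; rw [map_zpow, zpow_add, zpow_mul, hsq, one_zpow, one_mul, zpow_one]
  have hx1 : φ x ≠ 1 := by rw [hφx]; decide
  -- Take α = x unless x lies in the class of β. In that case x = β^i with i ≡ q modulo 2q; for even
  -- q this would put x in the kernel, so q is odd, and α = y^q lies in the class of y with square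
  -- y^(n/2).
  obtain ⟨α, hα1, hαβ, hα2⟩ : ∃ α, φ α ≠ 1 ∧ φ α ≠ φ β ∧ α ^ 2 = β ^ (2 * q) := by
    by_cases hxβ : φ x = φ β
    · have hxmem : ∃ i : ℤ, x = β ^ i := by
        have : β⁻¹ * x ∈ Subgroup.zpowers (β ^ 2) := by
          rw [hβK, ← hker, MonoidHom.mem_ker, map_mul, map_inv, hxβ, inv_mul_cancel]
        obtain ⟨j, hj⟩ := Subgroup.mem_zpowers_iff.1 this
        refine ⟨1 + 2 * j, ?_⟩
        rw [zpow_add, zpow_mul, zpow_ofNat β 2, hj, zpow_one, mul_inv_cancel_left]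
      obtain ⟨i, hi⟩ := hxmem
      have hqodd : Odd q := by
        by_contra hev
        rw [Nat.not_odd_iff_even] at hev
        obtain ⟨r, hr⟩ := hev
        have h1 : β ^ (2 * i - 2 * q) = 1 := by
          rw [zpow_sub, mul_comm 2 i, zpow_mul, ← hi, zpow_ofNat, hx2, hym]
          norm_cast
          rw [mul_inv_cancel]
        obtain ⟨k, hk⟩ := dvd_of_zpow_eq_one hβ h1
        push_cast at hk
        have hi2 : i = 2 * (r + q * k) := by
          have : (q : ℤ) = r + r := by exact_mod_cast hr
          linarith
        apply hx1
        rw [hi, hi2, map_zpow, zpow_mul, zpow_ofNat, sq, Klein.mul_self, one_zpow]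
      have hφyq : φ (y ^ q) = φ y := by
        obtain ⟨r, rfl⟩ := hqodd
        rw [map_pow, pow_add, pow_mul, sq (φ y), Klein.mul_self, one_pow, one_mul, pow_one]
      refine ⟨y ^ q, ?_, ?_, ?_⟩
      · rw [hφyq, hφy]; decide
      · rw [hφyq, ← hxβ, hφx, hφy]; decide
      · rw [← pow_mul, mul_comm, hym]
    · exact ⟨x, hx1, hxβ, by rw [hx2, hym]⟩
  have hα : IsPresentedBy (4 * q) s α β :=
    h.of_relations h2 (by omega) hs (by rw [hhalf, hα2]) hβ (hrel α hα1 hαβ)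
      (fun hmem => (hφβ α hmem).elim hα1 hαβ)
  refine ⟨α, hα, ?_⟩
  rcases hα.exists_eq hs c with ⟨i, rfl⟩ | hc
  · exact ((hφβ _ (Subgroup.zpow_mem_zpowers _ _)).elim hc1 hcβ).elim
  · exact hc

/-- The structure of sequences of length `2 n - 1` without product-one subsequence of
length `n`. -/
theorem exists_eq_of_productOneFreeOfLength (hn : 8 ≤ n) (h4 : 4 ∣ n) (hs : s ^ 2 ≡ 1 [ZMOD n])
    (hs1 : ¬ s ≡ 1 [ZMOD n]) (h : IsPresentedBy n s x y) (hcard : S.card = 2 * n - 1)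
    (hfree : ProductOneFreeOfLength n S) :
    ∃ (α β : G) (t₁ t₂ t₃ : ℤ), IsPresentedBy n s α β ∧ Int.gcd (t₁ - t₂) n = 1 ∧
      S = replicate (n - 1) (β ^ t₁) + replicate (n - 1) (β ^ t₂) + {α * β ^ t₃} := by
  have h2 : 2 ∣ n := dvd_trans (by norm_num) h4
  obtain ⟨hy, hxy⟩ := h.orderOf_eq h2 hs
  obtain ⟨hx2, hyn, hyx⟩ := h.relations
  obtain ⟨φ, hφx, hφy, hker, hfst⟩ := h.exists_klein_hom h4 hs
  have h01 : ∀ g : G, (φ g).toAdd.1 = 0 ∨ (φ g).toAdd.1 = 1 := fun g => by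
    generalize (φ g).toAdd.1 = z
    revert z
    decide
  by_cases hcent : ∀ v ∈ Subgroup.zpowers (y ^ 2), ∀ g, Commute v g
  · obtain ⟨q, rfl⟩ := h4
    have hhalf : 4 * q / 2 = 2 * q := by omega
    have hC : FreeConfig φ (y ^ 2) (2 * q) S := by
      refine ⟨hker, ?_, by omega, by omega, ?_⟩
      · rw [orderOf_pow_of_dvd (by norm_num) (by rw [hy]; exact h2), hy, hhalf]
      · rwa [show 2 * (2 * q) = 4 * q by ring]
    have hnxy : ¬ Commute x y := by
      intro hc
      rw [← hc.eq] at hyx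
      have h1 := mul_left_cancel hyx
      have h3 : y ^ (1 - s) = 1 := by rw [zpow_sub, ← h1, zpow_one, mul_inv_cancel]
      exact hs1 (Int.modEq_iff_dvd.2 (dvd_of_zpow_eq_one hy h3))
    obtain ⟨a, b, c, hS, ha, hb, hc, hcb, ho⟩ := hC.exists_eq_of_central hcent
      fun g h hg hh hgh => not_commute_of_ne hker hcent hnxy hg hh hgh
    rw [show 2 * (2 * q) = 4 * q by ring] at hS ho
    have hφβ : φ (b * a⁻¹) = φ b := by rw [map_mul, map_inv, ha, inv_one, mul_one]
    obtain ⟨α, hα, t, ht⟩ := exists_pair_of_central hn ⟨q, rfl⟩ hs hs1 h hφx hφy hker hcent ho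
      (by rwa [hφβ]) hc (by rwa [hφβ])
    have hβ2 : orderOf ((b * a⁻¹) ^ 2) = 2 * q := by
      rw [orderOf_pow_of_dvd (by norm_num) (by rw [ho]; exact h2), ho, hhalf]
    have hβK : Subgroup.zpowers ((b * a⁻¹) ^ 2) = Subgroup.zpowers (y ^ 2) :=
      zpowers_eq_of_orderOf_eq hC.orderOf_eq (by omega)
        (by rw [sq (b * a⁻¹)]; exact sq_mem_of_ker_eq hker _) hβ2
    have haK : a ∈ Subgroup.zpowers ((b * a⁻¹) ^ 2) := by
      rw [hβK, ← hker, MonoidHom.mem_ker, ha]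
    obtain ⟨j, hj⟩ := Subgroup.mem_zpowers_iff.1 haK
    have hja : (b * a⁻¹) ^ (2 * j) = a := by rw [zpow_mul, zpow_ofNat _ 2, hj]
    -- With β = b a⁻¹, the element a of the kernel ⟨β²⟩ is β^(2j), and b = β a.
    refine ⟨α, b * a⁻¹, 2 * j, 1 + 2 * j, t, hα, ?_, ?_⟩
    · rw [show 2 * j - (1 + 2 * j) = -1 by ring]
      simp
    · rw [zpow_add, hja, zpow_one, inv_mul_cancel_right, ← ht]
      exact hS
  -- When the kernel is not central, at most one term lies outside ⟨y⟩.
  · have htwo : ∀ c d : G, c ::ₘ d ::ₘ 0 ≤ S → (φ c).toAdd.1 = 1 → (φ d).toAdd.1 ≠ 1 := by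
      intro c d hcd hc hd
      apply hcent
      have hC : FreeConfig φ (y ^ 2) (n / 2) S := by
        refine ⟨hker, ?_, by omega, by omega, ?_⟩
        · rw [orderOf_pow_of_dvd (by norm_num) (by rw [hy]; exact h2), hy]
        · rwa [Nat.mul_div_cancel' h2]
      refine hC.commute_of_two_le ?_ ?_ hcd hc hd
      · intro a b ha hb
        exact zpowers_commute ((hfst a).1 ha) ((hfst b).1 hb)
      · have hxiff : ∀ v ∈ Subgroup.zpowers (y ^ 2), ∀ g : G, (φ g).toAdd.1 = 1 →
            (Commute v g ↔ Commute v x) := by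
          intro v hv g hg
          have hvy : v ∈ Subgroup.zpowers y :=
            (Subgroup.zpowers_le.2 (Subgroup.npow_mem_zpowers y 2)) hv
          rcases h.exists_eq hs g with ⟨i, rfl⟩ | ⟨i, rfl⟩
          · have := (hfst (y ^ i)).2 (Subgroup.zpow_mem_zpowers _ _)
            rw [hg] at this
            exact absurd this (by decide)
          · have hvi : Commute v (y ^ i) := zpowers_commute hvy (Subgroup.zpow_mem_zpowers _ _)
            refine ⟨fun hc => ?_, fun hc => hc.mul_right hvi⟩
            simpa using hc.mul_right hvi.inv_right
        intro v hv g h' hg hh hc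
        exact (hxiff v hv h' hh).2 ((hxiff v hv g hg).1 hc)
    by_cases hex : ∃ c ∈ S, (φ c).toAdd.1 = 1
    · obtain ⟨c, hcS, hc⟩ := hex
      obtain ⟨T, rfl⟩ := exists_cons_of_mem hcS
      have hT : ∀ z ∈ T, z ∈ Subgroup.zpowers y := by
        intro z hz
        refine (hfst z).1 ((h01 z).resolve_right (htwo c z ?_ hc))
        rw [cons_le_cons_iff]
        exact singleton_le.2 hz
      rw [card_cons] at hcard
      obtain ⟨u, hu, v, hv, huv, ho⟩ := exists_eq_replicate_of_mem_zpowers y (by omega) hy T hT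
        (by omega) (productOneFreeOfLength_iff.1 (hfree.mono (le_cons_self T c)))
      obtain ⟨t₁, rfl⟩ := Subgroup.mem_zpowers_iff.1 hu
      obtain ⟨t₂, rfl⟩ := Subgroup.mem_zpowers_iff.1 hv
      obtain ⟨t₃, rfl⟩ : ∃ t₃ : ℤ, c = x * y ^ t₃ := by
        rcases h.exists_eq hs c with ⟨i, rfl⟩ | hc'
        · have := (hfst (y ^ i)).2 (Subgroup.zpow_mem_zpowers _ _)
          rw [hc] at this
          exact absurd this (by decide)
        · exact hc'
      refine ⟨x, y, t₁, t₂, t₃, h, gcd_eq_one_of_orderOf (by omega) hy ho, ?_⟩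
      rw [huv, ← singleton_add, add_comm]
    -- All 2n - 1 terms lie in ⟨y⟩, contrary to Erdős–Ginzburg–Ziv.
    · push Not at hex
      obtain ⟨l, hl, hln, hl1⟩ := exists_list_of_mem_zpowers y hy S
        (fun z hz => (hfst z).1 ((h01 z).resolve_right (hex z hz))) (by omega)
      exact (productOneFreeOfLength_iff.1 hfree l hl hln hl1).elim

/-! ### The sequences of the stated form are free. -/

theorem le_replicate_add_replicate {α : Type*} {T : Multiset α} {i j : ℕ} {u v : α}
    (h : T ≤ replicate i u + replicate j v) :
    ∃ i' ≤ i, ∃ j' ≤ j, T = replicate i' u + replicate j' v := by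
  classical
  obtain ⟨i', hi', h1⟩ := le_replicate_iff.1 (inter_le_right : T ∩ replicate i u ≤ _)
  obtain ⟨j', hj', h2⟩ := le_replicate_iff.1 (tsub_le_iff_left.2 h)
  exact ⟨i', hi', j', hj', by rw [← h1, ← h2, add_comm, sub_add_inter]⟩

theorem prod_eq_of_coe_eq_replicate_add {l : List G} {i j : ℕ} {u v : G} (huv : Commute u v)
    (h : (l : Multiset G) = replicate i u + replicate j v) : l.prod = u ^ i * v ^ j := by
  have hperm : l.Perm (List.replicate i u ++ List.replicate j v) := by
    rw [← coe_eq_coe, h, ← coe_add, coe_replicate, coe_replicate]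
  have hmem : ∀ z ∈ l, z = u ∨ z = v := by
    intro z hz
    have : z ∈ (l : Multiset G) := hz
    rw [h, mem_add, mem_replicate, mem_replicate] at this
    exact this.imp And.right And.right
  rw [hperm.prod_eq', List.prod_append, List.prod_replicate, List.prod_replicate]
  refine List.Pairwise.imp_of_mem (R := fun _ _ => True) (fun {a b} ha hb _ => ?_)
    (List.pairwise_of_forall fun _ _ => trivial)
  rcases hmem a ha with rfl | rfl <;> rcases hmem b hb with rfl | rfl
  · exact Commute.refl _
  · exact huv
  · exact huv.symm
  · exact Commute.refl _

/-- The term α β^t₃ occurs only once, and a product containing it lies outside ⟨β⟩. Without it, i +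
j = r n terms of product one give n ∣ (t₁ - t₂) j, so n ∣ j; as j < n this forces j = 0 and i = r n,
one more than available. -/
theorem productOneFreeOfLength_of_eq (h4 : 4 ∣ n) (hn : 8 ≤ n) (hs : s ^ 2 ≡ 1 [ZMOD n])
    {α β : G} (h : IsPresentedBy n s α β) {t₁ t₂ t₃ : ℤ} (ht : Int.gcd (t₁ - t₂) n = 1) {r : ℕ}
    (hr : 1 ≤ r) : ProductOneFreeOfLength (r * n)
      (replicate (r * n - 1) (β ^ t₁) + replicate (n - 1) (β ^ t₂) + {α * β ^ t₃}) := by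
  have hrn : n ≤ r * n := Nat.le_mul_of_pos_left n hr
  rw [productOneFreeOfLength_iff]
  intro l hl hlen h1
  obtain ⟨hβ, -⟩ := h.orderOf_eq (dvd_trans (by norm_num) h4) hs
  obtain ⟨φ, hφα, hφβ, -, hfst⟩ := h.exists_klein_hom h4 hs
  have hcomm : Commute (β ^ t₁) (β ^ t₂) := Commute.zpow_zpow_self β t₁ t₂
  by_cases hc : α * β ^ t₃ ∈ l
  · obtain ⟨l', hl'⟩ : ∃ l' : Multiset G, (l : Multiset G) = α * β ^ t₃ ::ₘ l' :=
      exists_cons_of_mem (mem_coe.2 hc)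
    rw [hl', add_comm, singleton_add, cons_le_cons_iff] at hl
    obtain ⟨i, -, j, -, rfl⟩ := le_replicate_add_replicate hl
    have h2 : φ l.prod = ((l : Multiset G).map φ).prod := by simp [map_list_prod]
    rw [h1, hl', map_cons, prod_cons, Multiset.map_add, prod_add, map_replicate, map_replicate,
      prod_replicate, prod_replicate, ← map_pow, ← map_pow, ← map_mul, ← map_mul, map_one] at h2
    have h3 := (hfst (α * β ^ t₃ * ((β ^ t₁) ^ i * (β ^ t₂) ^ j))).1 (by rw [← h2]; rfl)
    have hm : ∀ t : ℤ, β ^ t ∈ Subgroup.zpowers β := Subgroup.zpow_mem_zpowers β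
    have h5 := (Subgroup.mul_mem_cancel_right _ (Subgroup.mul_mem _
      (Subgroup.pow_mem _ (hm t₁) i) (Subgroup.pow_mem _ (hm t₂) j))).1 h3
    have h6 := (hfst α).2 ((Subgroup.mul_mem_cancel_right _ (hm t₃)).1 h5)
    rw [hφα] at h6
    exact absurd h6 (by decide)
  · have hl' : (l : Multiset G) ≤ replicate (r * n - 1) (β ^ t₁) + replicate (n - 1) (β ^ t₂) := by
      rw [add_comm, singleton_add] at hl
      exact (le_cons_of_notMem (by simpa using hc)).1 hl
    obtain ⟨i, hi, j, hj, hij⟩ := le_replicate_add_replicate hl'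
    rw [prod_eq_of_coe_eq_replicate_add hcomm hij, ← zpow_natCast, ← zpow_natCast, ← zpow_mul,
      ← zpow_mul, ← zpow_add] at h1
    have hd := dvd_of_zpow_eq_one hβ h1
    have hsum := congrArg card hij
    rw [coe_card, hlen, card_add, card_replicate, card_replicate] at hsum
    have hd2 : (n : ℤ) ∣ (t₁ - t₂) * j := by
      have : (t₁ - t₂) * j = t₁ * (r * n : ℕ) - (t₁ * i + t₂ * j) := by
        rw [hsum]; push_cast; ring
      rw [this]
      refine dvd_sub (Dvd.dvd.mul_left ?_ _) hd
      push_cast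
      exact dvd_mul_left _ _
    have hd3 : (n : ℤ) ∣ j := by
      refine IsCoprime.dvd_of_dvd_mul_left ?_ hd2
      rw [Int.isCoprime_iff_gcd_eq_one, Int.gcd_comm, ht]
    have hj0 := Nat.eq_zero_of_dvd_of_lt (Int.natCast_dvd_natCast.1 hd3) (by omega)
    omega

/-! ### Part (c): exponent and padding by the identity. -/

theorem IsPresentedBy.pow_eq_one (h4 : 4 ∣ n) (hs : s ^ 2 ≡ 1 [ZMOD n])
    (h : IsPresentedBy n s x y) (g : G) : g ^ n = 1 := by
  have h2 : 2 ∣ n := dvd_trans (by norm_num) h4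
  obtain ⟨φ, -, -, hker, -⟩ := h.exists_klein_hom h4 hs
  obtain ⟨hy, -⟩ := h.orderOf_eq h2 hs
  obtain ⟨j, hj⟩ := Subgroup.mem_zpowers_iff.1 (sq_mem_of_ker_eq hker g)
  have hg : g ^ n = (g * g) ^ (n / 2) := by rw [← sq, ← pow_mul, Nat.mul_div_cancel' h2]
  rw [hg, ← hj, ← zpow_natCast, ← zpow_mul, mul_comm, zpow_mul, zpow_natCast, ← pow_mul,
    Nat.mul_div_cancel' h2, ← hy, pow_orderOf_eq_one, one_zpow]

theorem IsPresentedBy.exponent_eq (h4 : 4 ∣ n) (hs : s ^ 2 ≡ 1 [ZMOD n])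
    (h : IsPresentedBy n s x y) : Monoid.exponent G = n := by
  obtain ⟨hy, -⟩ := h.orderOf_eq (dvd_trans (by norm_num) h4) hs
  refine Nat.dvd_antisymm (Monoid.exponent_dvd_of_forall_pow_eq_one (h.pow_eq_one h4 hs)) ?_
  rw [← hy]
  exact Monoid.order_dvd_exponent y

theorem productOneFree_iff : ProductOneFree S ↔
    ∀ l : List G, (l : Multiset G) ≤ S → 1 ≤ l.length → l.prod ≠ 1 := by
  constructor
  · intro h l hl hk h1
    exact h ⟨l, hl, by simpa using hk, l, rfl, h1⟩
  · rintro h ⟨T, hT, hTk, l, rfl, h1⟩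
    exact h l hT (by simpa using hTk) h1

theorem shortProductOneFree_iff (hn : Monoid.exponent G = n) (hS : S.card = n) :
    ShortProductOneFree S ↔ ProductOneFree S := by
  constructor
  · rintro h ⟨T, hT, hTk, hT1⟩
    have := card_le_card hT
    exact h T.card ⟨hTk, by omega⟩ ⟨T, hT, rfl, hT1⟩
  · rintro h j ⟨hj, -⟩ ⟨T, hT, hTk, hT1⟩
    exact h ⟨T, hT, by omega, hT1⟩

theorem prod_filter_ne_one [DecidableEq G] (l : List G) : (l.filter (· ≠ 1)).prod = l.prod := by
  induction l with
  | nil => rfl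
  | cons a l ih =>
    by_cases ha : a = 1
    · subst ha
      simpa using ih
    · simpa [ha] using ih

/-- Copies of 1 pad a product-one subsequence to length n, and deleting the terms 1 reverses this.
Having only n - 1 copies matters: n terms equal to 1 would include one from S, already a product-one
subsequence. -/
theorem productOneFree_iff_add_replicate (hn : 1 ≤ n) (hS : S.card = n) :
    ProductOneFree S ↔ ProductOneFreeOfLength n (S + replicate (n - 1) 1) := by
  classical
  rw [productOneFree_iff, productOneFreeOfLength_iff]
  constructor
  · intro h l hl hlen h1
    refine h (l.filter (· ≠ 1)) ?_ ?_ ?_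
    · rw [← filter_coe]
      have := filter_le_filter (· ≠ 1) hl
      have h0 : (replicate (n - 1) (1 : G)).filter (· ≠ 1) = 0 :=
        filter_eq_nil.2 fun a ha => by simpa using eq_of_mem_replicate ha
      rw [filter_add, h0, add_zero] at this
      exact this.trans (filter_le _ _)
    · by_contra! hlt
      have h0 : l.filter (· ≠ 1) = [] := List.length_eq_zero_iff.1 (by omega)
      have hall : ∀ a ∈ l, a = 1 := by simpa [List.filter_eq_nil_iff] using h0
      have hrep : l = List.replicate n 1 := List.eq_replicate_iff.2 ⟨hlen, hall⟩
      by_cases h1S : (1 : G) ∈ S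
      · exact h [1] (by simpa using h1S) (by simp) (by simp)
      · have := count_le_of_le 1 hl
        rw [hrep, coe_replicate, count_replicate_self, count_add, count_replicate_self,
          count_eq_zero_of_notMem h1S] at this
        omega
    · rw [prod_filter_ne_one, h1]
  · intro h l hl hlen h1
    have hle : l.length ≤ n := by
      rw [← hS, ← coe_card]
      exact card_le_card hl
    refine h (l ++ List.replicate (n - l.length) 1) ?_ (by simp; omega) (by simp [h1])
    rw [← coe_add, coe_replicate]
    exact add_le_add hl ((replicate_le_replicate _).2 (by omega))

theorem IsPresentedBy.zpow_right (h4 : 4 ∣ n) (hn : 8 ≤ n) (hs : s ^ 2 ≡ 1 [ZMOD n]) {α β : G}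
    (h : IsPresentedBy n s α β) {t : ℤ} (ht : Int.gcd t n = 1) : IsPresentedBy n s α (β ^ t) := by
  have h2 : 2 ∣ n := dvd_trans (by norm_num) h4
  obtain ⟨hβ, hα⟩ := h.orderOf_eq h2 hs
  obtain ⟨hα2, hβn, hβα⟩ := h.relations
  obtain ⟨a, b, hab⟩ := Int.isCoprime_iff_gcd_eq_one.2 ht
  have hinv : (β ^ t) ^ a = β := by
    rw [← zpow_mul, show t * a = 1 - b * n by linarith, zpow_sub, zpow_one, mul_comm b, zpow_mul,
      zpow_natCast, hβn, one_zpow, inv_one, mul_one]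
  have hz : Subgroup.zpowers (β ^ t) = Subgroup.zpowers β := by
    apply le_antisymm
    · exact Subgroup.zpowers_le.2 (Subgroup.zpow_mem_zpowers _ _)
    · rw [Subgroup.zpowers_le]
      exact Subgroup.mem_zpowers_iff.2 ⟨a, hinv⟩
  have ho : orderOf (β ^ t) = n := by
    rw [← Nat.card_zpowers, hz, Nat.card_zpowers, hβ]
  refine h.of_relations h2 (by omega) hs ?_ ho ?_ (by rwa [hz])
  · rw [hα2, ← zpow_natCast (β ^ t), ← zpow_mul]
    refine (zpow_eq_pow_half (by rw [hβ, Nat.mul_div_cancel' h2]) ?_ ?_).symm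
    · rw [← zpow_add, ← mul_add]
      norm_cast
      rw [← two_mul, Nat.mul_div_cancel' h2, mul_comm, zpow_mul, zpow_natCast, hβn, one_zpow]
    · rw [zpow_mul, zpow_natCast]
      exact pow_ne_one_of_lt_orderOf (by omega) (by omega)
  · rw [zpow_mul_eq_mul_zpow hβα, ← zpow_mul, mul_comm]

theorem productOneFree_iff_exists (hn : 8 ≤ n) (h4 : 4 ∣ n) (hs : s ^ 2 ≡ 1 [ZMOD n])
    (hs1 : ¬ s ≡ 1 [ZMOD n]) (h : IsPresentedBy n s x y) (hS : S.card = n) :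
    ProductOneFree S ↔ ∃ (α β : G) (t : ℤ), IsPresentedBy n s α β ∧
      S = replicate (n - 1) β + {α * β ^ t} := by
  classical
  have h2 : 2 ∣ n := dvd_trans (by norm_num) h4
  rw [productOneFree_iff_add_replicate (by omega) hS]
  constructor
  · intro hf
    have h1S : (1 : G) ∉ S := by
      intro h1
      have := (productOneFree_iff_add_replicate (by omega) hS).2 hf
      rw [productOneFree_iff] at this
      exact this [1] (by simpa using h1) (by simp) (by simp)
    obtain ⟨α, β, t₁, t₂, t₃, hαβ, ht, hE⟩ := exists_eq_of_productOneFreeOfLength hn h4 hs hs1 h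
      (by rw [card_add, hS, card_replicate]; omega) hf
    obtain ⟨hβ, hα⟩ := hαβ.orderOf_eq h2 hs
    have hc : α * β ^ t₃ ∉ Subgroup.zpowers β := fun hmem =>
      hα ((Subgroup.mul_mem_cancel_right _ (Subgroup.zpow_mem_zpowers β t₃)).1 hmem)
    -- the case in which the other value is trivial
    have main : ∀ t t' : ℤ, Int.gcd (t' - t) n = 1 → β ^ t' = 1 →
        S = replicate (n - 1) (β ^ t) + {α * β ^ t₃} → ∃ (α β : G) (t : ℤ),
          IsPresentedBy n s α β ∧ S = replicate (n - 1) β + {α * β ^ t} := by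
      intro t t' hg h1 hST
      have hg' : Int.gcd t n = 1 := by
        obtain ⟨k, rfl⟩ := dvd_of_zpow_eq_one hβ h1
        rw [← Int.isCoprime_iff_gcd_eq_one] at hg ⊢
        obtain ⟨a, b, hab⟩ := hg
        exact ⟨-a, b + a * k, by linarith⟩
      have hP := hαβ.zpow_right h4 hn hs hg'
      obtain ⟨t'', ht''⟩ : ∃ i : ℤ, α * β ^ t₃ = α * (β ^ t) ^ i := by
        rcases hP.exists_eq hs (α * β ^ t₃) with ⟨i, hi⟩ | hi
        · rw [← zpow_mul] at hi
          exact (hc (hi ▸ Subgroup.zpow_mem_zpowers _ _)).elim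
        · exact hi
      exact ⟨α, β ^ t, t'', hP, by rw [hST, ht'']⟩
    have hcount := congrArg (count 1) hE
    simp only [count_add, count_replicate, count_eq_zero_of_notMem h1S, count_singleton] at hcount
    have hc1 : (1 : G) ≠ α * β ^ t₃ := fun h1 => hc (h1 ▸ Subgroup.one_mem _)
    rw [if_pos trivial, if_neg hc1] at hcount
    -- The padding gives 1 multiplicity n - 1 > 0, and α β^t₃ ≠ 1. The exponent of the other value
    -- is then coprime to n, so that value can serve as β.
    have hor : β ^ t₁ = 1 ∨ β ^ t₂ = 1 := by
      by_contra! hne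
      rw [if_neg hne.1, if_neg hne.2] at hcount
      omega
    rcases hor with h1 | h1
    · refine main t₂ t₁ ht h1 ?_
      rw [h1, add_comm, add_assoc] at hE
      exact add_left_cancel hE
    · refine main t₁ t₂ ?_ h1 ?_
      · rwa [← neg_sub, Int.neg_gcd]
      · rw [h1, add_right_comm] at hE
        exact add_right_cancel hE
  · rintro ⟨α, β, t, hαβ, rfl⟩
    have := productOneFreeOfLength_of_eq h4 hn hs hαβ (t₁ := 1) (t₂ := 0) (t₃ := t) (by simp)
      (r := 1) le_rfl
    rw [zpow_one, zpow_zero, one_mul] at this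
    rwa [add_right_comm]

/-! ### Part (b): removing product-one subsequences of length n. -/

/-- Two values of multiplicity `n - 1` and one of multiplicity `1`. -/
def IsTwoValued {G : Type*} (n : ℕ) (T : Multiset G) : Prop :=
  ∃ a b c, a ≠ b ∧ c ≠ a ∧ c ≠ b ∧ T = replicate (n - 1) a + replicate (n - 1) b + {c}

theorem IsTwoValued.count_eq {G : Type*} [DecidableEq G] {T : Multiset G} (h : IsTwoValued n T) {z : G}
    (hz : z ∈ T) : T.count z = n - 1 ∨ T.count z = 1 := by
  obtain ⟨a, b, c, hab, hca, hcb, rfl⟩ := h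
  simp only [mem_add, mem_replicate, mem_singleton] at hz
  simp only [count_add, count_replicate, count_singleton]
  rcases hz with (⟨-, rfl⟩ | ⟨-, rfl⟩) | rfl
  · simp [hab.symm, hca.symm]
  · simp [hab, hcb.symm]
  · simp [hca.symm, hcb.symm]

theorem IsTwoValued.mem_or {G : Type*} {T : Multiset G} (h : IsTwoValued n T) {a b c d : G} (hab : a ≠ b)
    (hca : c ≠ a) (hcb : c ≠ b) (ha : a ∈ T) (hb : b ∈ T) (hc : c ∈ T) (hd : d ∈ T) :
    d = a ∨ d = b ∨ d = c := by
  obtain ⟨a', b', c', -, -, -, rfl⟩ := h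
  simp only [mem_add, mem_replicate, mem_singleton] at ha hb hc hd
  have ha := ha.imp (Or.imp And.right And.right) id
  have hb := hb.imp (Or.imp And.right And.right) id
  have hc := hc.imp (Or.imp And.right And.right) id
  have hd := hd.imp (Or.imp And.right And.right) id
  grind

theorem IsPresentedBy.ne_of_gcd (hn : 8 ≤ n) (h2 : 2 ∣ n) (hs : s ^ 2 ≡ 1 [ZMOD n]) {α β : G}
    (h : IsPresentedBy n s α β) {t₁ t₂ : ℤ} (t₃ : ℤ) (ht : Int.gcd (t₁ - t₂) n = 1) :
    β ^ t₁ ≠ β ^ t₂ ∧ α * β ^ t₃ ≠ β ^ t₁ ∧ α * β ^ t₃ ≠ β ^ t₂ := by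
  obtain ⟨hβ, hα⟩ := h.orderOf_eq h2 hs
  have hc : α * β ^ t₃ ∉ Subgroup.zpowers β := fun hmem =>
    hα ((Subgroup.mul_mem_cancel_right _ (Subgroup.zpow_mem_zpowers β t₃)).1 hmem)
  refine ⟨fun he => ?_, fun he => hc (he ▸ Subgroup.zpow_mem_zpowers _ _),
    fun he => hc (he ▸ Subgroup.zpow_mem_zpowers _ _)⟩
  have h1 : β ^ (t₁ - t₂) = 1 := by rw [zpow_sub, he, mul_inv_cancel]
  have := Int.gcd_eq_right_iff_dvd (by omega) |>.2 (dvd_of_zpow_eq_one hβ h1)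
  omega

theorem isTwoValued_of_free (hn : 8 ≤ n) (h4 : 4 ∣ n) (hs : s ^ 2 ≡ 1 [ZMOD n])
    (hs1 : ¬ s ≡ 1 [ZMOD n]) (h : IsPresentedBy n s x y) {T : Multiset G}
    (hT : T.card = 2 * n - 1) (hf : ProductOneFreeOfLength n T) : IsTwoValued n T := by
  obtain ⟨α, β, t₁, t₂, t₃, hαβ, ht, rfl⟩ :=
    exists_eq_of_productOneFreeOfLength hn h4 hs hs1 h hT hf
  obtain ⟨h1, h2, h3⟩ := hαβ.ne_of_gcd hn (dvd_trans (by norm_num) h4) hs t₃ ht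
  exact ⟨_, _, _, h1, h2, h3, rfl⟩

/-- Every sequence of length `2 n` has a product-one subsequence of length `n`. -/
theorem exists_list_of_two_mul_le (hn : 8 ≤ n) (h4 : 4 ∣ n) (hs : s ^ 2 ≡ 1 [ZMOD n])
    (hs1 : ¬ s ≡ 1 [ZMOD n]) (h : IsPresentedBy n s x y) {T : Multiset G}
    (hT : 2 * n ≤ T.card) : ∃ l : List G, (l : Multiset G) ≤ T ∧ l.length = n ∧ l.prod = 1 := by
  classical
  obtain ⟨U, hU, hUc⟩ : ∃ U ≤ T, U.card = 2 * n := by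
    induction T using Quotient.inductionOn with
    | h l =>
      refine ⟨(l.take (2 * n) : List G), (List.take_sublist _ _).subperm, ?_⟩
      simpa using hT
  by_contra! hno
  have hf : ProductOneFreeOfLength n U :=
    productOneFreeOfLength_iff.2 fun l hl hlen => hno l (hl.trans hU) hlen
  obtain ⟨d, hd⟩ : ∃ d, d ∈ U := card_pos_iff_exists_mem.1 (by omega)
  obtain ⟨V, rfl⟩ := exists_cons_of_mem hd
  rw [card_cons] at hUc
  obtain ⟨a, b, c, hab, hca, hcb, hV⟩ := isTwoValued_of_free hn h4 hs hs1 h (T := V) (by omega)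
    (hf.mono (le_cons_self _ _))
  have hcount : ∀ z, V.count z < n → z ∈ V → (d ::ₘ V).count z < n := by
    intro z _ _
    by_contra! hge
    refine productOneFreeOfLength_iff.1 hf (List.replicate n z) ?_ (by simp) ?_
    · rw [coe_replicate]
      exact le_count_iff_replicate_le.1 hge
    · rw [List.prod_replicate, h.pow_eq_one h4 hs]
  have hVa : V.count a = n - 1 := by
    rw [hV]
    simp [count_replicate, hab.symm, hca.symm]
  have haV : a ∈ V := count_pos.1 (by omega)
  have hda : d ≠ a := by
    rintro rfl
    have := hcount d (by omega) haV
    rw [count_cons_self] at this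
    omega
  -- Replacing one a by d ≠ a leaves a with multiplicity n - 2, which is neither n - 1 nor 1.
  have h1 := isTwoValued_of_free hn h4 hs hs1 h (T := d ::ₘ V.erase a)
    (by rw [card_cons, card_erase_of_mem haV, Nat.pred_eq_sub_one]; omega)
    (hf.mono (by rw [cons_le_cons_iff]; exact erase_le _ _))
  have hca' : (d ::ₘ V.erase a).count a = n - 2 := by
    rw [count_cons_of_ne hda.symm, count_erase_self, hVa]
    omega
  have := h1.count_eq (z := a) (count_pos.1 (by omega))
  omega

theorem replicate_add_le_of_le_count {X : Type*} [DecidableEq X] {S : Multiset X} {a b c : X}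
    (hab : a ≠ b) (hca : c ≠ a) (hcb : c ≠ b) {p q r : ℕ} (hp : p ≤ S.count a)
    (hq : q ≤ S.count b) (hr : r ≤ S.count c) :
    replicate p a + replicate q b + replicate r c ≤ S := by
  rw [Multiset.le_iff_count]
  intro z
  simp only [count_add, count_replicate]
  by_cases hza : a = z
  · subst hza; simp [hab.symm, hca, hp]
  by_cases hzb : b = z
  · subst hzb; simp [hab, hcb, hq]
  by_cases hzc : c = z
  · subst hzc; simp [hca.symm, hcb.symm, hr]
  · simp [hza, hzb, hzc]

theorem eq_replicate_add_of_forall_mem {X : Type*} [DecidableEq X] {S : Multiset X} {a b c : X}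
    (hab : a ≠ b) (hca : c ≠ a) (hcb : c ≠ b) (h : ∀ d ∈ S, d = a ∨ d = b ∨ d = c) :
    S = replicate (S.count a) a + replicate (S.count b) b + replicate (S.count c) c := by
  ext z
  simp only [count_add, count_replicate]
  by_cases hz : z ∈ S
  · rcases h z hz with rfl | rfl | rfl
    · simp [hab.symm, hca]
    · simp [hab, hcb]
    · simp [hca.symm, hcb.symm]
  · have h0 := count_eq_zero_of_notMem hz
    by_cases hza : a = z
    · subst hza; simp [hab.symm, hca]
    by_cases hzb : b = z
    · subst hzb; simp [hab, hcb]
    by_cases hzc : c = z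
    · subst hzc; simp [hca.symm, hcb.symm]
    · simp [hza, hzb, hzc, h0]

/-- The multiplicities of three values, given what removing product-one subsequences of length `n`
may leave. -/
theorem multiplicities_eq (hn : 8 ≤ n) (hpow : ∀ g : G, g ^ n = 1) {β a b c : G}
    (hβ : orderOf β = n) (haβ : a ∈ Subgroup.zpowers β) (hbβ : b ∈ Subgroup.zpowers β)
    (hgen : orderOf (a * b⁻¹) = n) (hc2 : c * c ∈ Subgroup.zpowers β) {i j k : ℕ}
    (hsum : i + j + k = 3 * n - 1) (hia : n - 1 ≤ i) (hjb : n - 1 ≤ j) (hkc : 1 ≤ k)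
    (hk2 : 2 ≤ k → n - 1 ≤ k) (hcab : 4 ≤ k → c * c ≠ a * b)
    (hcompl : ∀ p q r : ℕ, p ≤ i → q ≤ j → 2 * r ≤ k → p + q + 2 * r = n →
      (c * c) ^ r * (a ^ p * b ^ q) = 1 →
      (i - p = 0 ∨ i - p = 1 ∨ i - p = n - 1) ∧ (j - q = 0 ∨ j - q = 1 ∨ j - q = n - 1) ∧
        (k - 2 * r = 0 ∨ k - 2 * r = 1 ∨ k - 2 * r = n - 1)) :
    k = 1 ∧ (i = 2 * n - 1 ∧ j = n - 1 ∨ i = n - 1 ∧ j = 2 * n - 1) := by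
  have hcomm : Commute a b := zpowers_commute haβ hbβ
  have hk1 : k = 1 := by
    by_contra hk
    have hkn := hk2 (by omega)
    -- Remove two copies of c, t of a and n - 2 - t of b, with product one. The value t = n - 1
    -- would mean c² = a b, which `hcab` excludes.
    obtain ⟨t, hi, hi1⟩ := exists_mul_zpow_eq_one hβ (by omega) haβ hbβ hgen (n - 2) hc2
    have hin : t ≤ n - 2 := by
      by_contra! hlt
      obtain rfl : t = n - 1 := by omega
      have h3 : (n - 2 : ℤ) - ((n - 1 : ℕ) : ℤ) = -1 := by omega
      have h5 : a ^ (n - 1) = a⁻¹ := by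
        rw [eq_inv_iff_mul_eq_one, ← pow_succ, Nat.sub_add_cancel (by omega),
          hpow]
      rw [h3, h5, zpow_neg_one, ← mul_inv_rev, mul_inv_eq_one] at hi1
      exact hcab (by omega) (hi1.trans hcomm.eq.symm)
    have hexp : b ^ ((n - 2 : ℤ) - t) = b ^ (n - 2 - t) := by
      rw [← zpow_natCast]
      congr 1
      omega
    rw [hexp] at hi1
    have hsub : ∀ u v : ℕ, n - 1 ≤ u → v ≤ n - 2 → u - v = 0 ∨ u - v = 1 ∨ u - v = n - 1 →
        u = v + 1 ∨ u = v + (n - 1) := by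
      intro u v _ _ h
      omega
    obtain ⟨ea, -, ec⟩ := hcompl t (n - 2 - t) 1 (by omega) (by omega) (by omega) (by omega)
      (by rw [pow_one, hi1])
    replace ea := hsub i t hia hin ea
    -- Removing two copies of c leaves 1 or n - 1 of them, and k = 3 is impossible since k ≥ n - 1.
    replace ec : k = n + 1 := by
      clear ea
      have := hsub k (2 * 1) hkn (by omega) ec
      omega
    obtain ⟨hi', hj'⟩ : i = n - 1 ∧ j = n - 1 := by
      clear ea
      omega
    -- Since t is 0 or n - 2, c² is b² or a². Then four copies of c and n - 4 of that element also
    -- have product one, and removing them leaves three of it, a multiplicity not in {0, 1, n - 1}.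
    have hsq : ∀ z : G, (c * c) * z ^ (n - 2) = 1 → (c * c) ^ 2 * z ^ (n - 4) = 1 := by
      intro z hz
      have h6 : z ^ (n - 2) = (z ^ 2)⁻¹ := by
        rw [eq_inv_iff_mul_eq_one, ← pow_add, Nat.sub_add_cancel (by omega),
          hpow]
      have h7 : z ^ (n - 4) = (z ^ 4)⁻¹ := by
        rw [eq_inv_iff_mul_eq_one, ← pow_add, Nat.sub_add_cancel (by omega),
          hpow]
      rw [h6, mul_inv_eq_one] at hz
      rw [h7, hz, ← pow_mul, mul_inv_cancel]
    have hi0 : t = 0 ∨ t = n - 2 := by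
      omega
    rcases hi0 with rfl | rfl
    · rw [pow_zero, one_mul, Nat.sub_zero] at hi1
      obtain ⟨-, h8, -⟩ := hcompl 0 (n - 4) 2 (by omega) (by omega) (by omega) (by omega)
        (by rw [pow_zero, one_mul, hsq b hi1])
      rw [hj'] at h8
      clear ea
      omega
    · rw [Nat.sub_self, pow_zero, mul_one] at hi1
      obtain ⟨h8, -, -⟩ := hcompl (n - 4) 0 2 (by omega) (by omega) (by omega) (by omega)
        (by rw [pow_zero, mul_one, hsq a hi1])
      rw [hi'] at h8
      clear ea
      omega
  refine ⟨hk1, ?_⟩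
  by_cases hin : n ≤ i
  · have h1 := hcompl n 0 0 hin (by omega) (by omega) (by omega)
      (by rw [pow_zero, pow_zero, one_mul, mul_one, hpow])
    omega
  · omega

theorem count_compl_of_isTwoValued [DecidableEq G] {a b c : G}
    (hab : a ≠ b) (hca : c ≠ a) (hcb : c ≠ b)
    (htwo : ∀ l : List G, (l : Multiset G) ≤ S → l.length = n → l.prod = 1 →
      IsTwoValued n (S - (l : Multiset G))) {p q r : ℕ} (hp : p ≤ S.count a) (hq : q ≤ S.count b)
    (hr : 2 * r ≤ S.count c) (hpqr : p + q + 2 * r = n) (h1 : (c * c) ^ r * (a ^ p * b ^ q) = 1) :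
    (S.count a - p = 0 ∨ S.count a - p = 1 ∨ S.count a - p = n - 1) ∧
      (S.count b - q = 0 ∨ S.count b - q = 1 ∨ S.count b - q = n - 1) ∧
      (S.count c - 2 * r = 0 ∨ S.count c - 2 * r = 1 ∨ S.count c - 2 * r = n - 1) := by
  let l := List.replicate (2 * r) c ++ (List.replicate p a ++ List.replicate q b)
  have hl : (l : Multiset G) = replicate p a + replicate q b + replicate (2 * r) c := by
    simp only [l, ← coe_add, coe_replicate]
    rw [add_comm]
  have hle' : (l : Multiset G) ≤ S := hl ▸ replicate_add_le_of_le_count hab hca hcb hp hq hr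
  have htw := htwo l hle' (by simp [l]; omega) (by
    simp only [l, List.prod_append, List.prod_replicate]
    rw [pow_mul, sq, h1])
  have hcnt : ∀ z, count z (S - (l : Multiset G)) = 0 ∨ count z (S - (l : Multiset G)) = 1 ∨
      count z (S - (l : Multiset G)) = n - 1 := by
    intro z
    by_cases hz : z ∈ S - (l : Multiset G)
    · have := htw.count_eq hz
      omega
    · exact Or.inl (count_eq_zero_of_notMem hz)
  have ea := hcnt a
  have eb := hcnt b
  have ec := hcnt c
  rw [count_sub, hl] at ea eb ec
  simp only [count_add, count_replicate, if_pos trivial, if_neg hab, if_neg hab.symm, if_neg hca,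
    if_neg hca.symm, if_neg hcb, if_neg hcb.symm, add_zero, zero_add] at ea eb ec
  exact ⟨ea, eb, ec⟩

theorem exists_eq_of_productOneFreeOfLength_two_mul (hn : 8 ≤ n) (h4 : 4 ∣ n)
    (hs : s ^ 2 ≡ 1 [ZMOD n]) (hs1 : ¬ s ≡ 1 [ZMOD n]) (h : IsPresentedBy n s x y)
    (hcard : S.card = 3 * n - 1) (hfree : ProductOneFreeOfLength (2 * n) S) :
    ∃ (α β : G) (t₁ t₂ t₃ : ℤ), IsPresentedBy n s α β ∧ Int.gcd (t₁ - t₂) n = 1 ∧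
      S = replicate (2 * n - 1) (β ^ t₁) + replicate (n - 1) (β ^ t₂) + {α * β ^ t₃} := by
  classical
  have h2 : 2 ∣ n := dvd_trans (by norm_num) h4
  have hfree' := productOneFreeOfLength_iff.1 hfree
  have hrest : ∀ l : List G, (l : Multiset G) ≤ S → l.length = n → l.prod = 1 →
      (S - (l : Multiset G)).card = 2 * n - 1 ∧ ProductOneFreeOfLength n (S - (l : Multiset G)) := by
    intro l hl hlen hl1
    refine ⟨by rw [card_sub hl, hcard, coe_card, hlen]; omega, ?_⟩
    rw [productOneFreeOfLength_iff]
    intro l' hl' hlen' hl1'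
    refine hfree' (l ++ l') ?_ (by simp; omega) (by simp [hl1, hl1'])
    rw [← coe_add]
    calc (l : Multiset G) + l' ≤ l + (S - l) := add_le_add_right hl' _
      _ = S := add_tsub_cancel_of_le hl
  have htwo : ∀ l : List G, (l : Multiset G) ≤ S → l.length = n → l.prod = 1 →
      IsTwoValued n (S - (l : Multiset G)) := fun l hl hlen hl1 =>
    isTwoValued_of_free hn h4 hs hs1 h (hrest l hl hlen hl1).1 (hrest l hl hlen hl1).2
  -- Any four terms can be protected from removal, because 3n - 5 ≥ 2n.
  have havoid : ∀ U ≤ S, U.card = 4 → ∃ l : List G, (l : Multiset G) ≤ S ∧ l.length = n ∧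
      l.prod = 1 ∧ U ≤ S - (l : Multiset G) := by
    intro U hU hUc
    obtain ⟨l, hl, hlen, hl1⟩ := exists_list_of_two_mul_le hn h4 hs hs1 h (T := S - U)
      (by rw [card_sub hU, hcard]; omega)
    refine ⟨l, hl.trans tsub_le_self, hlen, hl1, ?_⟩
    have : U + (l : Multiset G) ≤ S := by
      calc U + (l : Multiset G) ≤ U + (S - U) := add_le_add_right hl _
        _ = S := add_tsub_cancel_of_le hU
    exact le_tsub_of_add_le_right this
  obtain ⟨l₀, hl₀, hlen₀, hl1₀⟩ := exists_list_of_two_mul_le hn h4 hs hs1 h (T := S) (by omega)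
  obtain ⟨α, β, t₁, t₂, t₃, hαβ, ht, hT⟩ := exists_eq_of_productOneFreeOfLength hn h4 hs hs1 h
    (hrest l₀ hl₀ hlen₀ hl1₀).1 (hrest l₀ hl₀ hlen₀ hl1₀).2
  obtain ⟨hab, hca, hcb⟩ := hαβ.ne_of_gcd hn h2 hs t₃ ht
  obtain ⟨hβ, hα⟩ := hαβ.orderOf_eq h2 hs
  have hc2 : (α * β ^ t₃) * (α * β ^ t₃) ∈ Subgroup.zpowers β := by
    obtain ⟨φ, -, -, -, hfst⟩ := hαβ.exists_klein_hom h4 hs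
    rw [← hfst, map_mul, Klein.mul_self]
    rfl
  have haβ : β ^ t₁ ∈ Subgroup.zpowers β := Subgroup.zpow_mem_zpowers _ _
  have hbβ : β ^ t₂ ∈ Subgroup.zpowers β := Subgroup.zpow_mem_zpowers _ _
  have hgen : orderOf (β ^ t₁ * (β ^ t₂)⁻¹) = n := by
    have := (hαβ.zpow_right h4 hn hs ht).orderOf_eq h2 hs
    rw [← zpow_neg, ← zpow_add, ← sub_eq_add_neg]
    exact this.1
  have hTle : ∀ z, (replicate (n - 1) (β ^ t₁) + replicate (n - 1) (β ^ t₂) +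
      {α * β ^ t₃}).count z ≤ S.count z := by
    rw [← hT]
    exact fun z => count_le_of_le z tsub_le_self
  suffices h : S = replicate (S.count (β ^ t₁)) (β ^ t₁) +
      replicate (S.count (β ^ t₂)) (β ^ t₂) + replicate (S.count (α * β ^ t₃)) (α * β ^ t₃) ∧
      S.count (α * β ^ t₃) = 1 ∧
      (S.count (β ^ t₁) = 2 * n - 1 ∧ S.count (β ^ t₂) = n - 1 ∨
        S.count (β ^ t₁) = n - 1 ∧ S.count (β ^ t₂) = 2 * n - 1) by
    obtain ⟨hS, hk, ⟨hi, hj⟩ | ⟨hi, hj⟩⟩ := h <;> rw [hk, hi, hj, replicate_one] at hS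
    · exact ⟨α, β, t₁, t₂, t₃, hαβ, ht, hS⟩
    · exact ⟨α, β, t₂, t₁, t₃, hαβ, by rwa [← neg_sub, Int.neg_gcd],
        hS.trans (by rw [add_comm (replicate (n - 1) _)])⟩
  clear hT ht
  generalize β ^ t₁ = a at *
  generalize β ^ t₂ = b at *
  generalize α * β ^ t₃ = c at *
  have hia : n - 1 ≤ S.count a := by
    refine le_trans ?_ (hTle a)
    rw [count_add, count_add, count_replicate_self, add_assoc]
    exact Nat.le_add_right _ _
  have hjb : n - 1 ≤ S.count b := by
    refine le_trans ?_ (hTle b)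
    rw [count_add, count_add, count_replicate_self, add_right_comm]
    exact Nat.le_add_left _ _
  have hkc : 1 ≤ S.count c := by
    refine le_trans ?_ (hTle c)
    rw [count_add, count_singleton_self]
    exact Nat.le_add_left _ _
  have hvals : ∀ d ∈ S, d = a ∨ d = b ∨ d = c := by
    intro d hd
    by_contra! hne
    -- Protecting a, b, c and a fourth value d would leave four values in a complement that has only
    -- three.
    have hle : replicate 1 a + replicate 1 b + replicate 1 c + {d} ≤ S := by
      have h1 : replicate 1 a + replicate 1 b + replicate 1 c ≤ S.erase d := by
        refine replicate_add_le_of_le_count hab hca hcb ?_ ?_ ?_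
        · rw [count_erase_of_ne hne.1.symm]; omega
        · rw [count_erase_of_ne hne.2.1.symm]; omega
        · rwa [count_erase_of_ne hne.2.2.symm]
      calc _ ≤ S.erase d + {d} := add_le_add_left h1 _
        _ = S := by rw [add_comm, singleton_add, cons_erase hd]
    obtain ⟨l, hl, hlen, hl1, hU⟩ := havoid _ hle (by simp)
    have := (htwo l hl hlen hl1).mem_or hab hca hcb (mem_of_le hU (by simp))
      (mem_of_le hU (by simp)) (mem_of_le hU (by simp)) (d := d) (mem_of_le hU (by simp))
    tauto
  have hS := eq_replicate_add_of_forall_mem hab hca hcb hvals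
  refine ⟨hS, multiplicities_eq hn (h.pow_eq_one h4 hs) hβ haβ hbβ hgen hc2 ?_ hia hjb hkc
    (fun hk => ?_) (fun hk hcab => ?_)
    fun p q r => count_compl_of_isTwoValued hab hca hcb htwo⟩
  · have := congrArg card hS
    rw [card_add, card_add, card_replicate, card_replicate, card_replicate, hcard] at this
    exact this.symm
  -- Protecting a, b and two copies of c leaves c with multiplicity at least 2, hence n - 1.
  · obtain ⟨l, hl, hlen, hl1, hU⟩ := havoid _ (replicate_add_le_of_le_count hab hca hcb
      (show 1 ≤ S.count a by omega) (show 1 ≤ S.count b by omega) hk) (by simp)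
    have h1 := (htwo l hl hlen hl1).count_eq (z := c) (mem_of_le hU (by simp))
    have h3 : 2 ≤ count c (S - (l : Multiset G)) := by
      refine le_trans ?_ (count_le_of_le c hU)
      rw [count_add, count_replicate_self]
      exact Nat.le_add_left _ _
    have h5 : count c (S - (l : Multiset G)) ≤ S.count c := count_le_of_le _ tsub_le_self
    omega
  -- If c² = a b, then c⁴ a^(n-2) b^(n-2) = (a b)^n = 1 is a product of 2n terms.
  · have hcomm : Commute a b := zpowers_commute haβ hbβ
    refine hfree' (List.replicate 4 c ++ (List.replicate (n - 2) a ++ List.replicate (n - 2) b))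
      ?_ (by simp; omega) ?_
    · simp only [← coe_add, coe_replicate]
      rw [add_comm]
      exact replicate_add_le_of_le_count hab hca hcb (by omega) (by omega) (by omega)
    · simp only [List.prod_append, List.prod_replicate]
      rw [show 4 = 2 * 2 by norm_num, pow_mul, sq c, hcab, ← hcomm.mul_pow, ← pow_add,
        show 2 + (n - 2) = n by omega, h.pow_eq_one h4 hs]

end Main

theorem theorem1p2 {G : Type*} [Group G] (n : ℕ) (s : ℤ) (x y : G)
    (hn : 8 ≤ n) (hn4 : 4 ∣ n)
    (hs : s ^ 2 ≡ 1 [ZMOD n]) (hs1 : ¬ s ≡ 1 [ZMOD n]) (hs2 : ¬ s ≡ -1 [ZMOD n])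
    (hG : IsPresentedBy n s x y) (S : Multiset G) :
    (S.card = 2 * n - 1 →
      (ProductOneFreeOfLength n S ↔
        ∃ (α β : G) (t₁ t₂ t₃ : ℤ), IsPresentedBy n s α β ∧ Int.gcd (t₁ - t₂) n = 1 ∧
          S = Multiset.replicate (n - 1) (β ^ t₁) + Multiset.replicate (n - 1) (β ^ t₂)
            + {α * β ^ t₃})) ∧
    (S.card = 3 * n - 1 →
      (ProductOneFreeOfLength (2 * n) S ↔
        ∃ (α β : G) (t₁ t₂ t₃ : ℤ), IsPresentedBy n s α β ∧ Int.gcd (t₁ - t₂) n = 1 ∧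
          S = Multiset.replicate (2 * n - 1) (β ^ t₁) + Multiset.replicate (n - 1) (β ^ t₂)
            + {α * β ^ t₃})) ∧
    (S.card = n →
      (ProductOneFree S ↔
        ∃ (α β : G) (t : ℤ), IsPresentedBy n s α β ∧
          S = Multiset.replicate (n - 1) β + {α * β ^ t}) ∧
      (ShortProductOneFree S ↔
        ∃ (α β : G) (t : ℤ), IsPresentedBy n s α β ∧
          S = Multiset.replicate (n - 1) β + {α * β ^ t})) := by
  refine ⟨fun hS => ⟨exists_eq_of_productOneFreeOfLength hn hn4 hs hs1 hG hS, ?_⟩,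
    fun hS => ⟨exists_eq_of_productOneFreeOfLength_two_mul hn hn4 hs hs1 hG hS, ?_⟩, fun hS => ?_⟩
  · rintro ⟨α, β, t₁, t₂, t₃, h, ht, rfl⟩
    simpa only [one_mul] using
      productOneFreeOfLength_of_eq hn4 hn hs h (t₃ := t₃) ht (r := 1) le_rfl
  · rintro ⟨α, β, t₁, t₂, t₃, h, ht, rfl⟩
    exact productOneFreeOfLength_of_eq hn4 hn hs h ht (r := 2) (by norm_num)
  · rw [shortProductOneFree_iff (hG.exponent_eq hn4 hs) hS]
    exact ⟨productOneFree_iff_exists hn hn4 hs hs1 hG hS,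
      productOneFree_iff_exists hn hn4 hs hs1 hG hS⟩
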